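/- **Setting.** Let the states $a,b$ of the Basilica automaton act on finite binary words by $a(0w)=0\,b(w)$, $a(1w)=1w$, $b(0w)=1\,a(w)$, $b(1w)=0w$, and let $\Gamma_n$ be the Schreier graph on $\{0,1\}^n$, with one edge from $w$ to $s(w)$ for each $w$ and each $s\in\{a,b\}$. For $n\ge 2$, cutting $\Gamma_n$ at the degree-four vertex $0^n$ (replacing it by four vertices, one for each incident edge) produces two graphs with two boundary vertices each; let $G_n$ be the larger one. Its non-boundary vertices are the words of length $n$ that contain a $1$ and end in an even number of zeros. Its two boundary vertices are denoted $0^{n-1}x$ and $0^{n-1}y$; $x$ is attached to the edge that ends at $0^n$, and $y$ to the edge that starts at $0^n$ (for $n\ge3$ the neighbour of the former ends in $0$, and that of the latter in $1$). The Laplacian $L_n$ on $\mathbb R^{G_n}$ is $L_nf(u)=\sum_v c_{uv}(f(u)-f(v))$, where $c_{uv}$ is the number of edges joining $u$ and $v$. The *KNS spectral measure* is the weak limit, as $n\to\infty$, of the probability measures $|G_n|^{-1}\sum_j\delta_{\lambda_j}$, where $\lambda_j$ runs over the eigenvalues of $L_n$, repeated according to multiplicity. An *infinite blowup* $G_\infty$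 is the direct limit of graphs $G_{k_1}\to G_{k_2}\to\cdots$, where $k_1=2$, $k_{n+1}-k_n\in\{1,2\}$, and the morphisms are as follows. If $k_{n+1}-k_n=1$, the morphism appends $1$ to non-boundary words and replaces both $x$ and $y$ by $01$. If $k_{n+1}-k_n=2$, it either appends $00$ to non-boundary words and replaces $x\mapsto 00x$, $y\mapsto 001$, or appends $01$ to non-boundary words and replaces $x\mapsto 001$, $y\mapsto 00y$. The Laplacian $L_\infty$ on the real Hilbert space $\ell^2(G_\infty)$ is $L_\infty f(p)=\sum_q c_{pq}(f(p)-f(q))$, where $c_{pq}$ is the number of edges of $G_\infty$ joining $p$ and $q$; it is a bounded operator. **Corollary.** The KNS spectral measure $\mu$ exists. For every infinite blowup such that both $k_{n+1}-k_n=1$ and $k_{n+1}-k_n=2$ occur for infinitely many $n$, the spectrum of $L_\infty$ is equal to the support of $\mu$, and it is a Cantor set, that is, a non-empty, compact, perfect and totally disconnected subset of $\mathbb R$. -/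

import Mathlib

namespace Basilica

/-! ### The Basilica automaton and the graphs `G_n` -/

/-- The two non-identity states `a`, `b` of the Basilica automaton. -/
inductive Gen
  | a
  | b
  deriving DecidableEq

instance : Fintype Gen := ⟨{.a, .b}, fun s => by cases s <;> simp⟩

/-- The action of the states of the Basilica automaton on finite binary words (`false` is the
letter `0`, `true` is the letter `1`): `a(0w) = 0 b(w)`, `a(1w) = 1w`, `b(0w) = 1 a(w)`,
`b(1w) = 0w`. -/
def act : Gen → List Bool → List Bool
  | _, [] => []
  | .a, false :: w => false :: act .b w
  | .a, true :: w => true :: w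
  | .b, false :: w => true :: act .a w
  | .b, true :: w => false :: w

/-- The word `0^n`. -/
abbrev zeros (n : ℕ) : List Bool := List.replicate n false

/-- `w` contains the letter `1`, and the number of `0`s after its last `1` is even. -/
def EvenTail (w : List Bool) : Prop :=
  ∃ (v : List Bool) (j : ℕ), w = v ++ true :: zeros (2 * j)

/-- The two boundary vertices `0^{n-1}x` and `0^{n-1}y` of `G_n`. -/
inductive Bdry
  | x
  | y
  deriving DecidableEq

instance : Fintype Bdry := ⟨{.x, .y}, fun s => by cases s <;> simp⟩

/-- The vertices of `G_n` (`n ≥ 1`): the vertices of the larger of the two pieces into which the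
Schreier graph `Γ_n` falls when the vertex `0^n` is cut, and the two boundary vertices that
replace `0^n` in this piece. -/
abbrev Vtx (n : ℕ) : Type := {w : List Bool // w.length = n ∧ EvenTail w} ⊕ Bdry

/-- `Edge n s u v`: in `G_n` there is an edge with label `s` directed from `u` to `v`.
Edges of the Schreier graph `Γ_n` go from `w` to `s w`. Of the two edges at `0^n` that belong to
`G_n`, the one that ends at `0^n` is attached to `x` and the one that starts there to `y`. -/
def Edge (n : ℕ) (s : Gen) : Vtx n → Vtx n → Prop
  | .inl w, .inl w' => act s w.1 = w'.1
  | .inl w, .inr .x => act s w.1 = zeros n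
  | .inr .y, .inl w' => act s (zeros n) = w'.1
  | _, _ => False

open Classical in
/-- The number `c_{uv}` of edges that join two distinct vertices `u` and `v` (forgetting
directions) in a directed graph with labelled edges. Loops do not matter for the Laplacian. -/
noncomputable def edgeCount {V : Type*} (E : Gen → V → V → Prop) (u v : V) : ℕ :=
  ∑ s : Gen, ((if E s u v then 1 else 0) + (if E s v u then 1 else 0))

theorem edgeCount_comm {V : Type*} (E : Gen → V → V → Prop) (u v : V) :
    edgeCount E u v = edgeCount E v u :=
  Finset.sum_congr rfl fun _ _ => add_comm _ _

instance (n : ℕ) : Finite {w : List Bool // w.length = n ∧ EvenTail w} :=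
  ((List.finite_length_eq Bool n).subset fun _ h => h.1).to_subtype

noncomputable instance (n : ℕ) : Fintype {w : List Bool // w.length = n ∧ EvenTail w} :=
  Fintype.ofFinite _

instance (n : ℕ) : Nonempty (Vtx n) := ⟨.inr .x⟩

/-! ### The finite Laplacians and the KNS spectral measure -/

/-- The matrix of the Laplacian `L_n` on `ℝ^{G_n}`,
`L_n f (u) = ∑_v c_{uv} (f u - f v)`. -/
noncomputable def lapMatrix (n : ℕ) : Matrix (Vtx n) (Vtx n) ℝ :=
  Matrix.diagonal (fun u => ∑ v, (edgeCount (Edge n) u v : ℝ)) -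
    Matrix.of fun u v => (edgeCount (Edge n) u v : ℝ)

open Matrix in
theorem lapMatrix_mulVec (n : ℕ) (f : Vtx n → ℝ) (u : Vtx n) :
    (lapMatrix n *ᵥ f) u = ∑ v, (edgeCount (Edge n) u v : ℝ) * (f u - f v) := by
  simp only [lapMatrix, Matrix.sub_mulVec, Pi.sub_apply, Matrix.mulVec_diagonal, mul_sub,
    Finset.sum_sub_distrib, Finset.sum_mul]
  rfl

theorem lapMatrix_isHermitian (n : ℕ) : (lapMatrix n).IsHermitian := by
  refine (Matrix.isHermitian_diagonal _).sub ?_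
  ext u v
  simp [Matrix.conjTranspose, edgeCount_comm (Edge n) u v]

/-- The normalized spectral measure of `L_n`: the sum of the Dirac masses at the eigenvalues of
`L_n`, repeated according to multiplicity, divided by the number of vertices of `G_n`. -/
noncomputable def spectralMeasure (n : ℕ) : MeasureTheory.Measure ℝ :=
  (Fintype.card (Vtx n) : ENNReal)⁻¹ •
    ∑ i, MeasureTheory.Measure.dirac ((lapMatrix_isHermitian n).eigenvalues i)

theorem isProbabilityMeasure_spectralMeasure (n : ℕ) :
    MeasureTheory.IsProbabilityMeasure (spectralMeasure n) := by
  constructor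
  simp only [spectralMeasure, MeasureTheory.Measure.smul_apply,
    MeasureTheory.Measure.coe_finsetSum, Finset.sum_apply, MeasureTheory.measure_univ, smul_eq_mul,
    Finset.sum_const, Finset.card_univ, nsmul_eq_mul, mul_one]
  exact ENNReal.inv_mul_cancel (Nat.cast_ne_zero.2 Fintype.card_ne_zero)
    (ENNReal.natCast_ne_top _)

/-- `spectralMeasure n` as a probability measure. -/
noncomputable def spectralProbability (n : ℕ) : MeasureTheory.ProbabilityMeasure ℝ :=
  ⟨spectralMeasure n, isProbabilityMeasure_spectralMeasure n⟩

/-- `μ` is the Kesten--von Neumann--Serre spectral measure: the weak limit of the normalized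
spectral measures of the Laplacians `L_n`. -/
def IsKNSMeasure (μ : MeasureTheory.ProbabilityMeasure ℝ) : Prop :=
  Filter.Tendsto spectralProbability Filter.atTop (nhds μ)

/-! ### Blowups -/

/-- The three kinds of maps used in a blowup; they append the words `1`, `00`, `01`. -/
inductive Step
  | one
  | zeroZero
  | zeroOne

/-- The length of the appended word. -/
def Step.size : Step → ℕ
  | .one => 1
  | .zeroZero => 2
  | .zeroOne => 2

theorem EvenTail.append_one (w : List Bool) : EvenTail (w ++ [true]) := ⟨w, 0, rfl⟩

theorem EvenTail.append_zeroOne (w : List Bool) : EvenTail (w ++ [false, true]) :=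
  ⟨w ++ [false], 0, by simp⟩

theorem EvenTail.append_zeroZero {w : List Bool} (h : EvenTail w) :
    EvenTail (w ++ [false, false]) := by
  obtain ⟨v, j, rfl⟩ := h
  exact ⟨v, j + 1, by simp [Nat.mul_add, List.replicate_add]⟩

/-- The embedding morphisms `G_n → G_{n+1}` (append `1`, and `x, y ↦ 01`) and `G_n → G_{n+2}`
(append `00`, and `x ↦ 00x`, `y ↦ 001`; or append `01`, and `x ↦ 001`, `y ↦ 00y`). The boundary
vertices of `G_n` being `0^{n-1}x` and `0^{n-1}y`, the words `0^{n-1}01` and `0^{n-1}001` are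
`0^n 1` and `0^n 01`. -/
def Step.map {n : ℕ} : (t : Step) → Vtx n → Vtx (n + t.size)
  | .one, .inl w => .inl ⟨w.1 ++ [true], by simp [w.2.1, Step.size], .append_one _⟩
  | .one, .inr _ => .inl ⟨zeros n ++ [true], by simp [Step.size], .append_one _⟩
  | .zeroZero, .inl w =>
      .inl ⟨w.1 ++ [false, false], by simp [w.2.1, Step.size], .append_zeroZero w.2.2⟩
  | .zeroZero, .inr .x => .inr .x
  | .zeroZero, .inr .y =>
      .inl ⟨zeros n ++ [false, true], by simp [Step.size], .append_zeroOne _⟩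
  | .zeroOne, .inl w =>
      .inl ⟨w.1 ++ [false, true], by simp [w.2.1, Step.size], .append_zeroOne _⟩
  | .zeroOne, .inr .x =>
      .inl ⟨zeros n ++ [false, true], by simp [Step.size], .append_zeroOne _⟩
  | .zeroOne, .inr .y => .inr .y

/-! ### Basic facts on edges -/

theorem act_append {s : Gen} {w : List Bool} (h : true ∈ w) (t : List Bool) :
    act s (w ++ t) = act s w ++ t := by
  induction w generalizing s with
  | nil => simp at h
  | cons c w ih =>
    cases c
    · have h' : true ∈ w := by simpa using h
      cases s <;> simp [act, ih h']
    · cases s <;> simp [act]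

theorem act_injective (s : Gen) : Function.Injective (act s) := by
  intro w w'
  induction w generalizing s w' with
  | nil => cases w' with
    | nil => simp
    | cons c w' => cases s <;> cases c <;> simp [act]
  | cons c w ih =>
    cases w' with
    | nil => cases s <;> cases c <;> simp [act]
    | cons c' w' =>
      cases s <;> cases c <;> cases c' <;> simp [act] <;> exact fun h => ih _ h

theorem EvenTail.mem {w : List Bool} (h : EvenTail w) : true ∈ w := by
  obtain ⟨v, j, rfl⟩ := h
  simp

theorem not_evenTail_one_zero (u : List Bool) : ¬ EvenTail (u ++ [true, false]) := by
  rintro ⟨v, j, h⟩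
  have h := congrArg List.reverse h
  cases j with
  | zero => simp at h
  | succ j => simp [Nat.mul_add, List.replicate_add] at h

theorem act_zeros (s : Gen) (n : ℕ) :
    ((∀ t, act s (zeros n ++ t) = act s (zeros n) ++ act .a t) ∧
      (n = 0 ∨ ∃ u, act s (zeros n) = u ++ [true])) ∨
    ((∀ t, act s (zeros n ++ t) = act s (zeros n) ++ act .b t) ∧ ¬ EvenTail (act s (zeros n))) := by
  induction n with
  | zero =>
    cases s
    · exact .inl ⟨by simp [act], .inl rfl⟩
    · exact .inr ⟨by simp [act], fun h => by simpa [act] using h.mem⟩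
  | succ n ih =>
    have hz : zeros (n + 1) = zeros n ++ [false] := List.replicate_succ'
    rcases ih with ⟨h, hu⟩ | ⟨h, -⟩
    · refine .inr ⟨fun t => ?_, ?_⟩
      · rw [hz, List.append_assoc, h, h]
        simp [act]
      · rw [hz, h]
        rcases hu with rfl | ⟨u, hu⟩
        · exact fun h => by simpa [act] using h.mem
        · rw [hu]
          simpa [act] using not_evenTail_one_zero u
    · refine .inl ⟨fun t => ?_, .inr ⟨act s (zeros n), ?_⟩⟩
      · rw [hz, List.append_assoc, h, h]
        simp [act]
      · rw [hz, h]
        simp [act]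

theorem edge_map {n : ℕ} (t : Step) {s : Gen} {u v : Vtx n} (e : Edge n s u v) :
    Edge (n + t.size) s (t.map u) (t.map v) := by
  have hz : zeros (n + 2) = zeros n ++ [false, false] := List.replicate_add ..
  match u, v, e with
  | .inl w, .inl w', e =>
    have e : act s w.1 = w'.1 := e
    cases t <;> simp [Step.map, Edge, act_append w.2.2.mem, e]
  | .inl w, .inr .x, e =>
    have e : act s w.1 = zeros n := e
    cases t <;> simp [Step.map, Edge, act_append w.2.2.mem, e, Step.size, hz]
  | .inr .y, .inl w', e =>
    have e : act s (zeros n) = w'.1 := e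
    have h : ∀ t, act s (zeros n ++ t) = act s (zeros n) ++ act .a t := by
      rcases act_zeros s n with h | h
      · exact h.1
      · exact absurd (e ▸ w'.2.2) h.2
    cases t <;> simp [Step.map, Edge, h, e, Step.size, hz, act]

theorem not_evenTail_zeros (n : ℕ) : ¬ EvenTail (zeros n) := fun h => by simpa using h.mem

theorem edge_right_unique {n : ℕ} {s : Gen} {u v v' : Vtx n} (e : Edge n s u v)
    (e' : Edge n s u v') : v = v' := by
  match u, v, v', e, e' with
  | .inl w, .inl w₁, .inl w₂, e, e' => exact congrArg _ (Subtype.ext (e.symm.trans e'))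
  | .inl w, .inl w₁, .inr .x, e, e' =>
    exact absurd (e.symm.trans e' ▸ w₁.2.2) (not_evenTail_zeros n)
  | .inl w, .inr .x, .inl w₁, e, e' =>
    exact absurd (e'.symm.trans e ▸ w₁.2.2) (not_evenTail_zeros n)
  | .inl w, .inr .x, .inr .x, e, e' => rfl
  | .inr .y, .inl w₁, .inl w₂, e, e' => exact congrArg _ (Subtype.ext (e.symm.trans e'))

theorem edge_left_unique {n : ℕ} {s : Gen} {u u' v : Vtx n} (e : Edge n s u v)
    (e' : Edge n s u' v) : u = u' := by
  match u, u', v, e, e' with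
  | .inl w, .inl w', .inl w₁, e, e' =>
    exact congrArg _ (Subtype.ext (act_injective s (Eq.trans e e'.symm)))
  | .inl w, .inl w', .inr .x, e, e' =>
    exact congrArg _ (Subtype.ext (act_injective s (Eq.trans e e'.symm)))
  | .inl w, .inr .y, .inl w₁, e, e' =>
    exact absurd (act_injective s (Eq.trans e e'.symm) ▸ w.2.2) (not_evenTail_zeros n)
  | .inr .y, .inl w, .inl w₁, e, e' =>
    exact absurd (act_injective s (Eq.trans e' e.symm) ▸ w.2.2) (not_evenTail_zeros n)
  | .inr .y, .inr .y, .inl w₁, e, e' => rfl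

/-! ### The Laplacian on `ℓ²` -/

section Laplacian

variable {V : Type*} (E : Gen → V → V → Prop)

theorem sum_edgeCount_le (hr : ∀ s p q q', E s p q → E s p q' → q = q')
    (hl : ∀ s p p' q, E s p q → E s p' q → p = p') (p : V) (T : Finset V) :
    ∑ q ∈ T, edgeCount E p q ≤ 4 := by
  classical
  have h : ∀ P : V → Prop, (∀ q q', P q → P q' → q = q') →
      ∑ q ∈ T, (if P q then 1 else 0) ≤ 1 := by
    intro P hP
    rw [← Finset.card_filter, Finset.card_le_one]
    intro q hq q' hq'
    exact hP q q' (Finset.mem_filter.1 hq).2 (Finset.mem_filter.1 hq').2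
  have h1 : ∀ s : Gen, ∑ q ∈ T, ((if E s p q then 1 else 0) + (if E s q p then 1 else 0)) ≤ 2 := by
    intro s
    rw [Finset.sum_add_distrib]
    exact add_le_add (h _ (hr s p)) (h _ fun q q' => hl s q q' p)
  calc ∑ q ∈ T, edgeCount E p q
      = ∑ s : Gen, ∑ q ∈ T, ((if E s p q then 1 else 0) + (if E s q p then 1 else 0)) := by
        simp only [edgeCount]
        rw [Finset.sum_comm]
    _ ≤ ∑ s : Gen, 2 := Finset.sum_le_sum fun s _ => h1 s
    _ = 4 := rfl

theorem finite_edgeCount (hr : ∀ s p q q', E s p q → E s p q' → q = q')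
    (hl : ∀ s p p' q, E s p q → E s p' q → p = p') (p : V) :
    {q | edgeCount E p q ≠ 0}.Finite := by
  classical
  refine Set.Finite.subset (s := ⋃ s : Gen, ({q | E s p q} ∪ {q | E s q p})) ?_ ?_
  · refine Set.finite_iUnion fun s => Set.Finite.union ?_ ?_
    · exact Set.Subsingleton.finite fun q h q' h' => hr s p q q' h h'
    · exact Set.Subsingleton.finite fun q h q' h' => hl s q q' p h h'
  · intro q hq
    by_contra h
    simp only [Set.mem_iUnion, Set.mem_union, Set.mem_ofPred_eq, not_exists, not_or] at h
    exact hq (by simp [edgeCount, h])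

/-- The function `p ↦ ∑_q c_{pq} (f p - f q)`. -/
noncomputable def lapFun (f : V → ℝ) (p : V) : ℝ :=
  ∑' q, (edgeCount E p q : ℝ) * (f p - f q)

theorem sum_lapFun_sq_le (hr : ∀ s p q q', E s p q → E s p q' → q = q')
    (hl : ∀ s p p' q, E s p q → E s p' q → p = p') (f : lp (fun _ : V => ℝ) 2) (S : Finset V) :
    ∑ p ∈ S, lapFun E f p ^ 2 ≤ (8 * ‖f‖) ^ 2 := by
  classical
  set N : V → Finset V := fun p => (finite_edgeCount E hr hl p).toFinset with hN
  have hsq : ∀ T : Finset V, ∑ q ∈ T, f q ^ 2 ≤ ‖f‖ ^ 2 := by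
    intro T
    have := lp.sum_rpow_le_norm_rpow (p := 2) (by simp) f T
    simpa using this
  have hcast : ∀ (p : V) (T : Finset V), ∑ q ∈ T, (edgeCount E p q : ℝ) ≤ 4 := fun p T => by
    exact_mod_cast sum_edgeCount_le E hr hl p T
  have hval : ∀ p, lapFun E f p = ∑ q ∈ N p, (edgeCount E p q : ℝ) * (f p - f q) := by
    intro p
    refine tsum_eq_sum fun q hq => ?_
    have : edgeCount E p q = 0 := by simpa [hN] using hq
    simp [this]
  have hpt : ∀ p, lapFun E f p ^ 2 ≤
      8 * ∑ q ∈ N p, (edgeCount E p q : ℝ) * (f p ^ 2 + f q ^ 2) := by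
    intro p
    have hcs := Finset.sum_sq_le_sum_mul_sum_of_sq_le_mul (N p)
      (r := fun q => (edgeCount E p q : ℝ) * (f p - f q)) (f := fun q => (edgeCount E p q : ℝ))
      (g := fun q => (edgeCount E p q : ℝ) * (f p - f q) ^ 2)
      (fun q _ => by positivity) (fun q _ => by positivity) (fun q _ => le_of_eq (by ring))
    have h2 : ∑ q ∈ N p, (edgeCount E p q : ℝ) * (f p - f q) ^ 2 ≤
        2 * ∑ q ∈ N p, (edgeCount E p q : ℝ) * (f p ^ 2 + f q ^ 2) := by
      rw [Finset.mul_sum]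
      refine Finset.sum_le_sum fun q _ => ?_
      have : (0 : ℝ) ≤ edgeCount E p q := by positivity
      nlinarith [mul_nonneg this (sq_nonneg (f p + f q))]
    have h0 : 0 ≤ ∑ q ∈ N p, (edgeCount E p q : ℝ) * (f p - f q) ^ 2 :=
      Finset.sum_nonneg fun q _ => by positivity
    rw [hval]
    nlinarith [hcast p (N p), mul_le_mul_of_nonneg_right (hcast p (N p)) h0]
  have hA : ∑ p ∈ S, ∑ q ∈ N p, (edgeCount E p q : ℝ) * f p ^ 2 ≤ 4 * ‖f‖ ^ 2 := by
    calc ∑ p ∈ S, ∑ q ∈ N p, (edgeCount E p q : ℝ) * f p ^ 2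
        ≤ ∑ p ∈ S, 4 * f p ^ 2 := by
          refine Finset.sum_le_sum fun p _ => ?_
          rw [← Finset.sum_mul]
          exact mul_le_mul_of_nonneg_right (hcast p _) (sq_nonneg _)
      _ ≤ 4 * ‖f‖ ^ 2 := by
          rw [← Finset.mul_sum]
          linarith [hsq S]
  have hB : ∑ p ∈ S, ∑ q ∈ N p, (edgeCount E p q : ℝ) * f q ^ 2 ≤ 4 * ‖f‖ ^ 2 := by
    calc ∑ p ∈ S, ∑ q ∈ N p, (edgeCount E p q : ℝ) * f q ^ 2
        ≤ ∑ p ∈ S, ∑ q ∈ S.biUnion N, (edgeCount E p q : ℝ) * f q ^ 2 := by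
          refine Finset.sum_le_sum fun p hp => ?_
          exact Finset.sum_le_sum_of_subset_of_nonneg (Finset.subset_biUnion_of_mem N hp)
            fun q _ _ => by positivity
      _ = ∑ q ∈ S.biUnion N, (∑ p ∈ S, (edgeCount E q p : ℝ)) * f q ^ 2 := by
          rw [Finset.sum_comm]
          refine Finset.sum_congr rfl fun q _ => ?_
          rw [Finset.sum_mul]
          exact Finset.sum_congr rfl fun p _ => by rw [edgeCount_comm]
      _ ≤ ∑ q ∈ S.biUnion N, 4 * f q ^ 2 :=
          Finset.sum_le_sum fun q _ => mul_le_mul_of_nonneg_right (hcast q _) (sq_nonneg _)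
      _ ≤ 4 * ‖f‖ ^ 2 := by
          rw [← Finset.mul_sum]
          linarith [hsq (S.biUnion N)]
  calc ∑ p ∈ S, lapFun E f p ^ 2
      ≤ ∑ p ∈ S, 8 * ∑ q ∈ N p, (edgeCount E p q : ℝ) * (f p ^ 2 + f q ^ 2) :=
        Finset.sum_le_sum fun p _ => hpt p
    _ = 8 * (∑ p ∈ S, ∑ q ∈ N p, (edgeCount E p q : ℝ) * f p ^ 2 +
          ∑ p ∈ S, ∑ q ∈ N p, (edgeCount E p q : ℝ) * f q ^ 2) := by
        simp only [mul_add, Finset.sum_add_distrib, Finset.mul_sum]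
    _ ≤ (8 * ‖f‖) ^ 2 := by nlinarith

theorem memℓp_lapFun (hr : ∀ s p q q', E s p q → E s p q' → q = q')
    (hl : ∀ s p p' q, E s p q → E s p' q → p = p') (f : lp (fun _ : V => ℝ) 2) :
    Memℓp (lapFun E f) 2 := by
  refine memℓp_gen' (C := (8 * ‖f‖) ^ 2) fun S => ?_
  simpa using sum_lapFun_sq_le E hr hl f S

theorem summable_lapFun (hr : ∀ s p q q', E s p q → E s p q' → q = q')
    (hl : ∀ s p p' q, E s p q → E s p' q → p = p') (f : V → ℝ) (p : V) :
    Summable fun q => (edgeCount E p q : ℝ) * (f p - f q) := by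
  refine summable_of_ne_finset_zero (s := (finite_edgeCount E hr hl p).toFinset) fun q hq => ?_
  have : edgeCount E p q = 0 := by simpa using hq
  simp [this]

/-- The Laplacian `f ↦ (p ↦ ∑_q c_{pq} (f p - f q))` as a bounded operator on `ℓ²`, for a directed
graph in which every vertex has at most one incoming and one outgoing edge of each label. -/
noncomputable def graphLaplacian (hr : ∀ s p q q', E s p q → E s p q' → q = q')
    (hl : ∀ s p p' q, E s p q → E s p' q → p = p') :
    lp (fun _ : V => ℝ) 2 →L[ℝ] lp (fun _ : V => ℝ) 2 :=
  LinearMap.mkContinuous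
    { toFun := fun f => ⟨lapFun E f, memℓp_lapFun E hr hl f⟩
      map_add' := fun f g => by
        ext p
        have hf := summable_lapFun E hr hl f p
        have hg := summable_lapFun E hr hl g p
        change lapFun E (f + g : lp (fun _ : V => ℝ) 2) p = lapFun E f p + lapFun E g p
        simp only [lapFun]
        rw [← hf.tsum_add hg]
        refine tsum_congr fun q => ?_
        simp only [lp.coeFn_add, Pi.add_apply]
        ring
      map_smul' := fun c f => by
        ext p
        change lapFun E (c • f : lp (fun _ : V => ℝ) 2) p = c * lapFun E f p
        simp only [lapFun]
        rw [← tsum_mul_left]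
        refine tsum_congr fun q => ?_
        simp only [lp.coeFn_smul, Pi.smul_apply, smul_eq_mul]
        ring }
    8
    (fun f => by
      refine lp.norm_le_of_forall_sum_le (by simp) (by positivity) fun S => ?_
      simpa using sum_lapFun_sq_le E hr hl f S)

end Laplacian

/-! ### The infinite graphs -/

/-- An infinite blowup of the graphs `G_n` is given by an infinite sequence of steps. -/
structure Blowup where
  step : ℕ → Step

namespace Blowup

variable (B : Blowup)

/-- The levels `k`, starting at `2`, with differences `1` or `2`. -/
def level : ℕ → ℕ
  | 0 => 2
  | m + 1 => level m + (B.step m).size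

/-- The morphism `ι : G_{k_m} → G_{k_{m+1}}`. -/
def next (m : ℕ) : Vtx (B.level m) → Vtx (B.level (m + 1)) := (B.step m).map

/-- The composition `G_{k_i} → G_{k_j}`, `i ≤ j`, of the morphisms `ι`. -/
def trans (i j : ℕ) (h : i ≤ j) : Vtx (B.level i) → Vtx (B.level j) :=
  Nat.leRecOn h (fun {m} => B.next m)

theorem trans_self (i : ℕ) (u : Vtx (B.level i)) : B.trans i i le_rfl u = u :=
  Nat.leRecOn_self (C := fun m => Vtx (B.level m)) u

theorem trans_trans {i j l : ℕ} (h : i ≤ j) (h' : j ≤ l) (u : Vtx (B.level i)) :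
    B.trans j l h' (B.trans i j h u) = B.trans i l (h.trans h') u :=
  (Nat.leRecOn_trans (C := fun m => Vtx (B.level m)) h h' u).symm

theorem trans_succ {i j : ℕ} (h : i ≤ j) (u : Vtx (B.level i)) :
    B.trans i (j + 1) (h.trans (Nat.le_succ j)) u = B.next j (B.trans i j h u) :=
  Nat.leRecOn_succ (C := fun m => Vtx (B.level m)) h u

/-- The equivalence relation that defines the direct limit: two vertices at finite levels are
identified if they have the same image at some higher level. -/
def limitSetoid : Setoid (Σ m, Vtx (B.level m)) where
  r p q := ∃ (j : ℕ) (hp : p.1 ≤ j) (hq : q.1 ≤ j), B.trans p.1 j hp p.2 = B.trans q.1 j hq q.2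
  iseqv :=
    { refl := fun p => ⟨p.1, le_rfl, le_rfl, rfl⟩
      symm := fun ⟨j, hp, hq, h⟩ => ⟨j, hq, hp, h.symm⟩
      trans := fun ⟨j, hp, hq, h⟩ ⟨l, hq', hr, h'⟩ =>
        ⟨max j l, hp.trans (le_max_left _ _), hr.trans (le_max_right _ _), by
          rw [← B.trans_trans hp (le_max_left _ _), h, B.trans_trans,
            ← B.trans_trans hr (le_max_right _ _), ← h', B.trans_trans]⟩ }

/-- The vertex set of `G_∞`: the direct limit (in the category of sets) of the vertex sets of the
`G_{k_m}`. -/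
def Vertex : Type := Quotient B.limitSetoid

/-- The canonical map `G_{k_m} → G_∞`. -/
def toLimit (m : ℕ) (u : Vtx (B.level m)) : B.Vertex := Quotient.mk B.limitSetoid ⟨m, u⟩

theorem toLimit_surj (p : B.Vertex) : ∃ m u, B.toLimit m u = p := by
  obtain ⟨⟨m, u⟩, rfl⟩ := Quotient.exists_rep p
  exact ⟨m, u, rfl⟩

theorem toLimit_eq_iff {m l : ℕ} (u : Vtx (B.level m)) (v : Vtx (B.level l)) :
    B.toLimit m u = B.toLimit l v ↔
      ∃ (j : ℕ) (hm : m ≤ j) (hl : l ≤ j), B.trans m j hm u = B.trans l j hl v :=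
  Quotient.eq (r := B.limitSetoid)

theorem toLimit_trans {m j : ℕ} (h : m ≤ j) (u : Vtx (B.level m)) :
    B.toLimit j (B.trans m j h u) = B.toLimit m u :=
  (B.toLimit_eq_iff _ _).2 ⟨j, le_rfl, h, B.trans_self _ _⟩

/-- The labelled directed edges of `G_∞`: the images of the edges of the `G_{k_m}`. For each label
at most one edge leaves a vertex, so distinct edges of `G_∞` differ in label or source. -/
def LimEdge (s : Gen) (p q : B.Vertex) : Prop :=
  ∃ (m : ℕ) (u v : Vtx (B.level m)), B.toLimit m u = p ∧ B.toLimit m v = q ∧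
    Edge (B.level m) s u v

theorem edge_trans {m j : ℕ} (h : m ≤ j) {s : Gen} {u v : Vtx (B.level m)}
    (e : Edge (B.level m) s u v) :
    Edge (B.level j) s (B.trans m j h u) (B.trans m j h v) := by
  induction j, h using Nat.le_induction with
  | base => rwa [trans_self, trans_self]
  | succ j h ih =>
    rw [B.trans_succ h, B.trans_succ h]
    exact edge_map _ ih

theorem limEdge_right_unique (s : Gen) (p q q' : B.Vertex) (h : B.LimEdge s p q)
    (h' : B.LimEdge s p q') : q = q' := by
  obtain ⟨m, u, v, rfl, rfl, e⟩ := h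
  obtain ⟨l, u', v', hu, rfl, e'⟩ := h'
  obtain ⟨j, hl, hm, hj⟩ := (B.toLimit_eq_iff _ _).1 hu
  have e1 := B.edge_trans hm e
  have e2 := B.edge_trans hl e'
  rw [hj] at e2
  rw [← B.toLimit_trans hm, ← B.toLimit_trans hl, edge_right_unique e1 e2]

theorem limEdge_left_unique (s : Gen) (p p' q : B.Vertex) (h : B.LimEdge s p q)
    (h' : B.LimEdge s p' q) : p = p' := by
  obtain ⟨m, u, v, rfl, rfl, e⟩ := h
  obtain ⟨l, u', v', rfl, hv, e'⟩ := h'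
  obtain ⟨j, hl, hm, hj⟩ := (B.toLimit_eq_iff _ _).1 hv
  have e1 := B.edge_trans hm e
  have e2 := B.edge_trans hl e'
  rw [hj] at e2
  rw [← B.toLimit_trans hm, ← B.toLimit_trans hl, edge_left_unique e1 e2]

/-- The Laplacian `L_∞` on `ℓ²(G_∞)`,
`L_∞ f (p) = ∑_q c_{pq} (f p - f q)`, where `c_{pq}` is the number of edges joining `p` and `q`. -/
noncomputable def laplacian :
    lp (fun _ : B.Vertex => ℝ) 2 →L[ℝ] lp (fun _ : B.Vertex => ℝ) 2 :=
  graphLaplacian B.LimEdge B.limEdge_right_unique B.limEdge_left_unique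

theorem laplacian_apply (f : lp (fun _ : B.Vertex => ℝ) 2) (p : B.Vertex) :
    B.laplacian f p = ∑' q, (edgeCount B.LimEdge p q : ℝ) * (f p - f q) := rfl

/-- The genericity condition: both `k_{m+1} - k_m = 1` and `k_{m+1} - k_m = 2` occur for infinitely
many `m`. -/
def IsGeneric : Prop :=
  {m : ℕ | B.level (m + 1) = B.level m + 1}.Infinite ∧
    {m : ℕ | B.level (m + 1) = B.level m + 2}.Infinite

end Blowup

/-- A subset of the line is a Cantor set if it is non-empty, compact, perfect and totally
disconnected. -/
def IsCantorSet (S : Set ℝ) : Prop :=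
  S.Nonempty ∧ IsCompact S ∧ Perfect S ∧ IsTotallyDisconnected S

end Basilica

/-! `G_{n+2}` consists of two copies of `G_n` and a copy of `G_{n+1}` with its two boundary vertices
identified, all meeting in one vertex. Let `Z` = `pivotZeros` be the set of Dirichlet eigenvalues of
all the `G_n`. Both the spectrum of a generic blowup and the support of `μ` turn out to be the
closure of `Z`, and this closure is shown to be a Cantor set by one-dimensional dynamics.

For fixed `t`, eliminating all non-boundary vertices leaves a symmetric 2×2 response matrix (the
Dirichlet-to-Neumann map), and the decomposition gives a scalar recursion for its entries. Its
denominators are the pivots; they vanish exactly when a new Dirichlet eigenvalue appears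
(`IsSol.response`, `exists_dirichlet_eigenfunction`). In the coordinates `tau`, `kappa` two steps of
the recursion are one rational map. Just beside a zero of a pivot the orbit enters near `(0, 0)`,
with `tau` of opposite signs on the two sides. Negative `tau` is trapped, so one side borders a gap.
Positive `tau` grows until a further pivot vanishes, so zeros accumulate on the other side
(`gap_and_accumulation`). Hence the closure of `Z` is perfect and contains no interval.

Each point of `Z` has an eigenfunction for which both boundary values and both normal derivatives
vanish (`exists_localized`). It extends by zero to every larger graph, so it puts `t` into the
spectrum of every blowup; copying it gives multiplicities proportional to the number of vertices, so
`μ` has an atom at `t`. Conversely, in an interval that misses `Z` the matrix `L_n` has at most two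
eigenvalues, because the corresponding spectral subspace injects into the boundary values
(`card_eigenvalues_le_two`). In a generic blowup every finitely supported function is a Dirichlet
function on some `G_n`, so `L_∞ - c` is bounded below when `c` is not in the closure of `Z`
(`IsGeneric.le_norm_sub`).

The measure `μ` exists because traces of powers satisfy `t_{n+2} = t_{n+1} + 2 t_n` up to bounded
errors, so all moments converge, and the eigenvalues stay in a fixed compact interval. -/

namespace Basilica

/-! ### The scalar recursion -/

/-- The entries of the response matrix `!![A, B; B, A]` of `G_{k-1}` at the spectral parameter
`t`. -/
noncomputable def response (t : ℝ) : ℕ → ℝ × ℝ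
  | 0 => (1, -1)
  | 1 => (1, -1)
  | k + 2 =>
    ((response t k).1 - (response t k).2 ^ 2 /
        (2 * (response t k).1 + 2 * ((response t (k + 1)).1 + (response t (k + 1)).2) - t),
      -(response t k).2 ^ 2 /
        (2 * (response t k).1 + 2 * ((response t (k + 1)).1 + (response t (k + 1)).2) - t))

/-- The diagonal entry of the response matrix. -/
noncomputable def respA (k : ℕ) (t : ℝ) : ℝ := (response t k).1

/-- The off-diagonal entry of the response matrix. -/
noncomputable def respB (k : ℕ) (t : ℝ) : ℝ := (response t k).2

/-- The pivot: the coefficient of the value at the middle vertex of `G_{k+1}` after the elimination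
of all other interior vertices. -/
noncomputable def pivot (k : ℕ) (t : ℝ) : ℝ :=
  2 * respA k t + 2 * (respA (k + 1) t + respB (k + 1) t) - t

theorem respA_zero (t : ℝ) : respA 0 t = 1 := rfl
theorem respA_one (t : ℝ) : respA 1 t = 1 := rfl
theorem respB_zero (t : ℝ) : respB 0 t = -1 := rfl
theorem respB_one (t : ℝ) : respB 1 t = -1 := rfl

theorem respB_add_two (k : ℕ) (t : ℝ) : respB (k + 2) t = -(respB k t) ^ 2 / pivot k t := rfl

theorem respA_add_two (k : ℕ) (t : ℝ) : respA (k + 2) t = respA k t + respB (k + 2) t := by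
  rw [respB_add_two, neg_div, ← sub_eq_add_neg]
  rfl

theorem pivot_zero (t : ℝ) : pivot 0 t = 2 - t := by
  simp [pivot, respA_zero, respA_one, respB_one]

/-- The identity `A_{k+2} = A_k + B_{k+2}` removes the diagonal entries and the explicit `t`: the
recursion closes up in the pivots and the off-diagonal entries. -/
theorem pivot_succ (k : ℕ) (t : ℝ) :
    pivot (k + 1) t = pivot k t - 2 * respB (k + 1) t - 4 * respB k t ^ 2 / pivot k t := by
  have h := respB_add_two k t
  have h' : 4 * respB k t ^ 2 / pivot k t = -4 * respB (k + 2) t := by rw [h]; ring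
  rw [h']
  simp only [pivot]
  rw [respA_add_two]
  ring

/-- `response t k` involves only the pivots of index at most `k - 2`; this explains the index ranges
in the hypotheses below. -/
theorem respB_ne_zero {t : ℝ} : ∀ {k : ℕ}, (∀ i, i + 2 ≤ k → pivot i t ≠ 0) → respB k t ≠ 0
  | 0, _ => by simp [respB_zero]
  | 1, _ => by simp [respB_one]
  | k + 2, h => by
    rw [respB_add_two]
    exact div_ne_zero
      (neg_ne_zero.2 (pow_ne_zero 2 (respB_ne_zero fun i hi => h i (by omega)))) (h k le_rfl)

/-- The response matrix has a non-positive derivative. -/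
theorem hasDerivAt_resp {t : ℝ} : ∀ (k : ℕ), (∀ i, i + 2 ≤ k → pivot i t ≠ 0) →
    ∃ a b : ℝ, HasDerivAt (respA k) a t ∧ HasDerivAt (respB k) b t ∧ |b| ≤ -a
  | 0, _ => ⟨0, 0, hasDerivAt_const t _, hasDerivAt_const t _, by simp⟩
  | 1, _ => ⟨0, 0, hasDerivAt_const t _, hasDerivAt_const t _, by simp⟩
  | k + 2, h => by
    obtain ⟨a, b, ha, hb, hab⟩ := hasDerivAt_resp (t := t) k fun i hi => h i (by omega)
    obtain ⟨a', b', ha', hb', hab'⟩ := hasDerivAt_resp (t := t) (k + 1) fun i hi => h i (by omega)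
    have hs : pivot k t ≠ 0 := h k le_rfl
    have hS : HasDerivAt (pivot k) (2 * a + 2 * (a' + b') - 1) t :=
      ((ha.const_mul 2).add ((ha'.add hb').const_mul 2)).sub (hasDerivAt_id t)
    have hB : HasDerivAt (respB (k + 2)) _ t :=
      (((hb.pow 2).neg).div hS hs).congr_of_eventuallyEq (.of_forall fun u => respB_add_two k u)
    have hA : HasDerivAt (respA (k + 2)) _ t :=
      (ha.add hB).congr_of_eventuallyEq (.of_forall fun u => respA_add_two k u)
    refine ⟨_, _, hA, hB, ?_⟩
    set c := respB k t / pivot k t with hc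
    set d := 2 * a + 2 * (a' + b') - 1 with hd
    -- The condition `|b| ≤ -a` says that the derivative matrix `!![a, b; b, a]` is negative
    -- semidefinite; in particular `a' + b' ≤ 0`.
    have hd' : d ≤ 2 * a := by
      have := le_abs_self b'
      linarith
    simp only [Pi.neg_apply, Pi.pow_apply]
    have e : ((-(↑2 * respB k t ^ (2 - 1) * b)) * pivot k t - -respB k t ^ 2 * d) / pivot k t ^ 2
        = -2 * c * b + c ^ 2 * d := by
      rw [hc]
      field_simp
      push_cast
      ring
    push_cast at e ⊢
    rw [e]
    obtain ⟨h1, h2⟩ := abs_le.1 hab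
    -- With `β` the new off-diagonal derivative, the new diagonal one is `a + β`, so the two
    -- inequalities are `a ≤ 0` and `a + 2β ≤ 0`.
    refine abs_le.2 ⟨?_, ?_⟩
    · linarith
    · have h3 : c ^ 2 * d ≤ c ^ 2 * (2 * a) := mul_le_mul_of_nonneg_left hd' (sq_nonneg c)
      -- The left side is the mean of `(a + b)(1 - 2c)²` and `(a - b)(1 + 2c)²`.
      have h4 : a + 2 * (-2 * c * b) + 4 * c ^ 2 * a ≤ 0 := by
        nlinarith [mul_nonneg (sub_nonneg.2 h2) (sq_nonneg (1 - 2 * c)),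
          mul_nonneg (sub_nonneg.2 h1) (sq_nonneg (1 + 2 * c))]
      nlinarith

/-- The response terms have non-positive derivatives and `-t` contributes `-1`. Hence a first zero
is simple, and the sign of the pivot on either side of it is known. -/
theorem hasDerivAt_pivot {t : ℝ} (k : ℕ) (h : ∀ i < k, pivot i t ≠ 0) :
    ∃ d ≤ (-1 : ℝ), HasDerivAt (pivot k) d t := by
  obtain ⟨a, b, ha, hb, hab⟩ := hasDerivAt_resp (t := t) k fun i hi => h i (by omega)
  obtain ⟨a', b', ha', hb', hab'⟩ := hasDerivAt_resp (t := t) (k + 1) fun i hi => h i (by omega)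
  refine ⟨2 * a + 2 * (a' + b') - 1, ?_,
    ((ha.const_mul 2).add ((ha'.add hb').const_mul 2)).sub (hasDerivAt_id t)⟩
  have h1 := le_abs_self b'
  have h2 := abs_nonneg b
  linarith

theorem continuousAt_pivot {t : ℝ} (k : ℕ) (h : ∀ i < k, pivot i t ≠ 0) :
    ContinuousAt (pivot k) t :=
  (hasDerivAt_pivot k h).choose_spec.2.continuousAt

theorem continuousAt_respB {t : ℝ} (k : ℕ) (h : ∀ i, i + 2 ≤ k → pivot i t ≠ 0) :
    ContinuousAt (respB k) t := by
  obtain ⟨_, _, _, hb, _⟩ := hasDerivAt_resp k h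
  exact hb.continuousAt

/-! ### The renormalized recursion -/

/-- The set of zeros of the pivots. -/
def pivotZeros : Set ℝ := {t | ∃ k, pivot k t = 0}

/-- The first coordinate of the renormalized recursion. -/
noncomputable def tau (k : ℕ) (t : ℝ) : ℝ := pivot k t / respB (k + 1) t

/-- The second coordinate of the renormalized recursion. -/
noncomputable def kappa (k : ℕ) (t : ℝ) : ℝ := (respB k t / pivot k t) ^ 2

/-- The ratio of consecutive pivots, renormalized. -/
noncomputable def sigma (k : ℕ) (t : ℝ) : ℝ := tau k t - 2 - 4 * kappa k t * tau k t

theorem kappa_nonneg (k : ℕ) (t : ℝ) : 0 ≤ kappa k t := sq_nonneg _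

theorem pivot_succ_eq_mul_sigma {k : ℕ} {t : ℝ} (hb : respB (k + 1) t ≠ 0) :
    pivot (k + 1) t = respB (k + 1) t * sigma k t := by
  rw [pivot_succ]
  simp only [sigma, tau, kappa]
  rcases eq_or_ne (pivot k t) 0 with h | h
  · simp [h]; ring
  · field_simp

/-- Together with `kappa_add_two` this makes two steps of the recursion an autonomous rational map.
At `kappa = 0` it is `τ ↦ τ(4 - τ)`: the origin is repelling with multiplier `4`, and `4` is sent to
it. -/
theorem tau_add_two {k : ℕ} {t : ℝ} (hb : respB (k + 1) t ≠ 0) (hs : pivot k t ≠ 0)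
    (hs' : pivot (k + 1) t ≠ 0) :
    tau (k + 2) t = tau k t *
      (4 - 12 * kappa k t - tau k t * (1 - 4 * kappa k t) * (1 - 2 * kappa k t)) := by
  have h1 := pivot_succ k t
  have h2 : tau (k + 2) t = 4 - pivot (k + 1) t / respB (k + 1) t *
      (pivot (k + 1) t / respB (k + 1) t + 2 * (kappa k t * tau k t)) := by
    have h3 : respB (k + 3) t = -(respB (k + 1) t) ^ 2 / pivot (k + 1) t := respB_add_two _ _
    simp only [tau, kappa]
    rw [h3, pivot_succ (k + 1), respB_add_two k]
    field_simp
    ring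
  have h4 : pivot (k + 1) t / respB (k + 1) t = sigma k t := by
    rw [pivot_succ_eq_mul_sigma hb]
    field_simp
  rw [h2, h4, sigma]
  ring

/-- Writing `tau (k + 2) = tau k * g`, the factor `tau k` cancels where it is nonzero and the new
`kappa` is `kappa² (sigma / g)²`. So `kappa` stays small as long as `sigma / g` is bounded. -/
theorem kappa_add_two {k : ℕ} {t : ℝ} (hb : respB (k + 1) t ≠ 0) (hs : pivot k t ≠ 0)
    (hs' : pivot (k + 1) t ≠ 0) :
    kappa (k + 2) t = (kappa k t * tau k t * sigma k t / tau (k + 2) t) ^ 2 := by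
  have h4 : sigma k t = pivot (k + 1) t / respB (k + 1) t := by
    rw [pivot_succ_eq_mul_sigma hb]
    field_simp
  have h3 : respB (k + 3) t = -(respB (k + 1) t) ^ 2 / pivot (k + 1) t := respB_add_two _ _
  rw [h4]
  simp only [tau, kappa]
  rw [h3, respB_add_two k]
  rcases eq_or_ne (pivot (k + 2) t) 0 with h | h
  · simp [h]
  · field_simp

theorem pivot_eq_tau_mul {k : ℕ} {t : ℝ} (hb : respB (k + 1) t ≠ 0) :
    pivot k t = tau k t * respB (k + 1) t := by
  rw [tau]
  field_simp

/-- The invariant region `τ < 0`, `κ < 1/16`. -/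
theorem region_neg_add_two {k : ℕ} {t : ℝ} (h : ∀ i ≤ k, pivot i t ≠ 0) (ht : tau k t < 0)
    (hk : kappa k t < 1 / 16) :
    (∀ i ≤ k + 2, pivot i t ≠ 0) ∧ tau (k + 2) t < 0 ∧ kappa (k + 2) t < 1 / 16 := by
  have hb : respB (k + 1) t ≠ 0 := respB_ne_zero fun i hi => h i (by omega)
  have hk0 := kappa_nonneg k t
  have hσ : sigma k t < 0 := by
    rw [sigma]
    nlinarith
  have hs1 : pivot (k + 1) t ≠ 0 := by
    rw [pivot_succ_eq_mul_sigma hb]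
    exact mul_ne_zero hb hσ.ne
  have hτ := tau_add_two hb (h k le_rfl) hs1
  have hκ := kappa_add_two hb (h k le_rfl) hs1
  set τ := tau k t
  set κ := kappa k t
  -- The constants here and below are the values at `κ = 1/16`: `(3/4)(7/8) = 21/32` and `4 - 12/16
  -- = 13/4`.
  have hp : 21 / 32 ≤ (1 - 4 * κ) * (1 - 2 * κ) := by nlinarith
  have hg : 13 / 4 - τ * (21 / 32) ≤ 4 - 12 * κ - τ * (1 - 4 * κ) * (1 - 2 * κ) := by
    nlinarith [mul_nonneg (neg_nonneg.2 ht.le) (sub_nonneg.2 hp)]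
  set g := 4 - 12 * κ - τ * (1 - 4 * κ) * (1 - 2 * κ)
  have hg0 : 0 < g := by linarith
  have hτ' : tau (k + 2) t < 0 := by
    rw [hτ]
    exact mul_neg_of_neg_of_pos ht hg0
  refine ⟨fun i hi => ?_, hτ', ?_⟩
  · rcases Nat.lt_or_ge k i with hki | hki
    · obtain rfl | rfl : i = k + 1 ∨ i = k + 2 := by omega
      · exact hs1
      · have hb3 : respB (k + 2 + 1) t ≠ 0 := respB_ne_zero fun i hi => by
          rcases Nat.lt_or_ge k i with hki | hki
          · obtain rfl : i = k + 1 := by omega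
            exact hs1
          · exact h i hki
        rw [pivot_eq_tau_mul hb3]
        exact mul_ne_zero hτ'.ne hb3
    · exact h i hki
  · have hr : κ * τ * sigma k t / tau (k + 2) t = κ * (sigma k t / g) := by
      rw [hτ]
      have := ht.ne
      field_simp
    rw [hκ, hr]
    -- Here `|σ| ≤ 2 - τ`, while `2g ≥ 13/2 - (21/16)τ`. The resulting bound `κ' ≤ (1/8)²` is well
    -- inside the region.
    have hσg : |sigma k t / g| ≤ 2 := by
      rw [abs_div, abs_of_neg hσ, abs_of_pos hg0, div_le_iff₀ hg0]
      rw [sigma]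
      change -(τ - 2 - 4 * κ * τ) ≤ 2 * g
      nlinarith
    have : |κ * (sigma k t / g)| ≤ 1 / 8 := by
      rw [abs_mul, abs_of_nonneg hk0]
      nlinarith [abs_nonneg (sigma k t / g)]
    rw [← sq_abs]
    nlinarith [abs_nonneg (κ * (sigma k t / g))]

/-- Once an orbit enters the invariant region it never leaves it, and there neither `tau` nor
`sigma` vanishes, hence no pivot does. This produces the gaps. -/
theorem notMem_pivotZeros_of_region_neg {k : ℕ} {t : ℝ} (h : ∀ i ≤ k, pivot i t ≠ 0)
    (ht : tau k t < 0) (hk : kappa k t < 1 / 16) : t ∉ pivotZeros := by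
  have key : ∀ j, (∀ i ≤ k + 2 * j, pivot i t ≠ 0) ∧ tau (k + 2 * j) t < 0 ∧
      kappa (k + 2 * j) t < 1 / 16 := by
    intro j
    induction j with
    | zero => exact ⟨h, ht, hk⟩
    | succ j ih => exact region_neg_add_two ih.1 ih.2.1 ih.2.2
  rintro ⟨i, hi⟩
  exact (key i).1 i (by omega) hi

/-- The region `0 < τ`, `κ < 1/16`, `σ < 0`. -/
theorem region_pos_add_two {k : ℕ} {t : ℝ} (h : ∀ i ≤ k, pivot i t ≠ 0) (ht : 0 < tau k t)
    (hk : kappa k t < 1 / 16) (hσ : sigma k t < 0) :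
    5 / 4 * tau k t ≤ tau (k + 2) t ∧ tau (k + 2) t ≤ 4 * tau k t ∧ kappa (k + 2) t < 1 / 16 := by
  have hb : respB (k + 1) t ≠ 0 := respB_ne_zero fun i hi => h i (by omega)
  have hk0 := kappa_nonneg k t
  have hs1 : pivot (k + 1) t ≠ 0 := by
    rw [pivot_succ_eq_mul_sigma hb]
    exact mul_ne_zero hb hσ.ne
  have hτ := tau_add_two hb (h k le_rfl) hs1
  have hκ := kappa_add_two hb (h k le_rfl) hs1
  have hσ2 : -2 < sigma k t := by
    rw [sigma]
    nlinarith
  have hσ' : tau k t * (1 - 4 * kappa k t) < 2 := by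
    rw [sigma] at hσ
    linarith
  set τ := tau k t
  set κ := kappa k t
  have hp0 : 0 < τ * (1 - 4 * κ) := mul_pos ht (by linarith)
  -- The condition `σ < 0` bounds the last product by `2`, and `4 - 12/16 - 2 = 5/4`.
  have hg1 : 5 / 4 ≤ 4 - 12 * κ - τ * (1 - 4 * κ) * (1 - 2 * κ) := by nlinarith
  have hg2 : 4 - 12 * κ - τ * (1 - 4 * κ) * (1 - 2 * κ) ≤ 4 := by nlinarith
  set g := 4 - 12 * κ - τ * (1 - 4 * κ) * (1 - 2 * κ)
  refine ⟨by rw [hτ]; nlinarith, by rw [hτ]; nlinarith, ?_⟩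
  have hr : κ * τ * sigma k t / tau (k + 2) t = κ * (sigma k t / g) := by
    rw [hτ]
    have := ht.ne'
    field_simp
  rw [hκ, hr]
  have hσg : |sigma k t / g| ≤ 2 := by
    rw [abs_div, abs_of_neg hσ, abs_of_pos (by linarith), div_le_iff₀ (by linarith)]
    linarith
  have : |κ * (sigma k t / g)| ≤ 1 / 8 := by
    rw [abs_mul, abs_of_nonneg hk0]
    nlinarith [abs_nonneg (sigma k t / g)]
  rw [← sq_abs]
  nlinarith [abs_nonneg (κ * (sigma k t / g))]

end Basilica

/-! ### Gaps and accumulation points at the zeros of the pivots. -/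

namespace Basilica
open Filter Topology

/-! ### The recursion near a zero of a pivot -/

/-- For small `x` the point `(τ, κ)` is near `(4, 0)`, which the two-step map sends to `(0, 0)`. To
first order `T` is `-4(τ - 4)`, about `-8x`. Since `κτ` is of order `x²` and `T` of order `x`, the
new `kappa`, the square of a quotient of order `x`, is small as well. -/
theorem entry_estimate {x θ τ κ T : ℝ} (hx0 : x ≠ 0) (hx : |x| ≤ 1 / 100) (hθ : |θ| ≤ 1 / 100)
    (hτ : τ = 4 + x * (2 - θ)) (hκ : κ * τ ^ 2 = x ^ 2)
    (hT : T = τ * (4 - 12 * κ - τ * (1 - 4 * κ) * (1 - 2 * κ))) :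
    T * x < 0 ∧ |T| ≤ 10 * |x| ∧ (κ * τ * (τ - 2 - 4 * κ * τ) / T) ^ 2 < 1 / 16 := by
  obtain ⟨hx1, hx2⟩ := abs_le.1 hx
  obtain ⟨ht1, ht2⟩ := abs_le.1 hθ
  set η := x * (2 - θ) with hη
  have hη1 : |η| ≤ 201 / 100 * |x| := by
    rw [hη, abs_mul, mul_comm]
    exact mul_le_mul_of_nonneg_right (abs_le.2 ⟨by linarith, by linarith⟩) (abs_nonneg _)
  have hη2 := hη1.trans (mul_le_mul_of_nonneg_left hx (by norm_num))
  obtain ⟨h1, h2⟩ := abs_le.1 hη2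
  set y := κ * τ with hy
  have hyτ : y * τ = x ^ 2 := by rw [← hκ]; ring
  have hτ0 : 39 / 10 ≤ τ := by linarith
  have hy0 : 0 ≤ y := by
    by_contra hneg
    nlinarith [sq_nonneg x]
  have hx22 : x ^ 2 ≤ 1 / 100 * |x| := by
    rw [← sq_abs]
    nlinarith [abs_nonneg x]
  have hy1 : y ≤ 1 / 390 * |x| := by nlinarith
  have hy2 : y ≤ 1 / 39000 := by linarith
  have hη3 : η ^ 2 ≤ 5 / 100 * |x| := by
    rw [← sq_abs]
    nlinarith only [abs_nonneg η, abs_nonneg x, hη1, hη2, hx]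
  -- Expansion at `τ = 4`: everything on the right is of second order in `x`, because `y = κτ` is.
  have hTη : T + 4 * η = 12 * y + 6 * y * η - 8 * y ^ 2 - η ^ 2 := by
    rw [hT]
    have : τ * (4 - 12 * κ - τ * (1 - 4 * κ) * (1 - 2 * κ)) =
      4 * τ - 12 * y - τ ^ 2 + 6 * y * τ - 8 * y ^ 2 := by rw [hy]; ring
    rw [this, hτ]
    ring
  have hd : |T + 4 * η| ≤ 1 / 10 * |x| := by
    rw [hTη]
    have hyy : y ^ 2 ≤ 1 / 39000 * y := by nlinarith only [hy0, hy2]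
    have hyη : |y * η| ≤ y := by
      rw [abs_mul, abs_of_nonneg hy0]
      exact mul_le_of_le_one_right hy0 (by linarith)
    obtain ⟨h3, h4⟩ := abs_le.1 hyη
    refine abs_le.2 ⟨?_, ?_⟩ <;> nlinarith only [hyy, h3, h4, hη3, hy1, hy0, sq_nonneg y, sq_nonneg η]
  obtain ⟨hd1, hd2⟩ := abs_le.1 hd
  have hxpos : 0 < |x| := abs_pos.2 hx0
  have hTx : 6 * |x| ≤ |T| ∧ T * x < 0 := by
    rcases lt_or_gt_of_ne hx0 with h | h
    · have ha := abs_of_neg h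
      have : η ≤ 199 / 100 * x := by
        have := mul_nonneg (neg_nonneg.2 h.le) (by linarith : (0 : ℝ) ≤ 2 - θ - 199 / 100)
        rw [hη]
        linarith
      have hT0 : 6 * |x| ≤ T := by linarith
      exact ⟨hT0.trans (le_abs_self _), mul_neg_of_pos_of_neg (by linarith) h⟩
    · have ha := abs_of_pos h
      have : 199 / 100 * x ≤ η := by
        have := mul_nonneg h.le (by linarith : (0 : ℝ) ≤ 2 - θ - 199 / 100)
        rw [hη]
        linarith
      have hT0 : T ≤ -(6 * |x|) := by linarith
      exact ⟨by linarith [neg_abs_le T], mul_neg_of_neg_of_pos (by linarith) h⟩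
  refine ⟨hTx.2, ?_, ?_⟩
  · have : |T| ≤ |T + 4 * η| + |4 * η| := by
      have := abs_sub (T + 4 * η) (4 * η)
      rwa [add_sub_cancel_right] at this
    rw [abs_mul, abs_of_pos (by norm_num : (0 : ℝ) < 4)] at this
    linarith
  · have hσ : |τ - 2 - 4 * κ * τ| ≤ 3 := by
      rw [mul_assoc, ← hy]
      exact abs_le.2 ⟨by linarith, by linarith⟩
    have hTpos : 0 < |T| := by linarith [hTx.1]
    have : |y * (τ - 2 - 4 * κ * τ) / T| ≤ 1 / 8 := by
      rw [abs_div, abs_mul, abs_of_nonneg hy0, div_le_iff₀ hTpos]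
      have := mul_le_mul hy1 hσ (abs_nonneg _) (by positivity)
      linarith [hTx.1]
    rw [← sq_abs]
    exact (pow_le_pow_left₀ (abs_nonneg _) this 2).trans_lt (by norm_num)

/-- The local coordinate at a zero of `pivot k`. -/
noncomputable def entryCoord (k : ℕ) (t : ℝ) : ℝ := pivot k t * respB (k + 1) t / respB k t ^ 2

/-- Near a zero of `pivot k` both `pivot (k + 1)` and `respB (k + 2)` blow up, but their quotient
`tau (k + 1)` tends to `4`. One application of the two-step map then leads near `(0, 0)`, and the
sign of `tau (k + 3)` records the side of the zero. -/
theorem entry {k : ℕ} {t : ℝ} (h : ∀ i ≤ k, pivot i t ≠ 0) (hx : |entryCoord k t| ≤ 1 / 100)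
    (hθ : |tau k t| ≤ 1 / 100) :
    (∀ i ≤ k + 3, pivot i t ≠ 0) ∧ tau (k + 3) t * entryCoord k t < 0 ∧
      |tau (k + 3) t| ≤ 10 * |entryCoord k t| ∧ kappa (k + 3) t < 1 / 16 := by
  have hb0 : respB k t ≠ 0 := respB_ne_zero fun i hi => h i (by omega)
  have hb1 : respB (k + 1) t ≠ 0 := respB_ne_zero fun i hi => h i (by omega)
  have hb2 : respB (k + 2) t ≠ 0 := respB_ne_zero fun i hi => h i (by omega)
  have hs : pivot k t ≠ 0 := h k le_rfl
  have hx0 : entryCoord k t ≠ 0 := div_ne_zero (mul_ne_zero hs hb1) (pow_ne_zero 2 hb0)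
  have hτ : tau (k + 1) t = 4 + entryCoord k t * (2 - tau k t) := by
    simp only [tau, entryCoord]
    rw [pivot_succ, respB_add_two]
    field_simp
    ring
  have hτ0 : 0 < tau (k + 1) t := by
    have h1 := abs_le.1 hx
    have h2 := abs_le.1 hθ
    rw [hτ]
    nlinarith
  have hs1 : pivot (k + 1) t ≠ 0 := by
    rw [pivot_eq_tau_mul hb2]
    exact mul_ne_zero hτ0.ne' hb2
  have hκ : kappa (k + 1) t * tau (k + 1) t ^ 2 = entryCoord k t ^ 2 := by
    simp only [tau, kappa, entryCoord]
    rw [respB_add_two]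
    field_simp
  have hσ : 0 < sigma (k + 1) t := by
    have h1 := abs_le.1 hx
    have h2 := abs_le.1 hθ
    have h3 : kappa (k + 1) t * tau (k + 1) t * tau (k + 1) t = entryCoord k t ^ 2 := by
      rw [← hκ]; ring
    have h4 : 39 / 10 ≤ tau (k + 1) t := by
      rw [hτ]
      nlinarith
    have h5 : kappa (k + 1) t * tau (k + 1) t ≤ 1 / 100 := by
      by_contra hneg
      nlinarith
    rw [sigma]
    linarith
  have hs2 : pivot (k + 2) t ≠ 0 := by
    rw [pivot_succ_eq_mul_sigma hb2]
    exact mul_ne_zero hb2 hσ.ne'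
  have hT := tau_add_two hb2 hs1 hs2
  have hκ' := kappa_add_two hb2 hs1 hs2
  obtain ⟨e1, e2, e3⟩ := entry_estimate hx0 hx hθ hτ hκ hT
  have hi2 : ∀ i ≤ k + 2, pivot i t ≠ 0 := fun i hi => by
    obtain hi | rfl | rfl : i ≤ k ∨ i = k + 1 ∨ i = k + 2 := by omega
    exacts [h i hi, hs1, hs2]
  refine ⟨fun i hi => ?_, e1, e2, ?_⟩
  · rcases Nat.lt_or_ge i (k + 3) with hlt | hge
    · exact hi2 i (by omega)
    · obtain rfl : i = k + 3 := by omega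
      have hb4 : respB (k + 3 + 1) t ≠ 0 := respB_ne_zero fun i hi => hi2 i (by omega)
      rw [pivot_eq_tau_mul hb4]
      exact mul_ne_zero (fun h0 => by simp [h0] at e1) hb4
  · exact hκ'.trans_lt e3

/-- On an interval that contains no zeros of the pivots, the first coordinate cannot be positive
and tend to zero at an end point. -/
theorem exists_pivotZero_of_tau_pos {J : Set ℝ} (hJ : IsPreconnected J) {t₀ : ℝ}
    [hne : (𝓝[J] t₀).NeBot] {k : ℕ}
    (hτ : ∀ t ∈ J, 0 < tau k t) (hκ : ∀ t ∈ J, kappa k t < 1 / 16)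
    (hlim : Tendsto (tau k) (𝓝[J] t₀) (𝓝 0)) : (J ∩ pivotZeros).Nonempty := by
  by_contra hempty
  have hS : ∀ t ∈ J, ∀ i, pivot i t ≠ 0 := fun t ht i hi => hempty ⟨t, ht, i, hi⟩
  have hb : ∀ t ∈ J, ∀ i, respB i t ≠ 0 := fun t ht i => respB_ne_zero fun i _ => hS t ht i
  have hcτ : ∀ i, ContinuousOn (tau i) J := fun i t ht =>
    ((continuousAt_pivot i fun i _ => hS t ht i).div
      (continuousAt_respB (i + 1) fun i _ => hS t ht i) (hb t ht _)).continuousWithinAt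
  have hcκ : ∀ i, ContinuousOn (kappa i) J := fun i t ht =>
    (((continuousAt_respB i fun i _ => hS t ht i).div
      (continuousAt_pivot i fun i _ => hS t ht i) (hS t ht _)).pow 2).continuousWithinAt
  have hcσ : ∀ i, ContinuousOn (sigma i) J := fun i =>
    ((hcτ i).sub continuousOn_const).sub ((continuousOn_const.mul (hcκ i)).mul (hcτ i))
  have hσ0 : ∀ i, ∀ t ∈ J, sigma i t ≠ 0 := fun i t ht h0 =>
    hS t ht (i + 1) (by rw [pivot_succ_eq_mul_sigma (hb t ht _), h0, mul_zero])
  -- Near `t₀` one has `τ < 1`, hence `σ < 0`. A zero of `sigma i` is a zero of `pivot (i + 1)`, so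
  -- by connectedness `sigma i` keeps its sign on all of `J`.
  have hσneg : ∀ i, (∀ t ∈ J, 0 < tau i t) → (∀ t ∈ J, kappa i t < 1 / 16) →
      Tendsto (tau i) (𝓝[J] t₀) (𝓝 0) → ∀ t ∈ J, sigma i t < 0 := by
    intro i h1 h2 h3 t ht
    have hev : ∀ᶠ u in 𝓝[J] t₀, u ∈ J ∧ tau i u < 1 :=
      eventually_mem_nhdsWithin.and (h3.eventually_lt_const one_pos)
    obtain ⟨u, hu, hu1⟩ := hev.exists
    have hu' : sigma i u < 0 := by
      rw [sigma]
      nlinarith [mul_nonneg (kappa_nonneg i u) (h1 u hu).le]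
    by_contra hneg
    obtain ⟨v, hv, hv0⟩ := hJ.intermediate_value hu ht (hcσ i) ⟨hu'.le, not_lt.1 hneg⟩
    exact hσ0 i v hv hv0
  -- The upper bound `4τ` preserves the limit `0` at `t₀`, which `hσneg` needs at each step; the
  -- lower bound `5/4 τ` gives exponential growth.
  have key : ∀ j, (∀ t ∈ J, 0 < tau (k + 2 * j) t) ∧ (∀ t ∈ J, kappa (k + 2 * j) t < 1 / 16) ∧
      Tendsto (tau (k + 2 * j)) (𝓝[J] t₀) (𝓝 0) ∧
      ∀ t ∈ J, (5 / 4) ^ j * tau k t ≤ tau (k + 2 * j) t := by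
    intro j
    induction j with
    | zero => exact ⟨hτ, hκ, hlim, fun t _ => by simp⟩
    | succ j ih =>
      obtain ⟨h1, h2, h3, h4⟩ := ih
      have hr := fun t ht => region_pos_add_two (fun i _ => hS t ht i) (h1 t ht) (h2 t ht)
        (hσneg _ h1 h2 h3 t ht)
      have hpos : ∀ t ∈ J, 0 < tau (k + 2 * j + 2) t := fun t ht =>
        (mul_pos (by norm_num) (h1 t ht)).trans_le (hr t ht).1
      refine ⟨hpos, fun t ht => (hr t ht).2.2, ?_, fun t ht => ?_⟩
      · refine tendsto_of_tendsto_of_tendsto_of_le_of_le' tendsto_const_nhds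
          (by simpa using h3.const_mul 4) ?_ ?_
        · exact eventually_mem_nhdsWithin.mono fun t ht => (hpos t ht).le
        · exact eventually_mem_nhdsWithin.mono fun t ht => (hr t ht).2.1
      · refine le_trans ?_ (hr t ht).1
        rw [pow_succ]
        nlinarith [h4 t ht]
  obtain ⟨t, ht⟩ : J.Nonempty := (eventually_mem_nhdsWithin (a := t₀) (s := J)).exists
  -- For this `j` one gets `τ > 4`, whereas `σ < 0` and `κ < 1/16` force `τ < 8/3`.
  obtain ⟨j, hj⟩ := pow_unbounded_of_one_lt (4 / tau k t) (by norm_num : (1 : ℝ) < 5 / 4)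
  obtain ⟨h1, h2, h3, h4⟩ := key j
  have h5 := hσneg _ h1 h2 h3 t ht
  rw [div_lt_iff₀ (hτ t ht)] at hj
  have h6 := h4 t ht
  rw [sigma] at h5
  nlinarith [h2 t ht]

/-- Each zero of a pivot is the end point of an interval without zeros, and a limit of other
zeros. -/
theorem gap_and_accumulation {t₀ : ℝ} (h₀ : t₀ ∈ pivotZeros) {U : Set ℝ} (hU : U ∈ 𝓝 t₀) :
    (∃ V ⊆ U, IsOpen V ∧ V.Nonempty ∧ Disjoint V pivotZeros) ∧
      ∃ t ∈ U, t ≠ t₀ ∧ t ∈ pivotZeros := by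
  classical
  -- At the first vanishing pivot everything that enters `entryCoord k` and `tau k` is still regular
  -- at `t₀`; only later does the recursion divide by zero.
  obtain ⟨k, hk0, hlt⟩ : ∃ k, pivot k t₀ = 0 ∧ ∀ i < k, pivot i t₀ ≠ 0 :=
    ⟨Nat.find h₀, Nat.find_spec h₀, fun i hi => Nat.find_min h₀ hi⟩
  have hb0 : respB k t₀ ≠ 0 := respB_ne_zero fun i hi => hlt i (by omega)
  have hb1 : respB (k + 1) t₀ ≠ 0 := respB_ne_zero fun i hi => hlt i (by omega)
  have cb0 : ContinuousAt (respB k) t₀ := continuousAt_respB k fun i hi => hlt i (by omega)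
  have cb1 : ContinuousAt (respB (k + 1)) t₀ :=
    continuousAt_respB (k + 1) fun i hi => hlt i (by omega)
  have cs : ContinuousAt (pivot k) t₀ := continuousAt_pivot k hlt
  have cx : ContinuousAt (entryCoord k) t₀ := (cs.mul cb1).div (cb0.pow 2) (pow_ne_zero 2 hb0)
  have cθ : ContinuousAt (tau k) t₀ := cs.div cb1 hb1
  have x0 : entryCoord k t₀ = 0 := by simp [entryCoord, hk0]
  have θ0 : tau k t₀ = 0 := by simp [tau, hk0]
  obtain ⟨d, hd, hder⟩ := hasDerivAt_pivot k hlt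
  -- the sign of the coordinate on the two sides
  obtain ⟨c, hc, hsign⟩ : ∃ c : ℝ, c ≠ 0 ∧
      ∀ᶠ t in 𝓝 t₀, t ≠ t₀ → 0 < c * (t - t₀) * entryCoord k t := by
    -- The pivot is decreasing at `t₀`, so `entryCoord k t` has the sign of `-respB (k + 1) t₀ * (t
    -- - t₀)`.
    refine ⟨-respB (k + 1) t₀, neg_ne_zero.2 hb1, ?_⟩
    have e1 : ∀ᶠ t in 𝓝 t₀, 0 < respB (k + 1) t₀ * respB (k + 1) t :=
      (cb1.const_mul (respB (k + 1) t₀)).eventually_const_lt (mul_self_pos.2 hb1)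
    have e2 : ∀ᶠ t in 𝓝 t₀, respB k t ≠ 0 := cb0.eventually_ne hb0
    have e3 : ∀ᶠ t in 𝓝 t₀, t ≠ t₀ → slope (pivot k) t₀ t < 0 :=
      eventually_nhdsWithin_iff.1
        ((hasDerivAt_iff_tendsto_slope.1 hder).eventually_lt_const (by linarith))
    filter_upwards [e1, e2, e3] with t h1 h2 h3 hne
    have h4 := h3 hne
    rw [slope_def_field, hk0, sub_zero] at h4
    have h5 : t - t₀ ≠ 0 := sub_ne_zero.2 hne
    have h6 : -respB (k + 1) t₀ * (t - t₀) * entryCoord k t =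
        (respB (k + 1) t₀ * respB (k + 1) t) * (-(pivot k t / (t - t₀))) *
          ((t - t₀) / respB k t) ^ 2 := by
      rw [entryCoord]
      field_simp
    rw [h6]
    exact mul_pos (mul_pos h1 (neg_pos.2 h4)) (sq_pos_of_ne_zero (div_ne_zero h5 h2))
  have hev : ∀ᶠ t in 𝓝 t₀, t ∈ U ∧ (t ≠ t₀ → 0 < c * (t - t₀) * entryCoord k t) ∧
      (∀ i < k, pivot i t ≠ 0) ∧ |entryCoord k t| ≤ 1 / 100 ∧ |tau k t| ≤ 1 / 100 := by
    have e1 : ∀ᶠ t in 𝓝 t₀, ∀ i ∈ Finset.range k, pivot i t ≠ 0 :=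
      (Filter.eventually_all_finset _).2 fun i hi =>
        (continuousAt_pivot i fun j hj =>
          hlt j (hj.trans (Finset.mem_range.1 hi))).eventually_ne (hlt i (Finset.mem_range.1 hi))
    have e2 : ∀ᶠ t in 𝓝 t₀, |entryCoord k t| < 1 / 100 :=
      cx.abs.eventually_lt_const (by simp [x0])
    have e3 : ∀ᶠ t in 𝓝 t₀, |tau k t| < 1 / 100 :=
      cθ.abs.eventually_lt_const (by simp [θ0])
    filter_upwards [hU, hsign, e1, e2, e3] with t h1 h2 h3 h4 h5
    exact ⟨h1, h2, fun i hi => h3 i (Finset.mem_range.2 hi), h4.le, h5.le⟩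
  obtain ⟨δ, hδ, hball⟩ := Metric.eventually_nhds_iff_ball.1 hev
  have hside : ∀ t ∈ Metric.ball t₀ δ, t ≠ t₀ → (∀ i ≤ k + 3, pivot i t ≠ 0) ∧
      tau (k + 3) t * (c * (t - t₀)) < 0 ∧ |tau (k + 3) t| ≤ 10 * |entryCoord k t| ∧
      kappa (k + 3) t < 1 / 16 := by
    intro t ht hne
    obtain ⟨-, h2, h3, h4, h5⟩ := hball t ht
    have h2 := h2 hne
    have hs : pivot k t ≠ 0 := fun h0 => by simp [entryCoord, h0] at h2
    obtain ⟨e1, e2, e3, e4⟩ := entry (fun i hi => by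
      rcases hi.lt_or_eq with hi | rfl
      exacts [h3 i hi, hs]) h4 h5
    refine ⟨e1, ?_, e3, e4⟩
    have hx2 : 0 < entryCoord k t ^ 2 := by
      refine sq_pos_of_ne_zero fun h0 => ?_
      simp [h0] at h2
    by_contra hneg
    nlinarith [mul_nonneg (not_lt.1 hneg) hx2.le, mul_neg_of_pos_of_neg h2 e2]
  have hlim : Tendsto (tau (k + 3)) (𝓝[≠] t₀) (𝓝 0) := by
    refine squeeze_zero_norm' (a := fun t => 10 * |entryCoord k t|) ?_ ?_
    · filter_upwards [self_mem_nhdsWithin,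
        nhdsWithin_le_nhds (Metric.ball_mem_nhds t₀ hδ)] with t h1 h2
      exact (hside t h2 h1).2.2.1
    · have := (cx.abs.const_mul 10).tendsto
      rw [x0] at this
      simp only [abs_zero, mul_zero] at this
      exact this.mono_left nhdsWithin_le_nhds
  rw [Real.ball_eq_Ioo] at hside hball
  have hR : Set.Ioo t₀ (t₀ + δ) ⊆ Set.Ioo (t₀ - δ) (t₀ + δ) := Set.Ioo_subset_Ioo_left (by linarith)
  have hL : Set.Ioo (t₀ - δ) t₀ ⊆ Set.Ioo (t₀ - δ) (t₀ + δ) :=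
    Set.Ioo_subset_Ioo_right (by linarith)
  -- `P` is the one-sided neighbourhood of `t₀` on which `tau (k + 3)` is negative, hence a gap; on
  -- the opposite side `Q` it is positive and tends to zero at `t₀`, which forces further zeros.
  obtain ⟨P, Q, hPU, hQU, hPo, hPne, hQc, hQlim, hQ0, hPsign, hQsign⟩ :
      ∃ P Q : Set ℝ, P ⊆ Set.Ioo (t₀ - δ) (t₀ + δ) ∧ Q ⊆ Set.Ioo (t₀ - δ) (t₀ + δ) ∧ IsOpen P ∧
        P.Nonempty ∧ IsPreconnected Q ∧ (𝓝[Q] t₀).NeBot ∧ t₀ ∉ Q ∧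
        (∀ t ∈ P, 0 < c * (t - t₀)) ∧ (∀ t ∈ Q, c * (t - t₀) < 0) := by
    have hneR : (𝓝[Set.Ioo t₀ (t₀ + δ)] t₀).NeBot := left_nhdsWithin_Ioo_neBot (by linarith)
    have hneL : (𝓝[Set.Ioo (t₀ - δ) t₀] t₀).NeBot := right_nhdsWithin_Ioo_neBot (by linarith)
    rcases lt_or_gt_of_ne hc with hc | hc
    · exact ⟨_, _, hL, hR, isOpen_Ioo, ⟨t₀ - δ / 2, by constructor <;> linarith⟩,
        isPreconnected_Ioo, hneR, fun h => lt_irrefl _ h.1,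
        fun t ht => mul_pos_of_neg_of_neg hc (by linarith [ht.2]),
        fun t ht => mul_neg_of_neg_of_pos hc (by linarith [ht.1])⟩
    · exact ⟨_, _, hR, hL, isOpen_Ioo, ⟨t₀ + δ / 2, by constructor <;> linarith⟩,
        isPreconnected_Ioo, hneL, fun h => lt_irrefl _ h.2,
        fun t ht => mul_pos hc (by linarith [ht.1]),
        fun t ht => mul_neg_of_pos_of_neg hc (by linarith [ht.2])⟩
  have hP0 : ∀ t ∈ P, t ≠ t₀ := fun t ht h => by simpa [h] using hPsign t ht
  have hQ0' : ∀ t ∈ Q, t ≠ t₀ := fun t ht h => hQ0 (h ▸ ht)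
  refine ⟨⟨P, fun t ht => (hball t (hPU ht)).1, hPo, hPne, ?_⟩, ?_⟩
  · rw [Set.disjoint_left]
    intro t ht
    obtain ⟨e1, e2, -, e4⟩ := hside t (hPU ht) (hP0 t ht)
    exact notMem_pivotZeros_of_region_neg e1 (neg_of_mul_neg_left e2 (hPsign t ht).le) e4
  · obtain ⟨t, ht, htz⟩ := exists_pivotZero_of_tau_pos hQc (t₀ := t₀) (k := k + 3)
      (fun t ht => pos_of_mul_neg_left (hside t (hQU ht) (hQ0' t ht)).2.1 (hQsign t ht).le)
      (fun t ht => (hside t (hQU ht) (hQ0' t ht)).2.2.2)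
      (hlim.mono_left (nhdsWithin_mono _ fun t ht => hQ0' t ht))
    exact ⟨t, (hball t (hQU ht)).1, hQ0' t ht, htz⟩

theorem two_mem_pivotZeros : (2 : ℝ) ∈ pivotZeros := ⟨0, by simp [pivot_zero]⟩

/-- The closure of the set of zeros is perfect and totally disconnected. -/
theorem isCantorSet_closure_pivotZeros (hb : Bornology.IsBounded pivotZeros) :
    IsCantorSet (closure pivotZeros) := by
  refine ⟨⟨2, subset_closure two_mem_pivotZeros⟩, hb.isCompact_closure, ⟨isClosed_closure, ?_⟩, ?_⟩
  · have h : Preperfect pivotZeros := fun t ht => by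
      rw [accPt_iff_nhds]
      intro U hU
      obtain ⟨u, hu, hne, hz⟩ := (gap_and_accumulation ht hU).2
      exact ⟨u, ⟨hu, hz⟩, hne⟩
    exact h.perfect_closure.acc
  -- Two points of a connected subset would span an interval inside the closure. Zeros would be
  -- dense in it, but any zero in it has a gap arbitrarily close by.
  · intro s hs hsc t ht u hu
    by_contra hne
    wlog hlt : t < u generalizing t u
    · exact this hu ht (Ne.symm hne) (lt_of_le_of_ne (not_lt.1 hlt) (Ne.symm hne))
    have hsub : Set.Ioo t u ⊆ closure pivotZeros :=
      (Set.Ioo_subset_Icc_self.trans (hsc.Icc_subset ht hu)).trans hs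
    have hm : (t + u) / 2 ∈ Set.Ioo t u := by constructor <;> linarith
    obtain ⟨v, hv, hvz⟩ := mem_closure_iff.1 (hsub hm) _ isOpen_Ioo hm
    obtain ⟨V, hVU, hVo, ⟨w, hw⟩, hVd⟩ := (gap_and_accumulation hvz (isOpen_Ioo.mem_nhds hv)).1
    obtain ⟨z, hz, hz'⟩ := mem_closure_iff.1 (hsub (hVU hw)) V hVo hw
    exact Set.disjoint_left.1 hVd hz hz'

end Basilica

/-! ### The self-similar structure of the graphs `G_n`. -/

namespace Basilica

/-! ### The automaton and the tails of words -/

theorem act_length (s : Gen) (w : List Bool) : (act s w).length = w.length := by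
  induction w generalizing s with
  | nil => cases s <;> rfl
  | cons c w ih => cases s <;> cases c <;> simp [act, ih]

theorem act_surjective (s : Gen) : Function.Surjective (act s) := by
  intro w
  induction w generalizing s with
  | nil => exact ⟨[], by cases s <;> rfl⟩
  | cons c w ih =>
    obtain ⟨va, ha⟩ := ih .a
    obtain ⟨vb, hb⟩ := ih .b
    cases s <;> cases c
    · exact ⟨false :: vb, by simp [act, hb]⟩
    · exact ⟨true :: w, rfl⟩
    · exact ⟨true :: w, rfl⟩
    · exact ⟨false :: va, by simp [act, ha]⟩

theorem zeros_add (m n : ℕ) : zeros (m + n) = zeros m ++ zeros n := List.replicate_add ..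

theorem evenTail_append_iff {u : List Bool} {j : ℕ} :
    EvenTail (u ++ true :: zeros j) ↔ Even j := by
  have key : ∀ (a b : ℕ) (l l' : List Bool),
      zeros a ++ true :: l = zeros b ++ true :: l' → a = b := by
    intro a
    induction a with
    | zero => intro b l l' h; cases b <;> simp_all [List.replicate_succ]
    | succ a ih =>
      intro b l l' h
      cases b with
      | zero => simp [List.replicate_succ] at h
      | succ b =>
        simp only [List.replicate_succ, List.cons_append, List.cons.injEq, true_and] at h
        rw [ih b l l' h]
  constructor
  · rintro ⟨v, i, h⟩
    have h := congrArg List.reverse h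
    simp only [List.reverse_append, List.reverse_cons, List.reverse_replicate, List.append_assoc,
      List.singleton_append] at h
    exact ⟨i, by rw [key _ _ _ _ h]; ring⟩
  · rintro ⟨i, rfl⟩
    exact ⟨u, i, by rw [two_mul]⟩

theorem not_evenTail_append_false {w : List Bool} (h : EvenTail w) :
    ¬ EvenTail (w ++ [false]) := by
  obtain ⟨v, j, rfl⟩ := h
  have : v ++ true :: zeros (2 * j) ++ [false] = v ++ true :: zeros (2 * j + 1) := by
    simp [zeros_add]
  rw [this, evenTail_append_iff]
  simp

/-- The third kind consists of the words that contain a `1` and end in an odd number of zeros; they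
are the words left out of `G_n` besides `0^n`. -/
theorem word_trichotomy (v : List Bool) :
    v = zeros v.length ∨ EvenTail v ∨ ∃ w, EvenTail w ∧ v = w ++ [false] := by
  induction v using List.reverseRecOn with
  | nil => exact .inl rfl
  | append_singleton v c ih =>
    cases c
    · rcases ih with h | h | ⟨w, hw, rfl⟩
      · left
        rw [List.length_append, List.length_singleton, zeros_add, ← h]
        rfl
      · exact .inr (.inr ⟨v, h, rfl⟩)
      · exact .inr (.inl (by simpa using hw.append_zeroZero))
    · exact .inr (.inl (.append_one v))

/-- The label of the edges at the boundary vertices of `G_n`. -/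
def bdryLabel (n : ℕ) : Gen := if Even n then .a else .b

theorem bdryLabel_add_two (n : ℕ) : bdryLabel (n + 2) = bdryLabel n := by
  simp [bdryLabel, Nat.even_add]

theorem bdryLabel_ne (n : ℕ) : bdryLabel n ≠ bdryLabel (n + 1) := by
  by_cases h : Even n <;> simp [bdryLabel, Nat.even_add_one, h]

theorem eq_bdryLabel_or (n : ℕ) (s : Gen) : s = bdryLabel n ∨ s = bdryLabel (n + 1) := by
  by_cases h : Even n <;> cases s <;> simp [bdryLabel, Nat.even_add_one, h]

theorem sum_gen (n : ℕ) (F : Gen → ℝ) :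
    ∑ s, F s = F (bdryLabel n) + F (bdryLabel (n + 1)) := by
  have : (Finset.univ : Finset Gen) = {bdryLabel n, bdryLabel (n + 1)} := by
    ext s
    simpa using eq_bdryLabel_or n s
  rw [this, Finset.sum_pair (bdryLabel_ne n)]

/-- Reading a `0` exchanges the states `a` and `b`, so the parity of `n` decides which generator is
in state `a` after reading `0^n`. For `n ≥ 1` its last output came from `b` and is `1`. The other
generator has just been in state `a` and has output `0`, preceded by a `1` if `n ≥ 2`. -/
theorem act_bdryLabel_zeros (n : ℕ) :
    ((∀ t, act (bdryLabel n) (zeros n ++ t) = act (bdryLabel n) (zeros n) ++ act .a t) ∧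
      (n = 0 ∨ ∃ u, act (bdryLabel n) (zeros n) = u ++ [true])) ∧
    ((∀ t, act (bdryLabel (n + 1)) (zeros n ++ t) =
        act (bdryLabel (n + 1)) (zeros n) ++ act .b t) ∧
      ¬ EvenTail (act (bdryLabel (n + 1)) (zeros n))) := by
  induction n with
  | zero => exact ⟨⟨by simp [act, bdryLabel], .inl rfl⟩, by simp [act, bdryLabel],
      fun h => by simpa [act] using h.mem⟩
  | succ n ih =>
    obtain ⟨⟨h, hu⟩, h', -⟩ := ih
    have hz : zeros (n + 1) = zeros n ++ [false] := List.replicate_succ'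
    refine ⟨⟨fun t => ?_, .inr ⟨act (bdryLabel (n + 1)) (zeros n), ?_⟩⟩, fun t => ?_, ?_⟩
    · rw [hz, List.append_assoc, h', h']
      simp [act]
    · rw [hz, h']
      simp [act]
    · rw [bdryLabel_add_two, hz, List.append_assoc, h, h]
      simp [act]
    · rw [bdryLabel_add_two, hz, h]
      rcases hu with rfl | ⟨u, hu⟩
      · exact fun h => by simpa [act] using h.mem
      · rw [hu]
        simpa [act] using not_evenTail_one_zero u

/-- This is why `0^n` is a cut vertex: the generators lead from the words of `G_n` only to such
words or to `0^n`. -/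
theorem act_evenTail {w : List Bool} (h : EvenTail w) (s : Gen) :
    act s w = zeros w.length ∨ EvenTail (act s w) := by
  obtain ⟨u, j, rfl⟩ := h
  have h1 : act s (u ++ true :: zeros (2 * j)) = act s (u ++ [true]) ++ zeros (2 * j) := by
    rw [← act_append (by simp)]
    simp
  by_cases hu : true ∈ u
  · right
    rw [h1, act_append hu]
    exact ⟨act s u, j, by simp⟩
  · have hu : u = zeros u.length := List.eq_replicate_iff.2
      ⟨rfl, fun b hb => by
        cases b
        · rfl
        · exact absurd hb hu⟩
    have hl := act_length s u
    set k := u.length with hk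
    rw [h1]
    rcases eq_bdryLabel_or k s with rfl | rfl
    · right
      rw [hu, (act_bdryLabel_zeros k).1.1]
      exact ⟨act (bdryLabel k) (zeros k), j, by simp [act]⟩
    -- The state `b` turns the last `1` into a `0`. The image of `0^k` is `0^k` or has an odd tail,
    -- which this extra zero makes even.
    · have h2 : act (bdryLabel (k + 1)) (u ++ [true]) =
          act (bdryLabel (k + 1)) u ++ [false] := by
        rw [hu, (act_bdryLabel_zeros k).2.1]
        rfl
      rw [h2]
      rcases word_trichotomy (act (bdryLabel (k + 1)) u) with h | h | ⟨w, ⟨v, i, rfl⟩, hw⟩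
      · left
        rw [h, hl]
        simp [← List.replicate_succ', ← hk]
        omega
      · rw [hu] at h
        exact absurd h (act_bdryLabel_zeros k).2.2
      · right
        rw [hw]
        have : v ++ true :: zeros (2 * i) ++ [false] ++ [false] ++ zeros (2 * j) =
            v ++ true :: zeros (2 * i + (1 + (1 + 2 * j))) := by
          simp [zeros_add]
        rw [this, evenTail_append_iff]
        exact ⟨i + 1 + j, by ring⟩

/-! ### The edges of `G_n` -/

/-- The words that are the non-boundary vertices of `G_n`. -/
abbrev Word (n : ℕ) : Type := {w : List Bool // w.length = n ∧ EvenTail w}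

/-- With `exists_edge_to`, a non-boundary vertex has all its four edge ends inside `G_n`. Therefore
the Laplacian there does not depend on the ambient graph (`lapFun_map`). -/
theorem exists_edge_from (n : ℕ) (w : Word n) (s : Gen) : ∃ v, Edge n s (.inl w) v := by
  rcases act_evenTail w.2.2 s with h | h
  · exact ⟨.inr .x, by rwa [w.2.1] at h⟩
  · exact ⟨.inl ⟨act s w.1, by rw [act_length, w.2.1], h⟩, rfl⟩

theorem exists_edge_to (n : ℕ) (w : Word n) (s : Gen) : ∃ v, Edge n s v (.inl w) := by
  obtain ⟨v, hv⟩ := act_surjective s w.1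
  have hl : v.length = n := by rw [← act_length s, hv, w.2.1]
  rcases word_trichotomy v with h | h | ⟨u, hu, rfl⟩
  · rw [hl] at h
    subst h
    exact ⟨.inr .y, hv⟩
  · exact ⟨.inl ⟨v, hl, h⟩, hv⟩
  · exfalso
    rw [act_append hu.mem] at hv
    have he : EvenTail (act s u ++ [false]) := hv ▸ w.2.2
    rcases act_evenTail hu s with h | h
    · rw [h] at he
      simpa using he.mem
    · exact not_evenTail_append_false h he

theorem exists_edge_y {n : ℕ} (hn : 1 ≤ n) :
    ∃ w, Edge n (bdryLabel n) (.inr .y) (.inl w) := by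
  rcases (act_bdryLabel_zeros n).1.2 with h | ⟨u, hu⟩
  · omega
  · exact ⟨⟨act (bdryLabel n) (zeros n), by simp [act_length], hu ▸ .append_one u⟩, rfl⟩

theorem not_edge_y {n : ℕ} (v : Vtx n) : ¬ Edge n (bdryLabel (n + 1)) (.inr .y) v := by
  match v with
  | .inl w =>
    intro h
    exact (act_bdryLabel_zeros n).2.2 ((show act _ _ = w.1 from h) ▸ w.2.2)
  | .inr b => exact fun h => h

/-- The words that `a` and `b` map to `0^n`. -/
theorem act_eq_zeros (n : ℕ) :
    act .b (true :: zeros n) = zeros (n + 1) ∧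
      act .a (false :: true :: zeros n) = zeros (n + 2) := by
  simp [act, List.replicate_succ]

/-- The preimages of `0^n` are `1 0^{n-1}` under `b` and, for `n ≥ 2`, `0 1 0^{n-2}` under `a`; the
parity of `n` decides which of them has an even tail. -/
theorem exists_edge_x {n : ℕ} (hn : 1 ≤ n) :
    ∃ w, Edge n (bdryLabel n) (.inl w) (.inr .x) := by
  by_cases h : Even n
  · obtain ⟨m, rfl⟩ : ∃ m, n = m + 2 := ⟨n - 2, by have := h.two_dvd; omega⟩
    refine ⟨⟨false :: true :: zeros m, by simp, ?_⟩, ?_⟩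
    · exact (evenTail_append_iff (u := [false])).2 (by simpa [Nat.even_add] using h)
    · simp only [bdryLabel, h, if_true]
      exact (act_eq_zeros m).2
  · obtain ⟨m, rfl⟩ : ∃ m, n = m + 1 := ⟨n - 1, by omega⟩
    refine ⟨⟨true :: zeros m, by simp, ?_⟩, ?_⟩
    · exact (evenTail_append_iff (u := [])).2 (by simpa [Nat.even_add_one] using h)
    · simp only [bdryLabel, h, if_false]
      exact (act_eq_zeros m).1

theorem not_edge_x {n : ℕ} (hn : 1 ≤ n) (v : Vtx n) :
    ¬ Edge n (bdryLabel (n + 1)) v (.inr .x) := by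
  match v with
  | .inl w =>
    intro h
    have h : act (bdryLabel (n + 1)) w.1 = zeros n := h
    by_cases he : Even n
    · obtain ⟨m, rfl⟩ : ∃ m, n = m + 1 := ⟨n - 1, by omega⟩
      rw [bdryLabel, if_neg (by simpa [Nat.even_add_one] using he)] at h
      have := w.2.2
      rw [act_injective _ (h.trans (act_eq_zeros m).1.symm)] at this
      have := (evenTail_append_iff (u := [])).1 this
      simp only [Nat.even_add_one] at he
      exact he this
    · rw [bdryLabel, if_pos (by simpa [Nat.even_add_one] using he)] at h
      have hw := w.2.2
      rcases Nat.lt_or_ge n 2 with h2 | h2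
      -- In this degenerate case `a` fixes the word `0`.
      · obtain rfl : n = 1 := by omega
        have h3 : w.1 = zeros 1 := act_injective _ (h.trans rfl)
        rw [h3] at hw
        exact not_evenTail_zeros 1 hw
      · obtain ⟨m, rfl⟩ : ∃ m, n = m + 2 := ⟨n - 2, by omega⟩
        rw [act_injective _ (h.trans (act_eq_zeros m).2.symm)] at hw
        have := (evenTail_append_iff (u := [false])).1 hw
        exact he (by simpa [Nat.even_add] using this)
  | .inr .x => exact fun h => h
  | .inr .y => exact fun h => h

/-! ### The Laplacian as a sum over the labels -/

section Terms

variable {V : Type*} (E : Gen → V → V → Prop)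

open Classical in
/-- The contribution of the outgoing edge with label `s`. -/
noncomputable def outTerm (s : Gen) (f : V → ℝ) (p : V) : ℝ :=
  if h : ∃ q, E s p q then f p - f h.choose else 0

open Classical in
/-- The contribution of the incoming edge with label `s`. -/
noncomputable def inTerm (s : Gen) (f : V → ℝ) (p : V) : ℝ :=
  if h : ∃ q, E s q p then f p - f h.choose else 0

variable {E}

theorem outTerm_of_edge (hr : ∀ s p q q', E s p q → E s p q' → q = q') {s : Gen} {p q : V}
    (h : E s p q) (f : V → ℝ) : outTerm E s f p = f p - f q := by
  have h' : ∃ q, E s p q := ⟨q, h⟩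
  rw [outTerm, dif_pos h', hr s p _ _ h'.choose_spec h]

theorem outTerm_of_not {s : Gen} {p : V} (h : ∀ q, ¬ E s p q) (f : V → ℝ) :
    outTerm E s f p = 0 := by
  rw [outTerm, dif_neg fun h' => h _ h'.choose_spec]

theorem inTerm_of_edge (hl : ∀ s p p' q, E s p q → E s p' q → p = p') {s : Gen} {p q : V}
    (h : E s q p) (f : V → ℝ) : inTerm E s f p = f p - f q := by
  have h' : ∃ q, E s q p := ⟨q, h⟩
  rw [inTerm, dif_pos h', hl s _ _ p h'.choose_spec h]

theorem inTerm_of_not {s : Gen} {p : V} (h : ∀ q, ¬ E s q p) (f : V → ℝ) :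
    inTerm E s f p = 0 := by
  rw [inTerm, dif_neg fun h' => h _ h'.choose_spec]

/-- Regrouping by label and direction leaves at most one edge per term, so multiple edges need no
bookkeeping; loops contribute zero. -/
theorem lapFun_eq_sum (hr : ∀ s p q q', E s p q → E s p q' → q = q')
    (hl : ∀ s p p' q, E s p q → E s p' q → p = p') (f : V → ℝ) (p : V) :
    lapFun E f p = ∑ s, (outTerm E s f p + inTerm E s f p) := by
  classical
  have ho : ∀ s, HasSum (fun q => (if E s p q then (1 : ℝ) else 0) * (f p - f q))
      (outTerm E s f p) := by
    intro s
    by_cases h : ∃ q, E s p q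
    · obtain ⟨q, hq⟩ := h
      rw [outTerm_of_edge hr hq]
      convert hasSum_single q ?_ using 1
      · simp [hq]
      · intro q' hne
        rw [if_neg fun h => hne (hr s p _ _ h hq), zero_mul]
    · push Not at h
      rw [outTerm_of_not h]
      simp [h, hasSum_zero]
  have hi : ∀ s, HasSum (fun q => (if E s q p then (1 : ℝ) else 0) * (f p - f q))
      (inTerm E s f p) := by
    intro s
    by_cases h : ∃ q, E s q p
    · obtain ⟨q, hq⟩ := h
      rw [inTerm_of_edge hl hq]
      convert hasSum_single q ?_ using 1
      · simp [hq]
      · intro q' hne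
        rw [if_neg fun h => hne (hl s _ _ p h hq), zero_mul]
    · push Not at h
      rw [inTerm_of_not h]
      simp [h, hasSum_zero]
  have := hasSum_sum (s := Finset.univ) fun s _ => (ho s).add (hi s)
  refine (this.congr_fun ?_).tsum_eq
  intro q
  simp only [edgeCount, Nat.cast_sum, Nat.cast_add, Nat.cast_ite, Nat.cast_one, Nat.cast_zero,
    Finset.sum_mul, add_mul]

theorem outTerm_add (s : Gen) (f g : V → ℝ) (p : V) :
    outTerm E s (f + g) p = outTerm E s f p + outTerm E s g p := by
  by_cases h : ∃ q, E s p q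
  · simp only [outTerm, dif_pos h, Pi.add_apply]; ring
  · simp [outTerm, dif_neg h]

theorem inTerm_add (s : Gen) (f g : V → ℝ) (p : V) :
    inTerm E s (f + g) p = inTerm E s f p + inTerm E s g p := by
  by_cases h : ∃ q, E s q p
  · simp only [inTerm, dif_pos h, Pi.add_apply]; ring
  · simp [inTerm, dif_neg h]

theorem outTerm_smul (s : Gen) (c : ℝ) (f : V → ℝ) (p : V) :
    outTerm E s (c • f) p = c * outTerm E s f p := by
  by_cases h : ∃ q, E s p q
  · simp only [outTerm, dif_pos h, Pi.smul_apply, smul_eq_mul]; ring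
  · simp [outTerm, dif_neg h]

theorem inTerm_smul (s : Gen) (c : ℝ) (f : V → ℝ) (p : V) :
    inTerm E s (c • f) p = c * inTerm E s f p := by
  by_cases h : ∃ q, E s q p
  · simp only [inTerm, dif_pos h, Pi.smul_apply, smul_eq_mul]; ring
  · simp [inTerm, dif_neg h]

variable (E) in
/-- The Laplacian as a linear map on all functions. -/
noncomputable def lapLin (hr : ∀ s p q q', E s p q → E s p q' → q = q')
    (hl : ∀ s p p' q, E s p q → E s p' q → p = p') : (V → ℝ) →ₗ[ℝ] (V → ℝ) where
  toFun := lapFun E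
  map_add' f g := by
    ext p
    simp only [Pi.add_apply, lapFun_eq_sum hr hl, outTerm_add, inTerm_add,
      ← Finset.sum_add_distrib]
    exact Finset.sum_congr rfl fun s _ => by ring
  map_smul' c f := by
    ext p
    simp only [Pi.smul_apply, smul_eq_mul, RingHom.id_apply, lapFun_eq_sum hr hl, outTerm_smul,
      inTerm_smul, Finset.mul_sum]
    exact Finset.sum_congr rfl fun s _ => by ring

end Terms

theorem edge_ru (n : ℕ) : ∀ s p q q', Edge n s p q → Edge n s p q' → q = q' :=
  fun _ _ _ _ => edge_right_unique

theorem edge_lu (n : ℕ) : ∀ s p p' q, Edge n s p q → Edge n s p' q → p = p' :=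
  fun _ _ _ _ => edge_left_unique

/-- The Laplacian of `G_n` as a linear map. -/
noncomputable def lap (n : ℕ) : (Vtx n → ℝ) →ₗ[ℝ] (Vtx n → ℝ) :=
  lapLin (Edge n) (edge_ru n) (edge_lu n)

theorem lap_eq_sum {n : ℕ} (f : Vtx n → ℝ) (u : Vtx n) :
    lap n f u = ∑ s, (outTerm (Edge n) s f u + inTerm (Edge n) s f u) :=
  lapFun_eq_sum (edge_ru n) (edge_lu n) f u

open Matrix in
theorem lapMatrix_mulVec_eq_lap (n : ℕ) (f : Vtx n → ℝ) : lapMatrix n *ᵥ f = lap n f := by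
  ext u
  rw [lapMatrix_mulVec]
  exact (tsum_fintype _).symm

/-- At a non-boundary vertex of an embedded copy of `G_n` the two Laplacians agree. -/
theorem lapFun_map {V : Type*} {E : Gen → V → V → Prop}
    (hr : ∀ s p q q', E s p q → E s p q' → q = q')
    (hl : ∀ s p p' q, E s p q → E s p' q → p = p') {n : ℕ} {φ : Vtx n → V}
    (hφ : ∀ s u v, Edge n s u v → E s (φ u) (φ v)) (f : V → ℝ) (w : Word n) :
    lapFun E f (φ (.inl w)) = lap n (f ∘ φ) (.inl w) := by
  rw [lapFun_eq_sum hr hl, lap_eq_sum]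
  refine Finset.sum_congr rfl fun s _ => ?_
  obtain ⟨v, hv⟩ := exists_edge_from n w s
  obtain ⟨v', hv'⟩ := exists_edge_to n w s
  rw [outTerm_of_edge hr (hφ _ _ _ hv), inTerm_of_edge hl (hφ _ _ _ hv'),
    outTerm_of_edge (edge_ru n) hv,
    inTerm_of_edge (edge_lu n) hv']
  rfl

theorem lap_x {n : ℕ} (hn : 1 ≤ n) {u : Vtx n} (h : Edge n (bdryLabel n) u (.inr .x))
    (f : Vtx n → ℝ) : lap n f (.inr .x) = f (.inr .x) - f u := by
  rw [lap_eq_sum, sum_gen n, inTerm_of_edge (edge_lu n) h,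
    inTerm_of_not (not_edge_x hn), outTerm_of_not fun _ h => h, outTerm_of_not fun _ h => h]
  ring

theorem not_edge_to_y {n : ℕ} {s : Gen} (v : Vtx n) : ¬ Edge n s v (.inr .y) := by
  rcases v with w | (_ | _) <;> exact fun h => h

theorem lap_y {n : ℕ} {u : Vtx n} (h : Edge n (bdryLabel n) (.inr .y) u)
    (f : Vtx n → ℝ) : lap n f (.inr .y) = f (.inr .y) - f u := by
  rw [lap_eq_sum, sum_gen n, outTerm_of_edge (edge_ru n) h,
    outTerm_of_not not_edge_y, inTerm_of_not not_edge_to_y,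
    inTerm_of_not not_edge_to_y]
  ring

/-! ### The decomposition of `G_{n+2}` -/

/-- The copy of `G_n` in `G_{n+2}` at `x`. -/
def left (n : ℕ) : Vtx n → Vtx (n + 2)
  | .inl w => .inl ⟨w.1 ++ [false, false], by simp [w.2.1], .append_zeroZero w.2.2⟩
  | .inr .x => .inr .x
  | .inr .y => .inl ⟨zeros n ++ [false, true], by simp, .append_zeroOne _⟩

/-- The copy of `G_n` in `G_{n+2}` at `y`. -/
def right (n : ℕ) : Vtx n → Vtx (n + 2)
  | .inl w => .inl ⟨w.1 ++ [false, true], by simp [w.2.1], .append_zeroOne _⟩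
  | .inr .x => .inl ⟨zeros n ++ [false, true], by simp, .append_zeroOne _⟩
  | .inr .y => .inr .y

/-- The copy of `G_{n+1}` in `G_{n+2}`, with its boundary vertices identified. -/
def loop (n : ℕ) : Vtx (n + 1) → Vtx (n + 2)
  | .inl w => .inl ⟨w.1 ++ [true], by simp [w.2.1], .append_one _⟩
  | .inr _ => .inl ⟨zeros (n + 1) ++ [true], by simp, .append_one _⟩

theorem map_zeroZero {n : ℕ} (u : Vtx n) : Step.map .zeroZero u = left n u := by
  rcases u with w | (_ | _) <;> rfl

theorem map_zeroOne {n : ℕ} (u : Vtx n) : Step.map .zeroOne u = right n u := by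
  rcases u with w | (_ | _) <;> rfl

theorem map_one {n : ℕ} (u : Vtx (n + 1)) : Step.map .one u = loop n u := by
  rcases u with w | (_ | _) <;> rfl

/-- The vertex of `G_{n+2}` at which the three copies meet. -/
def mid (n : ℕ) : Word (n + 2) := ⟨zeros (n + 1) ++ [true], by simp, .append_one _⟩

theorem left_x (n : ℕ) : left n (.inr .x) = .inr .x := rfl

theorem right_y (n : ℕ) : right n (.inr .y) = .inr .y := rfl

theorem loop_bdry (n : ℕ) (b : Bdry) : loop n (.inr b) = .inl (mid n) := rfl

theorem left_y (n : ℕ) : left n (.inr .y) = .inl (mid n) := by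
  simp [left, mid, List.replicate_succ']

theorem right_x (n : ℕ) : right n (.inr .x) = .inl (mid n) := by
  simp [right, mid, List.replicate_succ']

theorem edge_left {n : ℕ} {s : Gen} {u v : Vtx n} (h : Edge n s u v) :
    Edge (n + 2) s (left n u) (left n v) := by
  simpa only [map_zeroZero] using! edge_map .zeroZero h

theorem edge_right {n : ℕ} {s : Gen} {u v : Vtx n} (h : Edge n s u v) :
    Edge (n + 2) s (right n u) (right n v) := by
  simpa only [map_zeroOne] using! edge_map .zeroOne h

theorem edge_loop {n : ℕ} {s : Gen} {u v : Vtx (n + 1)} (h : Edge (n + 1) s u v) :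
    Edge (n + 2) s (loop n u) (loop n v) := by
  simpa only [map_one] using! edge_map .one h

theorem lap_left {n : ℕ} (f : Vtx (n + 2) → ℝ) (w : Word n) :
    lap (n + 2) f (left n (.inl w)) = lap n (f ∘ left n) (.inl w) :=
  lapFun_map (edge_ru (n + 2)) (edge_lu (n + 2))
    (fun _ _ _ => edge_left) f w

theorem lap_right {n : ℕ} (f : Vtx (n + 2) → ℝ) (w : Word n) :
    lap (n + 2) f (right n (.inl w)) = lap n (f ∘ right n) (.inl w) :=
  lapFun_map (edge_ru (n + 2)) (edge_lu (n + 2))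
    (fun _ _ _ => edge_right) f w

theorem lap_loop {n : ℕ} (f : Vtx (n + 2) → ℝ) (w : Word (n + 1)) :
    lap (n + 2) f (loop n (.inl w)) = lap (n + 1) (f ∘ loop n) (.inl w) :=
  lapFun_map (edge_ru (n + 2)) (edge_lu (n + 2))
    (fun _ _ _ => edge_loop) f w

theorem lap_add_two_x {n : ℕ} (hn : 1 ≤ n) (f : Vtx (n + 2) → ℝ) :
    lap (n + 2) f (.inr .x) = lap n (f ∘ left n) (.inr .x) := by
  obtain ⟨w, hw⟩ := exists_edge_x hn
  have hw' := edge_left hw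
  rw [← bdryLabel_add_two] at hw'
  rw [lap_x hn hw, lap_x (by omega) hw']
  rfl

theorem lap_add_two_y {n : ℕ} (hn : 1 ≤ n) (f : Vtx (n + 2) → ℝ) :
    lap (n + 2) f (.inr .y) = lap n (f ∘ right n) (.inr .y) := by
  obtain ⟨w, hw⟩ := exists_edge_y hn
  have hw' := edge_right hw
  rw [← bdryLabel_add_two] at hw'
  rw [lap_y hw, lap_y hw']
  rfl

/-- The four edges at the common vertex are the boundary edges of the copies, so the Laplacian there
is the sum of four normal derivatives. With an eigenvalue equation this is the Kirchhoff condition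
used in all gluings. -/
theorem lap_mid {n : ℕ} (hn : 1 ≤ n) (f : Vtx (n + 2) → ℝ) :
    lap (n + 2) f (.inl (mid n)) = lap n (f ∘ left n) (.inr .y) + lap n (f ∘ right n) (.inr .x) +
      lap (n + 1) (f ∘ loop n) (.inr .x) + lap (n + 1) (f ∘ loop n) (.inr .y) := by
  obtain ⟨w₁, h₁⟩ := exists_edge_y hn
  obtain ⟨w₂, h₂⟩ := exists_edge_x hn
  obtain ⟨w₃, h₃⟩ := exists_edge_x (n := n + 1) (by omega)
  obtain ⟨w₄, h₄⟩ := exists_edge_y (n := n + 1) (by omega)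
  rw [lap_y h₁, lap_x hn h₂, lap_x (by omega) h₃, lap_y h₄, lap_eq_sum, sum_gen n]
  have e₁ := edge_left h₁
  have e₂ := edge_right h₂
  have e₃ := edge_loop h₃
  have e₄ := edge_loop h₄
  rw [left_y] at e₁
  rw [right_x] at e₂
  rw [loop_bdry] at e₃ e₄
  rw [outTerm_of_edge (edge_ru (n + 2)) e₁,
    inTerm_of_edge (edge_lu (n + 2)) e₂,
    inTerm_of_edge (edge_lu (n + 2)) e₃,
    outTerm_of_edge (edge_ru (n + 2)) e₄]
  simp only [Function.comp_apply, left_y, right_x, loop_bdry]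
  ring

theorem left_eq_iff {n : ℕ} {w : Word n} {u : Vtx n} :
    left n u = left n (.inl w) ↔ u = .inl w := by
  refine ⟨fun h => ?_, fun h => h ▸ rfl⟩
  match u with
  | .inl v =>
    simp only [left, Sum.inl.injEq, Subtype.mk.injEq, List.append_cancel_right_eq] at h
    rw [Subtype.ext h]
  | .inr .x => simp [left] at h
  | .inr .y =>
    exfalso
    simp only [left, Sum.inl.injEq, Subtype.mk.injEq] at h
    have := congrArg List.reverse h
    simp at this

theorem right_eq_iff {n : ℕ} {w : Word n} {u : Vtx n} :
    right n u = right n (.inl w) ↔ u = .inl w := by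
  refine ⟨fun h => ?_, fun h => h ▸ rfl⟩
  match u with
  | .inl v =>
    simp only [right, Sum.inl.injEq, Subtype.mk.injEq, List.append_cancel_right_eq] at h
    rw [Subtype.ext h]
  | .inr .y => simp [right] at h
  | .inr .x =>
    exfalso
    simp only [right, Sum.inl.injEq, Subtype.mk.injEq, List.append_cancel_right_eq] at h
    exact not_evenTail_zeros n (h ▸ w.2.2)

theorem loop_eq_iff {n : ℕ} {w : Word (n + 1)} {u : Vtx (n + 1)} :
    loop n u = loop n (.inl w) ↔ u = .inl w := by
  refine ⟨fun h => ?_, fun h => h ▸ rfl⟩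
  match u with
  | .inl v =>
    simp only [loop, Sum.inl.injEq, Subtype.mk.injEq, List.append_cancel_right_eq] at h
    rw [Subtype.ext h]
  | .inr b =>
    exfalso
    simp only [loop, Sum.inl.injEq, Subtype.mk.injEq, List.append_cancel_right_eq] at h
    exact not_evenTail_zeros (n + 1) (h ▸ w.2.2)

/-- The vertices of `G_{n+2}`: those of the three copies, the vertex at which the copies meet and
the two boundary vertices. -/
def assemble (n : ℕ) : ((Word n ⊕ Word n) ⊕ Word (n + 1)) ⊕ (Unit ⊕ Bdry) → Vtx (n + 2)
  | .inl (.inl (.inl w)) => left n (.inl w)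
  | .inl (.inl (.inr w)) => right n (.inl w)
  | .inl (.inr w) => loop n (.inl w)
  | .inr (.inl _) => .inl (mid n)
  | .inr (.inr b) => .inr b

/-- The ending of a word tells the copy. A word with a positive even tail comes from `left` by
removing `00`. For a word `v1` the trichotomy of `v` decides: zeros give `mid`, an even tail gives
`loop`, an odd tail gives `right`. -/
theorem assemble_bijective (n : ℕ) : Function.Bijective (assemble n) := by
  constructor
  · have h1 : ∀ (w : Word n), left n (.inl w) ≠ .inl (mid n) := fun w h => by
      rw [← left_y, eq_comm, left_eq_iff] at h
      cases h
    have h2 : ∀ (w : Word n), right n (.inl w) ≠ .inl (mid n) := fun w h => by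
      rw [← right_x, eq_comm, right_eq_iff] at h
      cases h
    have h3 : ∀ (w : Word (n + 1)), loop n (.inl w) ≠ .inl (mid n) := fun w h => by
      rw [← loop_bdry n .x, eq_comm, loop_eq_iff] at h
      cases h
    have h4 : ∀ (w v : Word n), left n (.inl w) ≠ right n (.inl v) := fun w v h => by
      simp only [left, right, Sum.inl.injEq, Subtype.mk.injEq] at h
      have := congrArg List.reverse h
      simp at this
    have h5 : ∀ (w : Word n) (v : Word (n + 1)), left n (.inl w) ≠ loop n (.inl v) := fun w v h => by
      simp only [left, loop, Sum.inl.injEq, Subtype.mk.injEq] at h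
      have := congrArg List.reverse h
      simp at this
    have h6 : ∀ (w : Word n) (v : Word (n + 1)), right n (.inl w) ≠ loop n (.inl v) := fun w v h => by
      simp only [right, loop, Sum.inl.injEq, Subtype.mk.injEq] at h
      have h := (List.append_assoc w.1 [false] [true]).trans h
      rw [List.append_cancel_right_eq] at h
      exact not_evenTail_append_false w.2.2 (h ▸ v.2.2)
    have h7 : ∀ (w : Word n) (b : Bdry), left n (.inl w) ≠ .inr b := fun w b h => by
      simp [left] at h
    have h8 : ∀ (w : Word n) (b : Bdry), right n (.inl w) ≠ .inr b := fun w b h => by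
      simp [right] at h
    have h9 : ∀ (w : Word (n + 1)) (b : Bdry), loop n (.inl w) ≠ .inr b := fun w b h => by
      simp [loop] at h
    rintro (((w | w) | w) | (w | w)) (((v | v) | v) | (v | v)) h <;>
      simp only [assemble] at h
    · rw [left_eq_iff] at h; cases h; rfl
    · exact absurd h (h4 _ _)
    · exact absurd h (h5 _ _)
    · exact absurd h (h1 _)
    · exact absurd h (h7 _ _)
    · exact absurd h.symm (h4 _ _)
    · rw [right_eq_iff] at h; cases h; rfl
    · exact absurd h (h6 _ _)
    · exact absurd h (h2 _)
    · exact absurd h (h8 _ _)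
    · exact absurd h.symm (h5 _ _)
    · exact absurd h.symm (h6 _ _)
    · rw [loop_eq_iff] at h; cases h; rfl
    · exact absurd h (h3 _)
    · exact absurd h (h9 _ _)
    · exact absurd h.symm (h1 _)
    · exact absurd h.symm (h2 _)
    · exact absurd h.symm (h3 _)
    · rfl
    · cases h
    · exact absurd h.symm (h7 _ _)
    · exact absurd h.symm (h8 _ _)
    · exact absurd h.symm (h9 _ _)
    · cases h
    · cases h; rfl
  · rintro (⟨u, hl, v, j, rfl⟩ | b)
    · cases j with
      | zero =>
        have hv : v.length = n + 1 := by simpa using hl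
        rcases word_trichotomy v with h | h | ⟨w, hw, rfl⟩
        · refine ⟨.inr (.inl ()), ?_⟩
          rw [hv] at h
          simp [assemble, mid, h]
        · exact ⟨.inl (.inr ⟨v, hv, h⟩), rfl⟩
        · refine ⟨.inl (.inl (.inr ⟨w, by simpa using hv, hw⟩)), ?_⟩
          simp [assemble, right]
      | succ j =>
        refine ⟨.inl (.inl (.inl ⟨v ++ true :: zeros (2 * j), ?_, v, j, rfl⟩)), ?_⟩
        · simp at hl ⊢
          omega
        · simp [assemble, left, Nat.mul_add]
          exact (zeros_add _ 2).symm
    · exact ⟨.inr (.inr b), rfl⟩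

/-- `assemble` as an equivalence. -/
noncomputable def assembleEquiv (n : ℕ) :
    ((Word n ⊕ Word n) ⊕ Word (n + 1)) ⊕ (Unit ⊕ Bdry) ≃ Vtx (n + 2) :=
  Equiv.ofBijective (assemble n) (assemble_bijective n)

theorem vtx_cases {n : ℕ} {P : Vtx (n + 2) → Prop} (hl : ∀ w, P (left n (.inl w)))
    (hr : ∀ w, P (right n (.inl w))) (ho : ∀ w, P (loop n (.inl w))) (hm : P (.inl (mid n)))
    (hb : ∀ b, P (.inr b)) (u : Vtx (n + 2)) : P u := by
  obtain ⟨(((w | w) | w) | (w | b)), rfl⟩ := (assemble_bijective n).2 u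
  exacts [hl w, hr w, ho w, hm, hb b]

/-- Functions on the three copies that agree at the common vertex can be glued. -/
theorem exists_glue {n : ℕ} {f g : Vtx n → ℝ} {h : Vtx (n + 1) → ℝ}
    (h₁ : g (.inr .x) = f (.inr .y)) (h₂ : h (.inr .x) = f (.inr .y))
    (h₃ : h (.inr .y) = f (.inr .y)) :
    ∃ k : Vtx (n + 2) → ℝ, k ∘ left n = f ∧ k ∘ right n = g ∧ k ∘ loop n = h := by
  set k : Vtx (n + 2) → ℝ := fun u => match (assembleEquiv n).symm u with
    | .inl (.inl (.inl w)) => f (.inl w)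
    | .inl (.inl (.inr w)) => g (.inl w)
    | .inl (.inr w) => h (.inl w)
    | .inr (.inl _) => f (.inr .y)
    | .inr (.inr .x) => f (.inr .x)
    | .inr (.inr .y) => g (.inr .y) with hk
  have hs : ∀ z, (assembleEquiv n).symm (assemble n z) = z := (assembleEquiv n).symm_apply_apply
  have hm : k (.inl (mid n)) = f (.inr .y) := by
    rw [hk]
    simp only
    rw [show Sum.inl (mid n) = assemble n (.inr (.inl ())) from rfl, hs]
  refine ⟨k, ?_, ?_, ?_⟩ <;> funext u
  · rcases u with w | (_ | _)
    · simp only [hk, Function.comp_apply]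
      rw [show left n (.inl w) = assemble n (.inl (.inl (.inl w))) from rfl, hs]
    · simp only [hk, Function.comp_apply]
      rw [show left n (.inr .x) = assemble n (.inr (.inr .x)) from rfl, hs]
    · rw [Function.comp_apply, left_y, hm]
  · rcases u with w | (_ | _)
    · simp only [hk, Function.comp_apply]
      rw [show right n (.inl w) = assemble n (.inl (.inl (.inr w))) from rfl, hs]
    · rw [Function.comp_apply, right_x, hm, h₁]
    · simp only [hk, Function.comp_apply]
      rw [show right n (.inr .y) = assemble n (.inr (.inr .y)) from rfl, hs]
  · rcases u with w | (_ | _)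
    · simp only [hk, Function.comp_apply]
      rw [show loop n (.inl w) = assemble n (.inl (.inr w)) from rfl, hs]
    · rw [Function.comp_apply, loop_bdry, hm, h₂]
    · rw [Function.comp_apply, loop_bdry, hm, h₃]

end Basilica

/-! ### Dirichlet eigenvalues, pivots and localized eigenfunctions. -/

namespace Basilica

/-! ### The response of `G_n` -/

/-- `f` satisfies the eigenvalue equation at all non-boundary vertices. -/
def IsSol (n : ℕ) (t : ℝ) (f : Vtx n → ℝ) : Prop := ∀ w : Word n, lap n f (.inl w) = t * f (.inl w)

/-- The only non-boundary vertex of `G_1`. -/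
def wordOne : Word 1 := ⟨[true], rfl, [], 0, rfl⟩

theorem eq_wordOne (w : Word 1) : w = wordOne := by
  obtain ⟨w, hl, he⟩ := w
  obtain ⟨c, rfl⟩ := List.length_eq_one_iff.1 hl
  cases c
  · exact absurd he.mem (by simp)
  · rfl

/-- The neighbour of the boundary vertices of `G_2`. -/
def wordZeroOne : Word 2 := ⟨[false, true], rfl, [false], 0, rfl⟩

/-- The other non-boundary vertex of `G_2`. -/
def wordOneOne : Word 2 := ⟨[true, true], rfl, [true], 0, rfl⟩

theorem eq_wordZeroOne_or (w : Word 2) : w = wordZeroOne ∨ w = wordOneOne := by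
  obtain ⟨w, hl, he⟩ := w
  obtain ⟨c, d, rfl⟩ := List.length_eq_two.1 hl
  cases c <;> cases d
  · exact absurd he.mem (by simp)
  · exact .inl rfl
  · exact absurd he (not_evenTail_one_zero [])
  · exact .inr rfl

theorem sum_gen_eq (F : Gen → ℝ) : ∑ s, F s = F .a + F .b := sum_gen 0 F

theorem lap_wordOne (f : Vtx 1 → ℝ) :
    lap 1 f (.inl wordOne) = 2 * f (.inl wordOne) - f (.inr .x) - f (.inr .y) := by
  have h₁ : Edge 1 .a (.inl wordOne) (.inl wordOne) := rfl
  have h₂ : Edge 1 .b (.inl wordOne) (.inr .x) := rfl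
  have h₃ : Edge 1 .b (.inr .y) (.inl wordOne) := rfl
  rw [lap_eq_sum, sum_gen_eq, outTerm_of_edge (edge_ru 1) h₁, inTerm_of_edge (edge_lu 1) h₁,
    outTerm_of_edge (edge_ru 1) h₂, inTerm_of_edge (edge_lu 1) h₃]
  ring

theorem lap_one_x (f : Vtx 1 → ℝ) : lap 1 f (.inr .x) = f (.inr .x) - f (.inl wordOne) :=
  lap_x le_rfl (show Edge 1 .b (.inl wordOne) (.inr .x) from rfl) f

theorem lap_one_y (f : Vtx 1 → ℝ) : lap 1 f (.inr .y) = f (.inr .y) - f (.inl wordOne) :=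
  lap_y (show Edge 1 .b (.inr .y) (.inl wordOne) from rfl) f

theorem lap_wordZeroOne (f : Vtx 2 → ℝ) :
    lap 2 f (.inl wordZeroOne) = 4 * f (.inl wordZeroOne) - 2 * f (.inl wordOneOne) -
      f (.inr .x) - f (.inr .y) := by
  have h₁ : Edge 2 .a (.inl wordZeroOne) (.inr .x) := rfl
  have h₂ : Edge 2 .a (.inr .y) (.inl wordZeroOne) := rfl
  have h₃ : Edge 2 .b (.inl wordZeroOne) (.inl wordOneOne) := rfl
  have h₄ : Edge 2 .b (.inl wordOneOne) (.inl wordZeroOne) := rfl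
  rw [lap_eq_sum, sum_gen_eq, outTerm_of_edge (edge_ru 2) h₁, inTerm_of_edge (edge_lu 2) h₂,
    outTerm_of_edge (edge_ru 2) h₃, inTerm_of_edge (edge_lu 2) h₄]
  ring

theorem lap_wordOneOne (f : Vtx 2 → ℝ) :
    lap 2 f (.inl wordOneOne) = 2 * f (.inl wordOneOne) - 2 * f (.inl wordZeroOne) := by
  have h₁ : Edge 2 .a (.inl wordOneOne) (.inl wordOneOne) := rfl
  have h₃ : Edge 2 .b (.inl wordZeroOne) (.inl wordOneOne) := rfl
  have h₄ : Edge 2 .b (.inl wordOneOne) (.inl wordZeroOne) := rfl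
  rw [lap_eq_sum, sum_gen_eq, outTerm_of_edge (edge_ru 2) h₁, inTerm_of_edge (edge_lu 2) h₁,
    outTerm_of_edge (edge_ru 2) h₄, inTerm_of_edge (edge_lu 2) h₃]
  ring

theorem lap_two_x (f : Vtx 2 → ℝ) : lap 2 f (.inr .x) = f (.inr .x) - f (.inl wordZeroOne) :=
  lap_x (by omega) (show Edge 2 .a (.inl wordZeroOne) (.inr .x) from rfl) f

theorem lap_two_y (f : Vtx 2 → ℝ) : lap 2 f (.inr .y) = f (.inr .y) - f (.inl wordZeroOne) :=
  lap_y (show Edge 2 .a (.inr .y) (.inl wordZeroOne) from rfl) f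

theorem IsSol.comp_left {n : ℕ} {t : ℝ} {f : Vtx (n + 2) → ℝ} (h : IsSol (n + 2) t f) :
    IsSol n t (f ∘ left n) := fun w => by
  rw [← lap_left]
  exact h _

theorem IsSol.comp_right {n : ℕ} {t : ℝ} {f : Vtx (n + 2) → ℝ} (h : IsSol (n + 2) t f) :
    IsSol n t (f ∘ right n) := fun w => by
  rw [← lap_right]
  exact h _

theorem IsSol.comp_loop {n : ℕ} {t : ℝ} {f : Vtx (n + 2) → ℝ} (h : IsSol (n + 2) t f) :
    IsSol (n + 1) t (f ∘ loop n) := fun w => by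
  rw [← lap_loop]
  exact h _

theorem isSol_add_two {n : ℕ} {t : ℝ} {f : Vtx (n + 2) → ℝ} (h₁ : IsSol n t (f ∘ left n))
    (h₂ : IsSol n t (f ∘ right n)) (h₃ : IsSol (n + 1) t (f ∘ loop n))
    (h₄ : lap (n + 2) f (.inl (mid n)) = t * f (.inl (mid n))) : IsSol (n + 2) t f := by
  intro w
  refine vtx_cases (P := fun u => (∃ b, u = .inr b) ∨ lap (n + 2) f u = t * f u)
    (fun w => .inr ?_) (fun w => .inr ?_) (fun w => .inr ?_) (.inr h₄) (fun b => .inl ⟨b, rfl⟩)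
    (.inl w) |>.resolve_left fun ⟨b, hb⟩ => by cases hb
  · rw [lap_left]; exact h₁ w
  · rw [lap_right]; exact h₂ w
  · rw [lap_loop]; exact h₃ w

/-- The boundary values of a solution determine the solution and its normal derivatives. -/
theorem IsSol.response {t : ℝ} : ∀ {n : ℕ}, 1 ≤ n → (∀ i < n, pivot i t ≠ 0) → ∀ {f : Vtx n → ℝ},
    IsSol n t f →
    lap n f (.inr .x) = respA (n + 1) t * f (.inr .x) + respB (n + 1) t * f (.inr .y) ∧
    lap n f (.inr .y) = respB (n + 1) t * f (.inr .x) + respA (n + 1) t * f (.inr .y) ∧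
    (f (.inr .x) = 0 → f (.inr .y) = 0 → f = 0)
  | 0, h, _, _, _ => absurd h (by omega)
  | 1, _, h, f, hf => by
    have h0 := h 0 (by omega)
    have e := hf wordOne
    rw [lap_wordOne] at e
    rw [pivot_zero] at h0
    have e' : f (.inl wordOne) = (f (.inr .x) + f (.inr .y)) / (2 - t) := by
      field_simp
      linarith
    rw [lap_one_x, lap_one_y, respA_add_two, respB_add_two, pivot_zero, respA_zero, respB_zero, e']
    refine ⟨by field_simp; ring, by field_simp; ring, fun hx hy => ?_⟩
    funext u
    rcases u with w | (_ | _)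
    · rw [eq_wordOne w, e', hx, hy]; simp
    · exact hx
    · exact hy
  | 2, _, h, f, hf => by
    have h0 := h 0 (by omega)
    have h1 := h 1 (by omega)
    have e₁ := hf wordZeroOne
    have e₂ := hf wordOneOne
    rw [lap_wordZeroOne] at e₁
    rw [lap_wordOneOne] at e₂
    have h1' := pivot_succ 0 t
    rw [respB_one, respB_zero] at h1'
    rw [pivot_zero] at h0 h1'
    have e₂' : f (.inl wordOneOne) = 2 * f (.inl wordZeroOne) / (2 - t) := by
      field_simp
      linarith
    have e₁' : pivot 1 t * f (.inl wordZeroOne) = f (.inr .x) + f (.inr .y) := by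
      rw [h1']
      rw [e₂'] at e₁
      field_simp at e₁ ⊢
      linarith
    have e₃ : f (.inl wordZeroOne) = (f (.inr .x) + f (.inr .y)) / pivot 1 t := by
      field_simp
      linarith
    rw [lap_two_x, lap_two_y, respA_add_two, respB_add_two, respA_one, respB_one, e₃]
    refine ⟨by field_simp; ring, by field_simp; ring, fun hx hy => ?_⟩
    funext u
    rcases u with w | (_ | _)
    · rcases eq_wordZeroOne_or w with rfl | rfl
      · rw [e₃, hx, hy]; simp
      · rw [e₂', e₃, hx, hy]; simp
    · exact hx
    · exact hy
  | n + 3, _, h, f, hf => by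
    obtain ⟨l₁, l₂, l₃⟩ := hf.comp_left.response (by omega) fun i hi => h i (by omega)
    obtain ⟨r₁, r₂, r₃⟩ := hf.comp_right.response (by omega) fun i hi => h i (by omega)
    obtain ⟨o₁, o₂, o₃⟩ := hf.comp_loop.response (by omega) fun i hi => h i (by omega)
    have hp : pivot (n + 2) t ≠ 0 := h _ (by omega)
    have e := hf (mid (n + 1))
    rw [lap_mid (by omega), l₂, r₁, o₁, o₂] at e
    simp only [Function.comp_apply, left_x, left_y, right_x, right_y, loop_bdry] at *
    -- The responses of the three copies turn the equation at `mid` into one whose coefficient of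
    -- the middle value is the pivot. Solving it is the Schur complement step behind `response`.
    have e' : pivot (n + 2) t * f (.inl (mid (n + 1))) =
        -respB (n + 2) t * (f (.inr .x) + f (.inr .y)) := by
      rw [pivot]
      linarith
    have e'' : f (.inl (mid (n + 1))) =
        -respB (n + 2) t * (f (.inr .x) + f (.inr .y)) / pivot (n + 2) t := by
      field_simp
      linarith
    have hA := respA_add_two (n + 2) t
    have hB := respB_add_two (n + 2) t
    have hx := lap_add_two_x (n := n + 1) (by omega) f
    have hy := lap_add_two_y (n := n + 1) (by omega) f
    rw [l₁] at hx
    rw [r₂] at hy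
    rw [hx, hy, hA, hB, e'']
    refine ⟨by field_simp; ring, by field_simp; ring, fun hx0 hy0 => ?_⟩
    have hm : f (.inl (mid (n + 1))) = 0 := by rw [e'', hx0, hy0]; simp
    have z₁ := l₃ hx0 hm
    have z₂ := r₃ hm hy0
    have z₃ := o₃ hm hm
    funext u
    refine vtx_cases (P := fun u => f u = 0) (fun w => congrFun z₁ _) (fun w => congrFun z₂ _)
      (fun w => congrFun z₃ _) hm (fun b => ?_) u
    cases b
    · exact hx0
    · exact hy0

/-- Extension by zero of functions on the non-boundary vertices. -/
def extendZero (n : ℕ) : (Word n → ℝ) →ₗ[ℝ] (Vtx n → ℝ) where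
  toFun h := Sum.elim h 0
  map_add' h h' := by ext u; cases u <;> simp
  map_smul' c h := by ext u; cases u <;> simp

/-- The Dirichlet Laplacian of `G_n`. -/
noncomputable def dirichletLap (n : ℕ) : (Word n → ℝ) →ₗ[ℝ] (Word n → ℝ) :=
  LinearMap.funLeft ℝ ℝ Sum.inl ∘ₗ lap n ∘ₗ extendZero n

theorem dirichletLap_apply {n : ℕ} (h : Word n → ℝ) (w : Word n) :
    dirichletLap n h w = lap n (extendZero n h) (.inl w) := rfl

/-- A Dirichlet eigenvalue is a zero of a pivot. -/
theorem mem_pivotZeros_of_dirichletLap {n : ℕ} (hn : 1 ≤ n) {t : ℝ} {h : Word n → ℝ}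
    (h0 : h ≠ 0) (he : dirichletLap n h = t • h) : t ∈ pivotZeros := by
  by_contra hz
  refine h0 ?_
  have hs : IsSol n t (extendZero n h) := fun w => congrFun he w
  have := (hs.response hn fun i _ hi => hz ⟨i, hi⟩).2.2 rfl rfl
  funext w
  exact congrFun this (.inl w)

/-- In finite dimensions uniqueness for the Dirichlet problem, which `IsSol.response` provides,
implies existence. -/
theorem exists_isSol {n : ℕ} (hn : 1 ≤ n) {t : ℝ} (ht : ∀ i < n, pivot i t ≠ 0) (α β : ℝ) :
    ∃ f, IsSol n t f ∧ f (.inr .x) = α ∧ f (.inr .y) = β := by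
  set T := dirichletLap n - t • LinearMap.id with hT
  have hinj : Function.Injective T := by
    rw [← LinearMap.ker_eq_bot, LinearMap.ker_eq_bot']
    intro h hh
    have hs : IsSol n t (extendZero n h) := fun w => by
      have := congrFun hh w
      simp only [hT, LinearMap.sub_apply, Pi.sub_apply, Pi.zero_apply, LinearMap.smul_apply,
        LinearMap.id_apply, Pi.smul_apply, smul_eq_mul] at this
      exact sub_eq_zero.1 this
    have := (hs.response hn ht).2.2 rfl rfl
    funext w
    exact congrFun this (.inl w)
  set g : Vtx n → ℝ := Sum.elim 0 (fun b => match b with | .x => α | .y => β) with hg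
  obtain ⟨h, hh⟩ := LinearMap.injective_iff_surjective.1 hinj fun w => -lap n g (.inl w)
  refine ⟨extendZero n h + g, fun w => ?_, by simp [extendZero, hg], by simp [extendZero, hg]⟩
  have := congrFun hh w
  simp only [hT, LinearMap.sub_apply, Pi.sub_apply, LinearMap.smul_apply, LinearMap.id_apply,
    Pi.smul_apply, smul_eq_mul, dirichletLap_apply] at this
  have e : (extendZero n h + g) (.inl w) = h w := by simp [extendZero, hg]
  rw [map_add, Pi.add_apply, e]
  linarith

/-- A first zero of a pivot is a Dirichlet eigenvalue, with a symmetric eigenfunction. -/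
theorem exists_dirichlet_eigenfunction {t : ℝ} : ∀ {k : ℕ}, pivot k t = 0 →
    (∀ i < k, pivot i t ≠ 0) → ∃ f : Vtx (k + 1) → ℝ, IsSol (k + 1) t f ∧ f (.inr .x) = 0 ∧
      f (.inr .y) = 0 ∧ lap (k + 1) f (.inr .x) = lap (k + 1) f (.inr .y) ∧ f ≠ 0
  | 0, h0, _ => by
    refine ⟨Sum.elim 1 0, fun w => ?_, rfl, rfl, ?_, fun h => ?_⟩
    · rw [pivot_zero] at h0
      rw [eq_wordOne w, lap_wordOne]
      simp
      linarith
    · rw [lap_one_x, lap_one_y]; rfl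
    · simpa using congrFun h (.inl wordOne)
  | 1, h0, hlt => by
    have h1 := hlt 0 one_pos
    rw [pivot_succ, respB_one, respB_zero] at h0
    rw [pivot_zero] at h0 h1
    have hne : wordOneOne ≠ wordZeroOne := by simp [wordOneOne, wordZeroOne]
    classical
    refine ⟨Sum.elim (fun w => if w = wordZeroOne then 1 else 2 / (2 - t)) 0, fun w => ?_, rfl, rfl,
      ?_, fun h => ?_⟩
    · rcases eq_wordZeroOne_or w with rfl | rfl
      · rw [lap_wordZeroOne]
        simp [hne]
        field_simp at h0 ⊢
        linarith
      · rw [lap_wordOneOne]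
        simp [hne]
        field_simp
        ring
    · rw [lap_two_x, lap_two_y]; rfl
    · simpa using congrFun h (.inl wordZeroOne)
  | k + 2, h0, hlt => by
    have ht : ∀ i < k + 1, pivot i t ≠ 0 := fun i hi => hlt i (by omega)
    -- The three pieces have the value `1` at `mid` and `0` at the outer boundary; the Kirchhoff
    -- condition is then `pivot (k + 2) t = 0`.
    obtain ⟨f, hf, hfx, hfy⟩ := exists_isSol (by omega) ht 0 1
    obtain ⟨g, hg, hgx, hgy⟩ := exists_isSol (by omega) ht 1 0
    obtain ⟨o, ho, hox, hoy⟩ := exists_isSol (n := k + 2) (by omega) hlt 1 1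
    obtain ⟨u, h₁, h₂, h₃⟩ := exists_glue (hgx.trans hfy.symm) (hox.trans hfy.symm)
      (hoy.trans hfy.symm)
    obtain ⟨l₁, l₂, -⟩ := hf.response (by omega) ht
    obtain ⟨r₁, r₂, -⟩ := hg.response (by omega) ht
    obtain ⟨o₁, o₂, -⟩ := ho.response (by omega) hlt
    have hm : u (.inl (mid (k + 1))) = 1 := by
      rw [← left_y]
      exact (congrFun h₁ _).trans hfy
    have e : lap (k + 3) u (.inl (mid (k + 1))) = t * u (.inl (mid (k + 1))) := by
      rw [lap_mid (by omega), h₁, h₂, h₃, l₂, r₁, o₁, o₂, hm, hfx, hfy, hgx, hgy, hox, hoy]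
      have : pivot (k + 2) t = 0 := h0
      rw [pivot] at this
      linarith
    refine ⟨u, isSol_add_two (h₁ ▸ hf) (h₂ ▸ hg) (h₃ ▸ ho) e, ?_, ?_, ?_, fun hu => ?_⟩
    · exact (congrFun h₁ (.inr .x)).trans hfx
    · exact (congrFun h₂ (.inr .y)).trans hgy
    · have hx := lap_add_two_x (n := k + 1) (by omega) u
      have hy := lap_add_two_y (n := k + 1) (by omega) u
      rw [h₁, l₁, hfx, hfy] at hx
      rw [h₂, r₂, hgx, hgy] at hy
      rw [hx, hy]
      ring
    · rw [hu] at hm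
      simp at hm

/-! ### Localized eigenfunctions -/

/-- The eigenfunctions on `G_n` that vanish at the boundary. -/
noncomputable def localized (n : ℕ) (t : ℝ) : Submodule ℝ (Vtx n → ℝ) :=
  LinearMap.ker (lap n - t • LinearMap.id) ⊓
    (LinearMap.ker (LinearMap.proj (R := ℝ) (φ := fun _ : Vtx n => ℝ) (.inr .x)) ⊓
      LinearMap.ker (LinearMap.proj (R := ℝ) (φ := fun _ : Vtx n => ℝ) (.inr .y)))

theorem mem_localized {n : ℕ} {t : ℝ} {f : Vtx n → ℝ} :
    f ∈ localized n t ↔ (∀ u, lap n f u = t * f u) ∧ f (.inr .x) = 0 ∧ f (.inr .y) = 0 := by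
  simp only [localized, Submodule.mem_inf, LinearMap.mem_ker, LinearMap.sub_apply,
    LinearMap.smul_apply, LinearMap.id_apply, LinearMap.proj_apply, sub_eq_zero, funext_iff,
    Pi.smul_apply, smul_eq_mul]

theorem mem_localized_iff {n : ℕ} {t : ℝ} {f : Vtx n → ℝ} :
    f ∈ localized n t ↔ IsSol n t f ∧ f (.inr .x) = 0 ∧ f (.inr .y) = 0 ∧
      lap n f (.inr .x) = 0 ∧ lap n f (.inr .y) = 0 := by
  rw [mem_localized]
  constructor
  · rintro ⟨h, hx, hy⟩
    exact ⟨fun w => h _, hx, hy, by rw [h, hx, mul_zero], by rw [h, hy, mul_zero]⟩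
  · rintro ⟨h, hx, hy, hx', hy'⟩
    refine ⟨?_, hx, hy⟩
    rintro (w | (_ | _))
    exacts [h w, by rw [hx', hx, mul_zero], by rw [hy', hy, mul_zero]]

theorem isSol_zero (n : ℕ) (t : ℝ) : IsSol n t 0 := fun w => by simp

/-- Two gluings remove the normal derivatives of the symmetric Dirichlet eigenfunction `f`. First
`f` and `-f` on the two outer copies cancel at the middle and leave opposite normal derivatives at
`x` and `y`. Then this function is placed on a `loop`, where `x` and `y` are identified and the two
derivatives cancel. -/
theorem exists_localized {t : ℝ} (ht : t ∈ pivotZeros) :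
    ∃ n, 1 ≤ n ∧ ∃ f ∈ localized n t, f ≠ 0 := by
  classical
  obtain ⟨k, hk0, hlt⟩ : ∃ k, pivot k t = 0 ∧ ∀ i < k, pivot i t ≠ 0 :=
    ⟨Nat.find ht, Nat.find_spec ht, fun i hi => Nat.find_min ht hi⟩
  obtain ⟨f, hf, hx, hy, hxy, hne⟩ := exists_dirichlet_eigenfunction hk0 hlt
  obtain ⟨g, g₁, g₂, g₃⟩ := exists_glue (f := f) (g := -f) (h := 0) (by simp [hx, hy])
    (by simp [hy]) (by simp [hy])
  have hf' : IsSol (k + 1) t (-f) := fun w => by simp [hf w]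
  have hgm : g (.inl (mid (k + 1))) = 0 := by
    rw [← left_y]
    exact (congrFun g₁ _).trans hy
  have hg : IsSol (k + 3) t g := by
    refine isSol_add_two (g₁ ▸ hf) (g₂ ▸ hf') (g₃ ▸ isSol_zero _ _) ?_
    rw [lap_mid (by omega), g₁, g₂, g₃, hgm]
    simp [hxy]
  have hgx : g (.inr .x) = 0 := (congrFun g₁ (.inr .x)).trans hx
  have hgy : g (.inr .y) = 0 := (congrFun g₂ (.inr .y)).trans (by simp [hy])
  have hgx' := lap_add_two_x (n := k + 1) (by omega) g
  have hgy' := lap_add_two_y (n := k + 1) (by omega) g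
  rw [g₁] at hgx'
  rw [g₂] at hgy'
  obtain ⟨h, h₁, h₂, h₃⟩ := exists_glue (n := k + 2) (f := 0) (g := 0) (h := g) rfl hgx hgy
  have hm : h (.inl (mid (k + 2))) = 0 := by
    rw [← left_y]
    exact congrFun h₁ _
  have hx0 := lap_add_two_x (n := k + 2) (by omega) h
  have hy0 := lap_add_two_y (n := k + 2) (by omega) h
  rw [h₁] at hx0
  rw [h₂] at hy0
  refine ⟨k + 4, by omega, h, mem_localized_iff.2
    ⟨?_, congrFun h₁ (.inr .x), congrFun h₂ (.inr .y), by simp [hx0], by simp [hy0]⟩, ?_⟩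
  · refine isSol_add_two (h₁ ▸ isSol_zero _ _) (h₂ ▸ isSol_zero _ _) (h₃ ▸ hg) ?_
    rw [lap_mid (by omega), h₁, h₂, h₃, hm]
    have e₁ : lap (k + 2 + 1) g (.inr .x) = lap (k + 1) f (.inr .x) := hgx'
    have e₂ : lap (k + 2 + 1) g (.inr .y) = lap (k + 1) (-f) (.inr .y) := hgy'
    rw [e₁, e₂]
    simp [hxy]
  · rintro rfl
    have : g = 0 := h₃.symm
    rw [this] at g₁
    exact hne g₁.symm

theorem finrank_add_le_finrank_prod {M N : Type*} [AddCommGroup M] [AddCommGroup N] [Module ℝ M]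
    [Module ℝ N] [FiniteDimensional ℝ M] [FiniteDimensional ℝ N] (p : Submodule ℝ M)
    (q : Submodule ℝ N) :
    Module.finrank ℝ p + Module.finrank ℝ q ≤ Module.finrank ℝ (p.prod q) := by
  rw [← Module.finrank_prod]
  refine LinearMap.finrank_le_finrank_of_injective
    (f := (p.subtype.prodMap q.subtype).codRestrict (p.prod q) fun z => ⟨z.1.2, z.2.2⟩) ?_
  intro a b h
  have h := congrArg Subtype.val h
  exact Prod.ext (Subtype.ext (congrArg Prod.fst h)) (Subtype.ext (congrArg Prod.snd h))

/-- Localized eigenfunctions on the three copies can be chosen independently: all values and normal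
derivatives at the gluing vertex vanish. -/
theorem finrank_localized_add_two {n : ℕ} (hn : 1 ≤ n) (t : ℝ) :
    2 * Module.finrank ℝ (localized n t) + Module.finrank ℝ (localized (n + 1) t) ≤
      Module.finrank ℝ (localized (n + 2) t) := by
  set Φ : (Vtx (n + 2) → ℝ) →ₗ[ℝ] ((Vtx n → ℝ) × (Vtx n → ℝ)) × (Vtx (n + 1) → ℝ) :=
    ((LinearMap.funLeft ℝ ℝ (left n)).prod (LinearMap.funLeft ℝ ℝ (right n))).prod
      (LinearMap.funLeft ℝ ℝ (loop n)) with hΦ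
  have hle : ((localized n t).prod (localized n t)).prod (localized (n + 1) t) ≤
      (localized (n + 2) t).map Φ := by
    rintro ⟨⟨f, g⟩, o⟩ ⟨⟨hf, hg⟩, ho⟩
    rw [SetLike.mem_coe, mem_localized_iff] at hf hg ho
    obtain ⟨hf, hfx, hfy, hfx', hfy'⟩ := hf
    obtain ⟨hg, hgx, hgy, hgx', hgy'⟩ := hg
    obtain ⟨ho, hox, hoy, hox', hoy'⟩ := ho
    obtain ⟨u, h₁, h₂, h₃⟩ := exists_glue (hgx.trans hfy.symm) (hox.trans hfy.symm)
      (hoy.trans hfy.symm)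
    have hm : u (.inl (mid n)) = 0 := by
      rw [← left_y]
      exact (congrFun h₁ _).trans hfy
    refine ⟨u, mem_localized_iff.2 ⟨?_, (congrFun h₁ (.inr .x)).trans hfx,
      (congrFun h₂ (.inr .y)).trans hgy, ?_, ?_⟩, ?_⟩
    · refine isSol_add_two (h₁ ▸ hf) (h₂ ▸ hg) (h₃ ▸ ho) ?_
      rw [lap_mid hn, h₁, h₂, h₃, hm, hfy', hgx', hox', hoy']
      ring
    · rw [lap_add_two_x hn, h₁, hfx']
    · rw [lap_add_two_y hn, h₂, hgy']
    · exact Prod.ext (Prod.ext h₁ h₂) h₃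
  have h1 := (Submodule.finrank_mono hle).trans (Submodule.finrank_map_le Φ _)
  have h2 := finrank_add_le_finrank_prod (localized n t) (localized n t)
  have h3 := finrank_add_le_finrank_prod ((localized n t).prod (localized n t))
    (localized (n + 1) t)
  omega

/-- The multiplicity of a zero of a pivot grows like the number of vertices. -/
theorem exists_two_pow_le_finrank_localized {t : ℝ} (ht : t ∈ pivotZeros) :
    ∃ m, ∀ n, 2 ^ n ≤ Module.finrank ℝ (localized (m + n) t) := by
  obtain ⟨m, hm, f, hf, hne⟩ := exists_localized ht
  set r : ℕ → ℕ := fun n => Module.finrank ℝ (localized n t) with hr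
  have h0 : 1 ≤ r m := by
    have : Nontrivial (localized m t) := ⟨⟨⟨f, hf⟩, 0, fun h => hne (congrArg Subtype.val h)⟩⟩
    exact Module.finrank_pos
  have hrec : ∀ n, 1 ≤ n → 2 * r n + r (n + 1) ≤ r (n + 2) := fun n hn =>
    finrank_localized_add_two hn t
  -- The recursion makes the sum of two consecutive dimensions at least double in each step.
  have hsum : ∀ n, 2 ^ n ≤ r (m + n) + r (m + n + 1) := by
    intro n
    induction n with
    | zero => simp; omega
    | succ n ih =>
      have h1 := hrec (m + n) (by omega)
      change 2 ^ (n + 1) ≤ r (m + n + 1) + r (m + n + 2)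
      rw [pow_succ]
      omega
  refine ⟨m + 2, fun n => ?_⟩
  have h1 := hrec (m + n) (by omega)
  have h2 := hsum n
  have h3 : m + 2 + n = m + n + 2 := by omega
  rw [h3]
  exact (show 2 ^ n ≤ r (m + n + 2) by omega)

/-- A localized eigenfunction extends by zero to each graph that contains a copy of `G_n`. -/
theorem exists_extension {V : Type*} {E : Gen → V → V → Prop}
    (hr : ∀ s p q q', E s p q → E s p q' → q = q')
    (hl : ∀ s p p' q, E s p q → E s p' q → p = p') {n : ℕ} (hn : 1 ≤ n) {φ : Vtx n → V}
    (hφ : ∀ s u v, Edge n s u v → E s (φ u) (φ v))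
    (hinj : ∀ u w, φ u = φ (.inl w) → u = .inl w) {t : ℝ} {f : Vtx n → ℝ}
    (hf : f ∈ localized n t) :
    ∃ g : V → ℝ, (∀ u, g (φ u) = f u) ∧ (∀ p, g p ≠ 0 → ∃ w, p = φ (.inl w)) ∧
      ∀ p, lapFun E g p = t * g p := by
  classical
  obtain ⟨hs, hx, hy, hx', hy'⟩ := mem_localized_iff.1 hf
  set g : V → ℝ := fun p => if h : ∃ w, p = φ (.inl w) then f (.inl h.choose) else 0 with hg
  have hgw : ∀ w, g (φ (.inl w)) = f (.inl w) := by
    intro w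
    have h : ∃ w', φ (.inl w) = φ (.inl w') := ⟨w, rfl⟩
    rw [hg]
    simp only
    rw [dif_pos h, ← hinj _ _ h.choose_spec]
  have hg0 : ∀ p, (∀ w, p ≠ φ (.inl w)) → g p = 0 := fun p hp =>
    dif_neg fun ⟨w, hw⟩ => hp w hw
  have hgφ : ∀ u, g (φ u) = f u := by
    rintro (w | b)
    · exact hgw w
    · rw [hg0 _ fun w hw => by cases hinj _ _ hw]
      cases b
      · exact hx.symm
      · exact hy.symm
  refine ⟨g, hgφ, fun p hp => ?_, fun p => ?_⟩
  · by_contra h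
    push Not at h
    exact hp (hg0 p h)
  by_cases hp : ∃ w, p = φ (.inl w)
  · obtain ⟨w, rfl⟩ := hp
    have : g ∘ φ = f := funext hgφ
    rw [lapFun_map hr hl hφ, this, hgw]
    exact hs w
  · push Not at hp
    rw [hg0 p hp, mul_zero, lapFun_eq_sum hr hl]
    refine Finset.sum_eq_zero fun s _ => ?_
    have hout : outTerm E s g p = 0 := by
      by_cases h : ∃ q, E s p q
      · obtain ⟨q, hq⟩ := h
        rw [outTerm_of_edge hr hq, hg0 p hp, zero_sub, neg_eq_zero]
        -- A neighbour of `p` inside the copy is joined, within `G_n`, to a boundary vertex lying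
        -- over `p`. The value of `f` at this neighbour is minus the normal derivative, which is
        -- zero.
        by_cases hqw : ∃ w, q = φ (.inl w)
        · obtain ⟨w, rfl⟩ := hqw
          obtain ⟨v, hv⟩ := exists_edge_to n w s
          have hpv := hl s _ _ _ hq (hφ _ _ _ hv)
          match v, hv with
          | .inl v, _ => exact absurd hpv (hp v)
          | .inr .y, hv =>
            have hs' : s = bdryLabel n := (eq_bdryLabel_or n s).resolve_right
              fun h => not_edge_y _ (h ▸ hv)
            rw [hs'] at hv
            rw [lap_y hv, hy, zero_sub, neg_eq_zero] at hy'
            rw [hgw, hy']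
          | .inr .x, hv => exact absurd hv id
        · push Not at hqw
          exact hg0 q hqw
      · push Not at h
        exact outTerm_of_not h g
    have hin : inTerm E s g p = 0 := by
      by_cases h : ∃ q, E s q p
      · obtain ⟨q, hq⟩ := h
        rw [inTerm_of_edge hl hq, hg0 p hp, zero_sub, neg_eq_zero]
        by_cases hqw : ∃ w, q = φ (.inl w)
        · obtain ⟨w, rfl⟩ := hqw
          obtain ⟨v, hv⟩ := exists_edge_from n w s
          have hpv := hr s _ _ _ hq (hφ _ _ _ hv)
          match v, hv with
          | .inl v, _ => exact absurd hpv (hp v)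
          | .inr .x, hv =>
            have hs' : s = bdryLabel n := (eq_bdryLabel_or n s).resolve_right
              fun h => not_edge_x hn _ (h ▸ hv)
            rw [hs'] at hv
            rw [lap_x hn hv, hx, zero_sub, neg_eq_zero] at hx'
            rw [hgw, hx']
          | .inr .y, hv => exact absurd hv id
        · push Not at hqw
          exact hg0 q hqw
      · push Not at h
        exact inTerm_of_not h g
    rw [hout, hin, add_zero]

end Basilica

/-! ### Approximate eigenvectors and eigenvalue counts. -/

namespace Basilica
open Matrix

/-! ### Real symmetric matrices -/

section Hermitian

variable {ι : Type*} [Fintype ι] [DecidableEq ι] {A : Matrix ι ι ℝ} (hA : A.IsHermitian)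

/-- The coefficient of `f` with respect to an eigenvector of the eigenvector basis. -/
noncomputable def eigenCoeff (i : ι) : (ι → ℝ) →ₗ[ℝ] ℝ where
  toFun f := (hA.eigenvectorBasis i : ι → ℝ) ⬝ᵥ f
  map_add' := dotProduct_add _
  map_smul' c f := dotProduct_smul c _ f

theorem eigenCoeff_eq_inner (i : ι) (f : ι → ℝ) :
    eigenCoeff hA i f = inner ℝ (hA.eigenvectorBasis i) (WithLp.toLp 2 f) := by
  simp only [eigenCoeff, LinearMap.coe_mk, AddHom.coe_mk, PiLp.inner_apply, dotProduct]
  refine Finset.sum_congr rfl fun u _ => ?_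
  simp [mul_comm]

theorem sum_eigenCoeff_sq (f : ι → ℝ) : ∑ i, eigenCoeff hA i f ^ 2 = ∑ u, f u ^ 2 := by
  have h := hA.eigenvectorBasis.sum_sq_norm_inner_right (WithLp.toLp 2 f)
  rw [EuclideanSpace.norm_sq_eq] at h
  simpa [← eigenCoeff_eq_inner] using h

theorem eigenCoeff_mulVec (i : ι) (f : ι → ℝ) :
    eigenCoeff hA i (A *ᵥ f) = hA.eigenvalues i * eigenCoeff hA i f := by
  have h := hA.mulVec_eigenvectorBasis i
  have ht : Aᵀ = A := (conjTranspose_eq_transpose_of_trivial A).symm.trans hA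
  simp only [eigenCoeff, LinearMap.coe_mk, AddHom.coe_mk]
  rw [dotProduct_mulVec, ← mulVec_transpose, ht, h, smul_dotProduct, smul_eq_mul]

theorem eigenCoeff_eigenvector (i j : ι) :
    eigenCoeff hA i (hA.eigenvectorBasis j : ι → ℝ) = if i = j then 1 else 0 := by
  rw [eigenCoeff_eq_inner]
  exact orthonormal_iff_ite.1 hA.eigenvectorBasis.orthonormal i j

theorem eq_zero_of_eigenCoeff {f : ι → ℝ} (h : ∀ i, eigenCoeff hA i f = 0) : f = 0 := by
  have := sum_eigenCoeff_sq hA f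
  simp only [h, ne_eq, OfNat.ofNat_ne_zero, not_false_eq_true, zero_pow,
    Finset.sum_const_zero] at this
  funext u
  exact pow_eq_zero_iff two_ne_zero |>.1
    ((Finset.sum_eq_zero_iff_of_nonneg fun u _ => sq_nonneg (f u)).1 this.symm u (Finset.mem_univ u))

theorem eigenCoeff_sub_smul (c : ℝ) (i : ι) (f : ι → ℝ) :
    eigenCoeff hA i (A *ᵥ f - c • f) = (hA.eigenvalues i - c) * eigenCoeff hA i f := by
  rw [map_sub, eigenCoeff_mulVec, map_smul, smul_eq_mul]
  ring

/-- The dimension of a space of eigenvectors is at most the multiplicity of the eigenvalue. -/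
theorem finrank_le_card_eigenvalues {t : ℝ} (P : Submodule ℝ (ι → ℝ))
    (hP : ∀ f ∈ P, A *ᵥ f = t • f) :
    Module.finrank ℝ P ≤ Fintype.card {i // hA.eigenvalues i = t} := by
  rw [← Module.finrank_fintype_fun_eq_card (R := ℝ)]
  refine LinearMap.finrank_le_finrank_of_injective
    (f := (LinearMap.pi fun i : {i // hA.eigenvalues i = t} => eigenCoeff hA i) ∘ₗ P.subtype) ?_
  rw [← LinearMap.ker_eq_bot, LinearMap.ker_eq_bot']
  rintro ⟨f, hf⟩ h
  refine Subtype.ext (eq_zero_of_eigenCoeff hA fun i => ?_)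
  by_cases hi : hA.eigenvalues i = t
  · exact congrFun h ⟨i, hi⟩
  · have h1 := eigenCoeff_sub_smul hA t i f
    rw [hP f hf, sub_self, map_zero] at h1
    exact (mul_eq_zero.1 h1.symm).resolve_left (sub_ne_zero.2 hi)

end Hermitian

/-- An approximate eigenvector is near an eigenvalue. -/
theorem exists_eigenvalue_near {ι : Type*} [Fintype ι] [DecidableEq ι] {A : Matrix ι ι ℝ}
    (hA : A.IsHermitian) {c r : ℝ} (hr : 0 ≤ r) {f : ι → ℝ} (hf : f ≠ 0)
    (h : ∑ u, (A *ᵥ f - c • f) u ^ 2 ≤ r ^ 2 * ∑ u, f u ^ 2) :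
    ∃ d : ℝ, ∃ g : ι → ℝ, g ≠ 0 ∧ A *ᵥ g = d • g ∧ |d - c| ≤ r := by
  suffices ∃ i, |hA.eigenvalues i - c| ≤ r by
    obtain ⟨i, hi⟩ := this
    refine ⟨hA.eigenvalues i, hA.eigenvectorBasis i, fun h0 => ?_,
      hA.mulVec_eigenvectorBasis i, hi⟩
    have := eigenCoeff_eigenvector hA i i
    rw [h0] at this
    simp at this
  -- If every eigenvalue were farther than `r` from `c`, Parseval's identity would make the residual
  -- strictly larger than `r` times the norm of `f`.
  by_contra hcon
  push Not at hcon
  rw [← sum_eigenCoeff_sq hA (A *ᵥ f - c • f), ← sum_eigenCoeff_sq hA f, Finset.mul_sum] at h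
  obtain ⟨i, hi⟩ : ∃ i, eigenCoeff hA i f ≠ 0 := by
    by_contra hall
    push Not at hall
    exact hf (eq_zero_of_eigenCoeff hA hall)
  refine absurd h (not_le.2 (Finset.sum_lt_sum (fun j _ => ?_) ⟨i, Finset.mem_univ i, ?_⟩))
  · rw [eigenCoeff_sub_smul, mul_pow]
    refine mul_le_mul_of_nonneg_right ?_ (sq_nonneg _)
    rw [← sq_abs (hA.eigenvalues j - c)]
    exact pow_le_pow_left₀ hr (hcon j).le 2
  · rw [eigenCoeff_sub_smul, mul_pow]
    refine mul_lt_mul_of_pos_right ?_ (sq_pos_of_ne_zero hi)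
    rw [← sq_abs (hA.eigenvalues i - c)]
    exact pow_lt_pow_left₀ (hcon i) hr two_ne_zero

/-! ### Dirichlet eigenvalues and zeros of pivots -/

theorem submatrix_mulVec_eq_dirichletLap (n : ℕ) (h : Word n → ℝ) :
    (lapMatrix n).submatrix Sum.inl Sum.inl *ᵥ h = dirichletLap n h := by
  funext w
  rw [dirichletLap_apply, ← lapMatrix_mulVec_eq_lap]
  simp [mulVec, dotProduct, extendZero, Fintype.sum_sum_type]

/-- An approximate Dirichlet eigenvector is near a zero of a pivot. -/
theorem exists_pivotZero_near {n : ℕ} (hn : 1 ≤ n) {c r : ℝ} (hr : 0 ≤ r) {f : Word n → ℝ}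
    (hf : f ≠ 0)
    (h : ∑ w, (dirichletLap n f w - c * f w) ^ 2 ≤ r ^ 2 * ∑ w, f w ^ 2) :
    ∃ d ∈ pivotZeros, |d - c| ≤ r := by
  classical
  obtain ⟨d, g, hg, hgd, hd⟩ := exists_eigenvalue_near ((lapMatrix_isHermitian n).submatrix Sum.inl)
    (c := c) hr hf (by rw [submatrix_mulVec_eq_dirichletLap]; exact h)
  rw [submatrix_mulVec_eq_dirichletLap] at hgd
  exact ⟨d, mem_pivotZeros_of_dirichletLap hn hg hgd, hd⟩

open Classical in
/-- There are at most two eigenvalues of `L_n` in an interval without zeros of the pivots. -/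
theorem card_eigenvalues_le_two {n : ℕ} (hn : 1 ≤ n) {c r : ℝ} (hr : 0 ≤ r)
    (hz : ∀ d ∈ pivotZeros, r < |d - c|) :
    Fintype.card {i // |(lapMatrix_isHermitian n).eigenvalues i - c| ≤ r} ≤ 2 := by
  set hA := lapMatrix_isHermitian n
  set J := {i // |hA.eigenvalues i - c| ≤ r}
  set Ψ : (J → ℝ) →ₗ[ℝ] (Vtx n → ℝ) :=
    Fintype.linearCombination ℝ (fun i : J => (hA.eigenvectorBasis i : Vtx n → ℝ)) with hΨ
  have hco : ∀ (y : J → ℝ) (i : Vtx n), eigenCoeff hA i (Ψ y) =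
      if h : |hA.eigenvalues i - c| ≤ r then y ⟨i, h⟩ else 0 := by
    intro y i
    rw [hΨ, Fintype.linearCombination_apply, map_sum]
    simp only [map_smul, eigenCoeff_eigenvector, smul_eq_mul, mul_ite, mul_one, mul_zero]
    split_ifs with h
    · rw [Finset.sum_eq_single ⟨i, h⟩]
      · simp
      · intro j _ hj
        rw [if_neg fun e => hj (Subtype.ext e.symm)]
      · simp
    · refine Finset.sum_eq_zero fun j _ => ?_
      rw [if_neg]
      rintro rfl
      exact h j.2
  set Θ : (J → ℝ) →ₗ[ℝ] (Bdry → ℝ) := LinearMap.funLeft ℝ ℝ Sum.inr ∘ₗ Ψ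
  -- A combination of these eigenvectors with zero boundary values is an approximate Dirichlet
  -- eigenvector with error `r`, hence gives a zero of a pivot within `r` of `c`. Injectivity bounds
  -- the count by the number of boundary vertices.
  have hinj : Function.Injective Θ := by
    rw [← LinearMap.ker_eq_bot, LinearMap.ker_eq_bot']
    intro y hy
    by_contra hy0
    have hy0' : Ψ y ≠ 0 := fun h0 => by
      refine hy0 (funext fun i => ?_)
      have := hco y i
      rw [h0, map_zero, dif_pos i.2] at this
      exact this.symm
    set f : Word n → ℝ := fun w => Ψ y (.inl w) with hf
    have hext : extendZero n f = Ψ y := by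
      funext u
      rcases u with w | b
      · rfl
      · exact (congrFun hy b).symm
    have hf0 : f ≠ 0 := fun h0 => by
      rw [h0, map_zero] at hext
      exact hy0' hext.symm
    have hle : ∑ w, (dirichletLap n f w - c * f w) ^ 2 ≤ r ^ 2 * ∑ w, f w ^ 2 := by
      have e1 : ∑ w, f w ^ 2 = ∑ u, Ψ y u ^ 2 := by
        rw [← hext]
        simp [extendZero, Fintype.sum_sum_type]
      have e2 : ∑ w, (dirichletLap n f w - c * f w) ^ 2 ≤
          ∑ u, (lapMatrix n *ᵥ Ψ y - c • Ψ y) u ^ 2 := by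
        rw [Fintype.sum_sum_type]
        simp only [dirichletLap_apply, hext, lapMatrix_mulVec_eq_lap]
        exact le_add_of_nonneg_right (Finset.sum_nonneg fun _ _ => sq_nonneg _)
      refine e2.trans ?_
      rw [e1, ← sum_eigenCoeff_sq hA (lapMatrix n *ᵥ Ψ y - c • Ψ y), ← sum_eigenCoeff_sq hA (Ψ y),
        Finset.mul_sum]
      refine Finset.sum_le_sum fun i _ => ?_
      rw [eigenCoeff_sub_smul, mul_pow, hco]
      split_ifs with h
      · refine mul_le_mul_of_nonneg_right ?_ (sq_nonneg _)
        rw [← sq_abs (hA.eigenvalues i - c)]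
        exact pow_le_pow_left₀ (abs_nonneg _) h 2
      · simp
    obtain ⟨d, hd, hdc⟩ := exists_pivotZero_near hn hr hf0 hle
    exact absurd hdc (not_le.2 (hz d hd))
  have := LinearMap.finrank_le_finrank_of_injective hinj
  rw [Module.finrank_fintype_fun_eq_card, Module.finrank_fintype_fun_eq_card] at this
  exact this

/-- The mass of a set is the number of eigenvalues that it contains, divided by the number of
vertices. -/
theorem spectralMeasure_apply (n : ℕ) {S : Set ℝ} (hS : MeasurableSet S)
    [DecidablePred fun i => (lapMatrix_isHermitian n).eigenvalues i ∈ S] :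
    spectralMeasure n S = (Fintype.card (Vtx n) : ENNReal)⁻¹ *
      Fintype.card {i // (lapMatrix_isHermitian n).eigenvalues i ∈ S} := by
  simp only [spectralMeasure, MeasureTheory.Measure.smul_apply,
    MeasureTheory.Measure.coe_finsetSum, Finset.sum_apply, smul_eq_mul]
  congr 1
  simp only [MeasureTheory.Measure.dirac_apply' _ hS, Set.indicator_apply, Pi.one_apply]
  rw [Finset.sum_boole, Fintype.card_subtype]

end Basilica

/-! ### Existence of the spectral measure by the method of moments. -/

namespace Basilica
open Matrix Filter Topology

/-! ### Traces of powers under perturbations -/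

section Trace

variable {ι : Type*} [Fintype ι]

/-- The sum of the absolute values of the entries of a matrix. -/
def entrySum (X : Matrix ι ι ℝ) : ℝ := ∑ u, ∑ v, |X u v|

theorem entrySum_add_le (X Y : Matrix ι ι ℝ) : entrySum (X + Y) ≤ entrySum X + entrySum Y := by
  simp only [entrySum, ← Finset.sum_add_distrib]
  exact Finset.sum_le_sum fun u _ => Finset.sum_le_sum fun v _ => abs_add_le _ _

theorem abs_trace_le_entrySum (X : Matrix ι ι ℝ) : |X.trace| ≤ entrySum X := by
  refine (Finset.abs_sum_le_sum_abs _ _).trans (Finset.sum_le_sum fun u _ => ?_)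
  exact Finset.single_le_sum (f := fun v => |X u v|) (fun v _ => abs_nonneg _) (Finset.mem_univ u)

theorem entrySum_mul_le {c : ℝ} (X : Matrix ι ι ℝ) {B : Matrix ι ι ℝ}
    (hB : ∀ u, ∑ v, |B u v| ≤ c) : entrySum (X * B) ≤ c * entrySum X := by
  calc entrySum (X * B) ≤ ∑ u, ∑ w, ∑ v, |X u v| * |B v w| := by
        refine Finset.sum_le_sum fun u _ => Finset.sum_le_sum fun w _ => ?_
        rw [mul_apply]
        refine (Finset.abs_sum_le_sum_abs _ _).trans (le_of_eq ?_)
        exact Finset.sum_congr rfl fun v _ => abs_mul _ _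
    _ = ∑ u, ∑ v, |X u v| * ∑ w, |B v w| := by
        refine Finset.sum_congr rfl fun u _ => ?_
        rw [Finset.sum_comm]
        exact Finset.sum_congr rfl fun v _ => (Finset.mul_sum _ _ _).symm
    _ ≤ ∑ u, ∑ v, |X u v| * c := by
        refine Finset.sum_le_sum fun u _ => Finset.sum_le_sum fun v _ => ?_
        exact mul_le_mul_of_nonneg_left (hB v) (abs_nonneg _)
    _ = c * entrySum X := by
        rw [entrySum, Finset.mul_sum]
        refine Finset.sum_congr rfl fun u _ => ?_
        rw [Finset.mul_sum]
        exact Finset.sum_congr rfl fun v _ => mul_comm _ _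

theorem entrySum_transpose (X : Matrix ι ι ℝ) : entrySum Xᵀ = entrySum X := by
  simp only [entrySum, transpose_apply]
  exact Finset.sum_comm

theorem entrySum_mul_le' {c : ℝ} {A : Matrix ι ι ℝ} (X : Matrix ι ι ℝ) (hs : Aᵀ = A)
    (hA : ∀ u, ∑ v, |A u v| ≤ c) : entrySum (A * X) ≤ c * entrySum X := by
  rw [← entrySum_transpose, transpose_mul, hs, ← entrySum_transpose X]
  exact entrySum_mul_le _ hA

variable [DecidableEq ι]

/-- Telescoping, with an `ℓ¹` norm that each multiplication enlarges by at most the row bound `8`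
(twice the maximal degree). The estimate does not depend on the size of the matrices. -/
theorem entrySum_pow_sub_pow_le {A B : Matrix ι ι ℝ} (hs : Aᵀ = A) (hA : ∀ u, ∑ v, |A u v| ≤ 8)
    (hB : ∀ u, ∑ v, |B u v| ≤ 8) (k : ℕ) :
    entrySum (A ^ k - B ^ k) ≤ k * 8 ^ k * entrySum (A - B) := by
  have h0 : 0 ≤ entrySum (A - B) :=
    Finset.sum_nonneg fun _ _ => Finset.sum_nonneg fun _ _ => abs_nonneg _
  induction k with
  | zero => simp [entrySum]
  | succ k ih =>
    have h1 : ∀ j : ℕ, entrySum ((A - B) * B ^ j) ≤ 8 ^ j * entrySum (A - B) := by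
      intro j
      induction j with
      | zero => simp
      | succ j ihj =>
        rw [pow_succ, ← mul_assoc]
        refine (entrySum_mul_le _ hB).trans ?_
        rw [pow_succ]
        linarith
    have e : A ^ (k + 1) - B ^ (k + 1) = A * (A ^ k - B ^ k) + (A - B) * B ^ k := by
      rw [pow_succ', pow_succ', mul_sub, sub_mul]
      abel
    rw [e]
    refine (entrySum_add_le _ _).trans ?_
    have h2 := entrySum_mul_le' (A ^ k - B ^ k) hs hA
    have h3 := h1 k
    have h4 : (8 : ℝ) ^ k * entrySum (A - B) ≤ 8 * 8 ^ k * entrySum (A - B) := by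
      have : (0 : ℝ) ≤ 8 ^ k * entrySum (A - B) := by positivity
      linarith
    push_cast
    rw [pow_succ]
    linarith

theorem trace_fromBlocks_diagonal {I J : Type*} [Fintype I] [Fintype J] (A : Matrix I I ℝ)
    (D : Matrix J J ℝ) : (fromBlocks A 0 0 D).trace = A.trace + D.trace := by
  simp [trace, Fintype.sum_sum_type]

/-- Removing rows and columns changes the traces of powers by a bounded amount. -/
theorem abs_trace_pow_sub_le {I J : Type*} [Fintype I] [Fintype J] [DecidableEq I] [DecidableEq J]
    {M : Matrix (I ⊕ J) (I ⊕ J) ℝ} (hs : Mᵀ = M) (hM : ∀ u, ∑ v, |M u v| ≤ 8) (k : ℕ) :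
    |(M ^ k).trace - (M.toBlocks₁₁ ^ k).trace| ≤
      k * 8 ^ k * (16 * Fintype.card J) + Fintype.card J := by
  set B : Matrix (I ⊕ J) (I ⊕ J) ℝ := fromBlocks M.toBlocks₁₁ 0 0 0 with hB
  have hB8 : ∀ u, ∑ v, |B u v| ≤ 8 := by
    rintro (u | u)
    · refine le_trans ?_ (hM (.inl u))
      rw [Fintype.sum_sum_type, Fintype.sum_sum_type]
      simp only [hB, fromBlocks_apply₁₁, fromBlocks_apply₁₂, toBlocks₁₁, of_apply, Matrix.zero_apply,
        abs_zero, Finset.sum_const_zero, add_zero]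
      exact le_add_of_nonneg_right (Finset.sum_nonneg fun v _ => abs_nonneg (M (.inl u) (.inr v)))
    · rw [Fintype.sum_sum_type]
      simp [hB]
  have hsub : entrySum (M - B) ≤ 16 * Fintype.card J := by
    have e : ∀ u v, |(M - B) u v| ≤
        (match u with | .inl _ => 0 | .inr _ => |M u v|) +
        (match v with | .inl _ => 0 | .inr _ => |M u v|) := by
      rintro (u | u) (v | v) <;> simp [hB, toBlocks₁₁]
    calc entrySum (M - B) ≤ ∑ u, ∑ v, ((match u with | .inl _ => 0 | .inr _ => |M u v|) +
          (match v with | .inl _ => 0 | .inr _ => |M u v|)) :=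
          Finset.sum_le_sum fun u _ => Finset.sum_le_sum fun v _ => e u v
      _ = ∑ j : J, ∑ v, |M (.inr j) v| + ∑ j : J, ∑ u, |M u (.inr j)| := by
          simp only [Finset.sum_add_distrib]
          congr 1
          · rw [Fintype.sum_sum_type]
            simp
          · rw [Finset.sum_comm, Fintype.sum_sum_type]
            simp
      _ ≤ ∑ j : J, 8 + ∑ j : J, 8 := by
          refine add_le_add (Finset.sum_le_sum fun j _ => hM _) (Finset.sum_le_sum fun j _ => ?_)
          refine le_trans (le_of_eq ?_) (hM (.inr j))
          exact Finset.sum_congr rfl fun u _ => by rw [← transpose_apply M, hs]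
      _ = 16 * Fintype.card J := by
          simp
          ring
  have hBk : (B ^ k).trace = (M.toBlocks₁₁ ^ k).trace + ((0 : Matrix J J ℝ) ^ k).trace := by
    rw [hB, fromBlocks_diagonal_pow, trace_fromBlocks_diagonal]
  -- Equality occurs for `k = 0`, where the power of the zero block is the identity.
  have h0 : |((0 : Matrix J J ℝ) ^ k).trace| ≤ Fintype.card J := by
    cases k with
    | zero => simp
    | succ k => simp
  have h1 : |(M ^ k).trace - (B ^ k).trace| ≤ k * 8 ^ k * (16 * Fintype.card J) := by
    rw [← trace_sub]
    refine (abs_trace_le_entrySum _).trans ((entrySum_pow_sub_pow_le hs hM hB8 k).trans ?_)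
    exact mul_le_mul_of_nonneg_left hsub (by positivity)
  rw [hBk] at h1
  have h2 := abs_add_le ((M ^ k).trace - ((M.toBlocks₁₁ ^ k).trace + ((0 : Matrix J J ℝ) ^ k).trace))
    ((0 : Matrix J J ℝ) ^ k).trace
  rw [show (M ^ k).trace - ((M.toBlocks₁₁ ^ k).trace + ((0 : Matrix J J ℝ) ^ k).trace) +
    ((0 : Matrix J J ℝ) ^ k).trace = (M ^ k).trace - (M.toBlocks₁₁ ^ k).trace by ring] at h2
  linarith

theorem abs_trace_pow_sub_submatrix_le {I J : Type*} [Fintype I] [Fintype J] [DecidableEq I]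
    [DecidableEq J] {N : Matrix ι ι ℝ} (hs : Nᵀ = N) (hN : ∀ u, ∑ v, |N u v| ≤ 8) (k : ℕ)
    (e : I ⊕ J ≃ ι) :
    |(N ^ k).trace - ((N.submatrix e e).toBlocks₁₁ ^ k).trace| ≤
      k * 8 ^ k * (16 * Fintype.card J) + Fintype.card J := by
  have hpow : N.submatrix e e ^ k = (N ^ k).submatrix e e :=
    (map_pow (reindexAlgEquiv ℝ ℝ e.symm) N k).symm
  have htr : ((N ^ k).submatrix e e).trace = (N ^ k).trace := e.sum_comp fun v => (N ^ k) v v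
  rw [← htr, ← hpow]
  refine abs_trace_pow_sub_le (by rw [transpose_submatrix, hs]) (fun u => ?_) k
  simp only [submatrix_apply]
  rw [e.sum_comp fun v => |N (e u) v|]
  exact hN _

theorem trace_fromBlocks_pow {I J : Type*} [Fintype I] [Fintype J] [DecidableEq I] [DecidableEq J]
    (A : Matrix I I ℝ) (D : Matrix J J ℝ) (k : ℕ) :
    ((fromBlocks (fromBlocks A 0 0 A) 0 0 D) ^ k).trace = 2 * (A ^ k).trace + (D ^ k).trace := by
  rw [fromBlocks_diagonal_pow, fromBlocks_diagonal_pow, trace_fromBlocks_diagonal,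
    trace_fromBlocks_diagonal]
  ring

theorem trace_pow_eq_sum_eigenvalues {A : Matrix ι ι ℝ} (hA : A.IsHermitian) (k : ℕ) :
    (A ^ k).trace = ∑ i, hA.eigenvalues i ^ k := by
  conv_lhs => rw [hA.spectral_theorem]
  rw [← map_pow, Unitary.conjStarAlgAut_apply, trace_mul_cycle, Unitary.coe_star_mul_self, one_mul,
    diagonal_pow, trace_diagonal]
  rfl

end Trace

/-! ### The moments of the spectral measures -/

theorem lapMatrix_transpose (n : ℕ) : (lapMatrix n)ᵀ = lapMatrix n :=
  (conjTranspose_eq_transpose_of_trivial _).symm.trans (lapMatrix_isHermitian n)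

theorem sum_abs_lapMatrix_le (n : ℕ) (u : Vtx n) : ∑ v, |lapMatrix n u v| ≤ 8 := by
  classical
  have h4 : ∑ v, (edgeCount (Edge n) u v : ℝ) ≤ 4 := by
    exact_mod_cast sum_edgeCount_le (Edge n) (edge_ru n) (edge_lu n) u Finset.univ
  calc ∑ v, |lapMatrix n u v| ≤ ∑ v, ((if u = v then ∑ w, (edgeCount (Edge n) u w : ℝ) else 0) +
        (edgeCount (Edge n) u v : ℝ)) := by
        refine Finset.sum_le_sum fun v _ => ?_
        rw [lapMatrix, Matrix.sub_apply, diagonal_apply, of_apply]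
        refine (abs_sub _ _).trans (le_of_eq ?_)
        congr 1
        · split_ifs
          · exact abs_of_nonneg (Finset.sum_nonneg fun _ _ => Nat.cast_nonneg _)
          · exact abs_zero
        · exact abs_of_nonneg (Nat.cast_nonneg _)
    _ ≤ 8 := by
        rw [Finset.sum_add_distrib, Finset.sum_ite_eq, if_pos (Finset.mem_univ _)]
        linarith

theorem lapMatrix_apply {n : ℕ} (u v : Vtx n) :
    lapMatrix n u v = lap n (fun p => if p = v then 1 else 0) u := by
  rw [← lapMatrix_mulVec_eq_lap]
  simp [mulVec, dotProduct]

theorem left_eq_assemble {n : ℕ} {u : Vtx n} {z} (h : left n u = assemble n (.inl z)) :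
    ∃ w, u = .inl w ∧ z = .inl (.inl w) := by
  rcases u with w | (_ | _)
  · exact ⟨w, rfl, Sum.inl_injective
      ((assemble_bijective n).1 (a₁ := .inl (.inl (.inl w))) h).symm⟩
  · cases (assemble_bijective n).1 (a₁ := .inr (.inr .x)) h
  · rw [left_y] at h
    cases (assemble_bijective n).1 (a₁ := .inr (.inl ())) h

theorem right_eq_assemble {n : ℕ} {u : Vtx n} {z} (h : right n u = assemble n (.inl z)) :
    ∃ w, u = .inl w ∧ z = .inl (.inr w) := by
  rcases u with w | (_ | _)
  · exact ⟨w, rfl, Sum.inl_injective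
      ((assemble_bijective n).1 (a₁ := .inl (.inl (.inr w))) h).symm⟩
  · rw [right_x] at h
    cases (assemble_bijective n).1 (a₁ := .inr (.inl ())) h
  · cases (assemble_bijective n).1 (a₁ := .inr (.inr .y)) h

theorem loop_eq_assemble {n : ℕ} {u : Vtx (n + 1)} {z} (h : loop n u = assemble n (.inl z)) :
    ∃ w, u = .inl w ∧ z = .inr w := by
  rcases u with w | b
  · exact ⟨w, rfl, Sum.inl_injective ((assemble_bijective n).1 (a₁ := .inl (.inr w)) h).symm⟩
  · rw [loop_bdry] at h
    cases (assemble_bijective n).1 (a₁ := .inr (.inl ())) h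

/-- The matrix of the Dirichlet Laplacian. -/
noncomputable def dirichletMatrix (n : ℕ) : Matrix (Word n) (Word n) ℝ :=
  (lapMatrix n).toBlocks₁₁

/-- The three copies touch only at `mid`; deleting it and the two boundary vertices makes the matrix
block diagonal with Dirichlet blocks. -/
theorem toBlocks₁₁_lapMatrix_add_two (n : ℕ) :
    ((lapMatrix (n + 2)).submatrix (assembleEquiv n) (assembleEquiv n)).toBlocks₁₁ =
      fromBlocks (fromBlocks (dirichletMatrix n) 0 0 (dirichletMatrix n)) 0 0
        (dirichletMatrix (n + 1)) := by
  have hl : ∀ w z, lapMatrix (n + 2) (left n (.inl w)) (assemble n (.inl z)) =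
      match z with
      | .inl (.inl v) => lapMatrix n (.inl w) (.inl v)
      | _ => 0 := by
    intro w z
    rw [lapMatrix_apply, lap_left]
    split
    · rename_i v
      rw [lapMatrix_apply]
      exact congrFun (congrArg (lap n) (funext fun u => if_congr left_eq_iff rfl rfl)) _
    · rename_i hz
      have : (fun p => if p = assemble n (.inl z) then (1 : ℝ) else 0) ∘ left n = 0 := by
        funext u
        refine if_neg fun h => ?_
        obtain ⟨w, -, hw⟩ := left_eq_assemble h
        exact hz w hw
      rw [this]
      simp
  have hr : ∀ w z, lapMatrix (n + 2) (right n (.inl w)) (assemble n (.inl z)) =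
      match z with
      | .inl (.inr v) => lapMatrix n (.inl w) (.inl v)
      | _ => 0 := by
    intro w z
    rw [lapMatrix_apply, lap_right]
    split
    · rename_i v
      rw [lapMatrix_apply]
      exact congrFun (congrArg (lap n) (funext fun u => if_congr right_eq_iff rfl rfl)) _
    · rename_i hz
      have : (fun p => if p = assemble n (.inl z) then (1 : ℝ) else 0) ∘ right n = 0 := by
        funext u
        refine if_neg fun h => ?_
        obtain ⟨w, -, hw⟩ := right_eq_assemble h
        exact hz w hw
      rw [this]
      simp
  have ho : ∀ w z, lapMatrix (n + 2) (loop n (.inl w)) (assemble n (.inl z)) =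
      match z with
      | .inr v => lapMatrix (n + 1) (.inl w) (.inl v)
      | _ => 0 := by
    intro w z
    rw [lapMatrix_apply, lap_loop]
    split
    · rename_i v
      rw [lapMatrix_apply]
      exact congrFun (congrArg (lap (n + 1)) (funext fun u => if_congr loop_eq_iff rfl rfl)) _
    · rename_i hz
      have : (fun p => if p = assemble n (.inl z) then (1 : ℝ) else 0) ∘ loop n = 0 := by
        funext u
        refine if_neg fun h => ?_
        obtain ⟨w, -, hw⟩ := loop_eq_assemble h
        exact hz w hw
      rw [this]
      simp
  ext ((w | w) | w) ((v | v) | v)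
  exacts [hl w (.inl (.inl v)), hl w (.inl (.inr v)), hl w (.inr v), hr w (.inl (.inl v)),
    hr w (.inl (.inr v)), hr w (.inr v), ho w (.inl (.inl v)), ho w (.inl (.inr v)),
    ho w (.inr v)]

/-- The trace of a power of `L_n`. -/
noncomputable def lapTrace (k n : ℕ) : ℝ := (lapMatrix n ^ k).trace

theorem abs_lapTrace_sub_dirichlet_le (k n : ℕ) :
    |lapTrace k n - (dirichletMatrix n ^ k).trace| ≤ k * 8 ^ k * 32 + 2 := by
  classical
  have h := abs_trace_pow_sub_le (lapMatrix_transpose n) (sum_abs_lapMatrix_le n) k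
  have hc : (Fintype.card Bdry : ℝ) = 2 := by
    exact_mod_cast (rfl : Fintype.card Bdry = 2)
  rw [hc] at h
  have e : lapTrace k n = (lapMatrix n ^ k).trace := rfl
  have e' : dirichletMatrix n = (lapMatrix n).toBlocks₁₁ := rfl
  rw [e, e']
  convert h using 2
  ring

theorem abs_lapTrace_add_two_le (k n : ℕ) :
    |lapTrace k (n + 2) - (2 * (dirichletMatrix n ^ k).trace +
      (dirichletMatrix (n + 1) ^ k).trace)| ≤ k * 8 ^ k * 48 + 3 := by
  classical
  have h := abs_trace_pow_sub_submatrix_le (lapMatrix_transpose (n + 2))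
    (sum_abs_lapMatrix_le (n + 2)) k (assembleEquiv n)
  have hc : (Fintype.card (Unit ⊕ Bdry) : ℝ) = 3 := by
    exact_mod_cast (rfl : Fintype.card (Unit ⊕ Bdry) = 3)
  rw [hc, toBlocks₁₁_lapMatrix_add_two, trace_fromBlocks_pow] at h
  rw [lapTrace]
  convert h using 2
  ring

theorem exists_abs_lapTrace_rec_le (k : ℕ) :
    ∃ C, ∀ n, |lapTrace k (n + 2) - lapTrace k (n + 1) - 2 * lapTrace k n| ≤ C := by
  -- Three vertices are removed from `G_{n+2}`, and two from each of the three copies: `144 = 48 + 3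
  -- * 32` and `9 = 3 + 3 * 2`.
  refine ⟨k * 8 ^ k * 144 + 9, fun n => ?_⟩
  have h1 := abs_le.1 (abs_lapTrace_add_two_le k n)
  have h2 := abs_le.1 (abs_lapTrace_sub_dirichlet_le k n)
  have h3 := abs_le.1 (abs_lapTrace_sub_dirichlet_le k (n + 1))
  exact abs_le.2 ⟨by linarith, by linarith⟩

/-- The characteristic polynomial is `(X - 2)(X + 1)`. The defect `t (n + 1) - 2 t n` changes sign
at each step up to a bounded error, so it is negligible against `2 ^ n`; the crude rate `(3 / 2) ^
n` suffices. -/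
theorem exists_tendsto_div_two_pow {t : ℕ → ℝ} {C : ℝ}
    (h : ∀ n, |t (n + 2) - t (n + 1) - 2 * t n| ≤ C) :
    ∃ l, Tendsto (fun n => t n / 2 ^ n) atTop (𝓝 l) := by
  set z : ℕ → ℝ := fun n => t (n + 1) - 2 * t n with hz
  have hC : 0 ≤ C := (abs_nonneg _).trans (h 0)
  set K := |z 0| + 2 * C with hK
  have hzb : ∀ n, |z n| ≤ K * (3 / 2) ^ n := by
    intro n
    induction n with
    | zero => simp [hK]; exact hC
    | succ n ih =>
      have e : z (n + 1) = (t (n + 2) - t (n + 1) - 2 * t n) - z n := by simp only [hz]; ring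
      have h1 : |z (n + 1)| ≤ C + |z n| := by
        rw [e]
        exact (abs_sub _ _).trans (add_le_add_left (h n) _)
      have h2 : (1 : ℝ) ≤ (3 / 2) ^ n := one_le_pow₀ (by norm_num)
      have h3 : 2 * C ≤ K := by
        rw [hK]
        linarith [abs_nonneg (z 0)]
      rw [pow_succ]
      nlinarith
  refine cauchySeq_tendsto_of_complete (cauchySeq_of_le_geometric (3 / 4) (K / 2) (by norm_num)
    fun n => ?_)
  have e : t n / 2 ^ n - t (n + 1) / 2 ^ (n + 1) = -(z n / 2 ^ (n + 1)) := by
    simp only [hz]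
    field_simp
    ring
  rw [Real.dist_eq, e, abs_neg, abs_div, abs_of_pos (by positivity : (0 : ℝ) < 2 ^ (n + 1)),
    div_le_iff₀ (by positivity)]
  refine (hzb n).trans (le_of_eq ?_)
  rw [pow_succ, show (3 / 2 : ℝ) = 3 / 4 * 2 by norm_num, mul_pow]
  ring

theorem lapTrace_zero (n : ℕ) : lapTrace 0 n = Fintype.card (Vtx n) := by
  simp [lapTrace]

theorem exists_card_ge : ∃ m, ∀ n, 2 ^ n ≤ Fintype.card (Vtx (m + n)) := by
  obtain ⟨m, hm⟩ := exists_two_pow_le_finrank_localized two_mem_pivotZeros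
  refine ⟨m, fun n => (hm n).trans ?_⟩
  rw [← Module.finrank_fintype_fun_eq_card (R := ℝ)]
  exact Submodule.finrank_le _

/-- The zeroth moment counts the vertices. Positivity of the limit comes from the multiplicity of
the eigenvalue `2`. -/
theorem exists_tendsto_card : ∃ l, 0 < l ∧
    Tendsto (fun n => (Fintype.card (Vtx n) : ℝ) / 2 ^ n) atTop (𝓝 l) := by
  obtain ⟨C, hC⟩ := exists_abs_lapTrace_rec_le 0
  obtain ⟨l, hl⟩ := exists_tendsto_div_two_pow hC
  obtain ⟨m, hm⟩ := exists_card_ge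
  simp only [lapTrace_zero] at hl
  refine ⟨l, lt_of_lt_of_le (by positivity : (0 : ℝ) < 1 / 2 ^ m) ?_, hl⟩
  refine ge_of_tendsto hl (eventually_atTop.2 ⟨m, fun n hn => ?_⟩)
  obtain ⟨j, rfl⟩ := Nat.exists_eq_add_of_le hn
  have : (2 : ℝ) ^ j ≤ Fintype.card (Vtx (m + j)) := by exact_mod_cast hm j
  rw [div_le_div_iff₀ (by positivity) (by positivity), pow_add]
  have h2 : (0 : ℝ) < 2 ^ m := by positivity
  nlinarith

theorem abs_eigenvalues_le (n : ℕ) (i : Vtx n) :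
    |(lapMatrix_isHermitian n).eigenvalues i| ≤ 8 := by
  set hA := lapMatrix_isHermitian n
  set f : Vtx n → ℝ := (hA.eigenvectorBasis i).ofLp with hf
  have he : lapMatrix n *ᵥ f = hA.eigenvalues i • f := hA.mulVec_eigenvectorBasis i
  obtain ⟨u, hu⟩ := Finite.exists_max fun u => |f u|
  have hpos : 0 < |f u| := by
    by_contra h
    have h0 : f = 0 := funext fun v => abs_eq_zero.1
      (le_antisymm ((hu v).trans (not_lt.1 h)) (abs_nonneg _))
    have := eigenCoeff_eigenvector hA i i
    rw [← hf, h0] at this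
    simp at this
  have h1 : |hA.eigenvalues i| * |f u| ≤ 8 * |f u| := by
    rw [← abs_mul, ← smul_eq_mul, ← Pi.smul_apply, ← he]
    calc |(lapMatrix n *ᵥ f) u| ≤ ∑ v, |lapMatrix n u v| * |f v| := by
          simp only [mulVec, dotProduct, ← abs_mul]
          exact Finset.abs_sum_le_sum_abs _ _
      _ ≤ ∑ v, |lapMatrix n u v| * |f u| :=
          Finset.sum_le_sum fun v _ => mul_le_mul_of_nonneg_left (hu v) (abs_nonneg _)
      _ ≤ 8 * |f u| := by
          rw [← Finset.sum_mul]
          exact mul_le_mul_of_nonneg_right (sum_abs_lapMatrix_le n u) (abs_nonneg _)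
  exact le_of_mul_le_mul_right h1 hpos

/-- The average of a function over the eigenvalues of `L_n`. -/
noncomputable def spectralAverage (n : ℕ) (f : ℝ → ℝ) : ℝ :=
  (Fintype.card (Vtx n) : ℝ)⁻¹ * ∑ i, f ((lapMatrix_isHermitian n).eigenvalues i)

theorem integral_spectralMeasure (n : ℕ) (f : ℝ → ℝ) :
    ∫ x, f x ∂(spectralMeasure n) = spectralAverage n f := by
  rw [spectralMeasure, MeasureTheory.integral_smul_measure,
    MeasureTheory.integral_finsetSum_measure]
  · simp only [MeasureTheory.integral_dirac, spectralAverage, smul_eq_mul, ENNReal.toReal_inv,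
      ENNReal.toReal_natCast]
  · intro i _
    exact MeasureTheory.integrable_dirac (by simp)

theorem exists_tendsto_spectralAverage_pow (k : ℕ) :
    ∃ l, Tendsto (fun n => spectralAverage n fun x => x ^ k) atTop (𝓝 l) := by
  obtain ⟨C, hC⟩ := exists_abs_lapTrace_rec_le k
  obtain ⟨l, hl⟩ := exists_tendsto_div_two_pow hC
  obtain ⟨l₀, h₀, hl₀⟩ := exists_tendsto_card
  refine ⟨l / l₀, (hl.div hl₀ h₀.ne').congr fun n => ?_⟩
  simp only [Pi.div_apply]
  rw [div_div_div_cancel_right₀ (by positivity), lapTrace,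
    trace_pow_eq_sum_eigenvalues (lapMatrix_isHermitian n), spectralAverage, div_eq_inv_mul]

theorem exists_tendsto_spectralAverage_polynomial (p : Polynomial ℝ) :
    ∃ l, Tendsto (fun n => spectralAverage n fun x => p.eval x) atTop (𝓝 l) := by
  choose l hl using exists_tendsto_spectralAverage_pow
  refine ⟨∑ k ∈ Finset.range (p.natDegree + 1), p.coeff k * l k,
    (tendsto_finsetSum _ fun k _ => (hl k).const_mul (p.coeff k)).congr fun n => ?_⟩
  simp only [spectralAverage, Polynomial.eval_eq_sum_range, Finset.mul_sum]
  rw [Finset.sum_comm]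
  exact Finset.sum_congr rfl fun i _ => Finset.sum_congr rfl fun k _ => by ring

theorem abs_spectralAverage_sub_le {n : ℕ} {f g : ℝ → ℝ} {ε : ℝ}
    (h : ∀ x ∈ Set.Icc (-8 : ℝ) 8, |f x - g x| ≤ ε) :
    |spectralAverage n f - spectralAverage n g| ≤ ε := by
  have hc : (0 : ℝ) < Fintype.card (Vtx n) := Nat.cast_pos.2 Fintype.card_pos
  rw [spectralAverage, spectralAverage, ← mul_sub, ← Finset.sum_sub_distrib, abs_mul, abs_inv,
    abs_of_pos hc, inv_mul_le_iff₀ hc]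
  refine (Finset.abs_sum_le_sum_abs _ _).trans ((Finset.sum_le_sum fun i _ =>
    h _ (abs_le.1 (abs_eigenvalues_le n i))).trans (le_of_eq ?_))
  simp

/-- All eigenvalues lie in `[-8, 8]`, where `f` is uniformly approximated by polynomials, whose
averages converge. -/
theorem exists_tendsto_spectralAverage {f : ℝ → ℝ} (hf : Continuous f) :
    ∃ l, Tendsto (fun n => spectralAverage n f) atTop (𝓝 l) := by
  refine cauchySeq_tendsto_of_complete (Metric.cauchySeq_iff'.2 fun ε hε => ?_)
  obtain ⟨p, hp⟩ := exists_polynomial_near_of_continuousOn (-8) 8 f hf.continuousOn (ε / 4)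
    (by positivity)
  obtain ⟨l, hl⟩ := exists_tendsto_spectralAverage_polynomial p
  obtain ⟨N, hN⟩ := Metric.cauchySeq_iff'.1 hl.cauchySeq (ε / 4) (by positivity)
  refine ⟨N, fun n hn => ?_⟩
  have h1 := hN n hn
  have h2 : ∀ m, |spectralAverage m (fun x => p.eval x) - spectralAverage m f| ≤ ε / 4 :=
    fun m => abs_spectralAverage_sub_le fun x hx => (hp x hx).le
  have h3 := abs_le.1 (h2 n)
  have h4 := abs_le.1 (h2 N)
  rw [Real.dist_eq] at h1 ⊢
  have h5 := abs_lt.1 h1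
  exact abs_lt.2 ⟨by linarith, by linarith⟩

theorem spectralMeasure_compl_Icc (n : ℕ) : spectralMeasure n (Set.Icc (-8) 8)ᶜ = 0 := by
  classical
  rw [spectralMeasure_apply n measurableSet_Icc.compl]
  have : IsEmpty {i // (lapMatrix_isHermitian n).eigenvalues i ∈ (Set.Icc (-8 : ℝ) 8)ᶜ} :=
    ⟨fun i => i.2 (abs_le.1 (abs_eigenvalues_le n i))⟩
  rw [Fintype.card_eq_zero_iff.2 this, Nat.cast_zero, mul_zero]

/-- The KNS spectral measure exists. -/
theorem exists_isKNSMeasure : ∃ μ, IsKNSMeasure μ := by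
  have htight : MeasureTheory.IsTightMeasureSet
      {((μ : MeasureTheory.ProbabilityMeasure ℝ) : MeasureTheory.Measure ℝ) |
        μ ∈ Set.range spectralProbability} := by
    rw [MeasureTheory.isTightMeasureSet_iff_exists_isCompact_measure_compl_le]
    refine fun ε _ => ⟨Set.Icc (-8) 8, isCompact_Icc, ?_⟩
    rintro _ ⟨_, ⟨n, rfl⟩, rfl⟩
    exact (spectralMeasure_compl_Icc n).le.trans zero_le
  have hK := isCompact_closure_of_isTightMeasureSet htight
  -- Prokhorov's theorem gives a limit along an ultrafilter. As the averages of each continuous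
  -- function converge along all of `ℕ`, they converge to the same integrals.
  obtain ⟨μ, -, hμ⟩ := isCompact_iff_ultrafilter_le_nhds.1 hK
    ((hyperfilter ℕ : Ultrafilter ℕ).map spectralProbability) (by
      rw [le_principal_iff]
      exact Filter.mem_of_superset (Filter.range_mem_map) subset_closure)
  refine ⟨μ, MeasureTheory.ProbabilityMeasure.tendsto_iff_forall_integral_tendsto.2 fun f => ?_⟩
  have h1 := MeasureTheory.ProbabilityMeasure.tendsto_iff_forall_integral_tendsto.1
    (show Tendsto spectralProbability (hyperfilter ℕ : Filter ℕ) (𝓝 μ) from hμ) f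
  obtain ⟨l, hl⟩ := exists_tendsto_spectralAverage f.continuous
  have h2 : ∀ n, ∫ x, f x ∂(spectralProbability n : MeasureTheory.Measure ℝ) =
      spectralAverage n f := fun n => integral_spectralMeasure n f
  simp only [h2] at h1 ⊢
  have h3 : (hyperfilter ℕ : Filter ℕ) ≤ atTop := Nat.hyperfilter_le_atTop
  rw [tendsto_nhds_unique h1 (hl.mono_left h3)]
  exact hl

end Basilica

/-! ### Identification of the spectrum and of the support of `μ`. -/

namespace Basilica
open Filter Topology

/-! ### The embeddings of `G_n` into the blowups -/

/-- Only boundary vertices are ever identified; this persists to the limit and lets functions on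
non-boundary vertices be transported. -/
theorem map_eq_iff {n : ℕ} (t : Step) {w : Word n} {u : Vtx n} :
    t.map u = t.map (.inl w) ↔ u = .inl w := by
  cases t
  · cases n with
    | zero => exact absurd w.2.2.mem (by simp [List.length_eq_zero_iff.1 w.2.1])
    | succ n =>
      rw [map_one, map_one]
      exact loop_eq_iff
  · rw [map_zeroZero, map_zeroZero]
    exact left_eq_iff
  · rw [map_zeroOne, map_zeroOne]
    exact right_eq_iff

theorem exists_map_inl {n : ℕ} (t : Step) (w : Word n) : ∃ w', t.map (.inl w) = .inl w' := by
  cases t <;> exact ⟨_, rfl⟩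

theorem exists_map_one {n : ℕ} (u : Vtx n) : ∃ w', Step.map .one u = .inl w' := by
  cases u <;> exact ⟨_, rfl⟩

namespace Blowup

variable (B : Blowup)

theorem add_two_le_level (m : ℕ) : m + 2 ≤ B.level m := by
  induction m with
  | zero => exact le_rfl
  | succ m ih =>
    have : 1 ≤ (B.step m).size := by cases B.step m <;> simp [Step.size]
    simp only [level]
    omega

theorem exists_trans_inl {i j : ℕ} (h : i ≤ j) (w : Word (B.level i)) :
    ∃ w', B.trans i j h (.inl w) = .inl w' := by
  induction j, h using Nat.le_induction with
  | base => exact ⟨w, B.trans_self _ _⟩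
  | succ j h ih =>
    obtain ⟨w', hw'⟩ := ih
    rw [B.trans_succ h, hw']
    exact exists_map_inl _ _

theorem trans_eq_iff {i j : ℕ} (h : i ≤ j) {w : Word (B.level i)} {u : Vtx (B.level i)} :
    B.trans i j h u = B.trans i j h (.inl w) ↔ u = .inl w := by
  induction j, h using Nat.le_induction with
  | base => rw [trans_self, trans_self]
  | succ j h ih =>
    obtain ⟨w', hw'⟩ := B.exists_trans_inl h w
    rw [B.trans_succ h, B.trans_succ h, ← ih, hw']
    exact map_eq_iff _

theorem toLimit_eq_toLimit_inl_iff {m : ℕ} {w : Word (B.level m)} {u : Vtx (B.level m)} :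
    B.toLimit m u = B.toLimit m (.inl w) ↔ u = .inl w := by
  refine ⟨fun h => ?_, fun h => h ▸ rfl⟩
  obtain ⟨j, hj, _, h⟩ := (B.toLimit_eq_iff _ _).1 h
  exact (B.trans_eq_iff hj).1 h

theorem edge_toLimit (m : ℕ) (s : Gen) (u v : Vtx (B.level m)) (h : Edge (B.level m) s u v) :
    B.LimEdge s (B.toLimit m u) (B.toLimit m v) :=
  ⟨m, u, v, rfl, rfl, h⟩

variable {B}

/-- Every vertex of a generic blowup is a non-boundary vertex of all graphs of high level. -/
theorem IsGeneric.eventually_exists_inl (hB : B.IsGeneric) (p : B.Vertex) :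
    ∀ᶠ m in atTop, ∃ w, B.toLimit m (.inl w) = p := by
  obtain ⟨i, u, rfl⟩ := B.toLimit_surj p
  -- A step that appends `1` makes both boundary vertices non-boundary, and non-boundary vertices
  -- remain so.
  obtain ⟨j, hj, hij⟩ := hB.1.exists_gt i
  have hs : B.step j = .one := by
    have : B.level j + (B.step j).size = B.level j + 1 := hj
    cases h : B.step j <;> simp [h, Step.size] at this ⊢
  have h1 : ∃ w, B.trans i (j + 1) (hij.le.trans (Nat.le_succ j)) u = .inl w := by
    rw [B.trans_succ hij.le]
    have : ∀ (t : Step) (v : Vtx (B.level j)), t = .one → ∃ w, t.map v = .inl w := by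
      rintro _ v rfl
      exact exists_map_one v
    exact this _ _ hs
  obtain ⟨w, hw⟩ := h1
  refine eventually_atTop.2 ⟨j + 1, fun m hm => ?_⟩
  obtain ⟨w', hw'⟩ := B.exists_trans_inl hm w
  exact ⟨w', by rw [← hw', ← hw, B.toLimit_trans, B.toLimit_trans]⟩

/-! ### The spectrum of the Laplacian of a blowup -/

/-- A localized eigenfunction of a large enough `G_{k_j}` extends by zero to a finitely supported
eigenfunction of the blowup. -/
theorem mem_spectrum_of_mem_pivotZeros {t : ℝ} (ht : t ∈ pivotZeros) :
    t ∈ spectrum ℝ B.laplacian := by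
  obtain ⟨j, hj⟩ := exists_two_pow_le_finrank_localized ht
  obtain ⟨i, hi⟩ := Nat.exists_eq_add_of_le
    (show j ≤ B.level j from (Nat.le_add_right j 2).trans (B.add_two_le_level j))
  have hpos : 0 < Module.finrank ℝ (localized (B.level j) t) := by
    rw [hi]
    exact lt_of_lt_of_le (by positivity) (hj i)
  have := Module.finrank_pos_iff_exists_ne_zero.1 hpos
  obtain ⟨⟨f, hf⟩, hf0⟩ := this
  obtain ⟨g, hgf, hsupp, hg⟩ := exists_extension B.limEdge_right_unique B.limEdge_left_unique
    (show 1 ≤ B.level j by have := B.add_two_le_level j; omega) (B.edge_toLimit j)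
    (fun u w => B.toLimit_eq_toLimit_inl_iff.1) hf
  have hmem : Memℓp g 2 := (memℓp_zero ((Set.finite_range
    fun w : Word (B.level j) => B.toLimit j (.inl w)).subset fun p hp => by
      obtain ⟨w, rfl⟩ := hsupp p hp
      exact ⟨w, rfl⟩)).of_exponent_ge zero_le
  set G : lp (fun _ : B.Vertex => ℝ) 2 := ⟨g, hmem⟩ with hG
  have hG0 : G ≠ 0 := by
    intro h
    refine hf0 (Subtype.ext (funext fun u => ?_))
    refine (hgf u).symm.trans ?_
    exact congrArg (fun F : lp (fun _ : B.Vertex => ℝ) 2 => F (B.toLimit j u)) h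
  rw [spectrum.mem_iff, ContinuousLinearMap.isUnit_iff_bijective]
  refine fun h => hG0 (h.1 ?_)
  rw [map_zero]
  ext p
  change t * g p - lapFun B.LimEdge g p = 0
  rw [hg, sub_self]

theorem closure_pivotZeros_subset_spectrum : closure pivotZeros ⊆ spectrum ℝ B.laplacian :=
  closure_minimal (fun _ => mem_spectrum_of_mem_pivotZeros) (spectrum.isClosed _)

end Blowup

/-! ### The Laplacian on `ℓ²` is symmetric -/

section Symmetric

variable {V : Type*} {E : Gen → V → V → Prop}

open Classical in
theorem lapFun_single_of_ne {p q : V} (h : q ≠ p) (a : ℝ) :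
    lapFun E (Pi.single p a) q = -(edgeCount E q p : ℝ) * a := by
  rw [lapFun, tsum_eq_single p fun r hr => by simp [Pi.single_eq_of_ne hr, Pi.single_eq_of_ne h]]
  simp [Pi.single_eq_of_ne h]

open Classical in
theorem lapFun_single_comm (p q : V) :
    lapFun E (Pi.single p 1) q = lapFun E (Pi.single q 1) p := by
  by_cases h : q = p
  · rw [h]
  · rw [lapFun_single_of_ne h, lapFun_single_of_ne (Ne.symm h), edgeCount_comm]

variable (hr : ∀ s p q q', E s p q → E s p q' → q = q')
  (hl : ∀ s p p' q, E s p q → E s p' q → p = p')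

/-- A bounded operator is determined by its matrix coefficients at the point masses, and these are
symmetric because `edgeCount` is. -/
theorem isSelfAdjoint_graphLaplacian : IsSelfAdjoint (graphLaplacian E hr hl) := by
  classical
  rw [ContinuousLinearMap.isSelfAdjoint_iff']
  refine lp.ext_continuousLinearMap (by simp) fun p => ?_
  refine ContinuousLinearMap.ext_ring ?_
  ext q
  change ContinuousLinearMap.adjoint (graphLaplacian E hr hl) (lp.single 2 p (1 : ℝ)) q =
    lapFun E (Pi.single p 1) q
  have h1 := lp.inner_single_left (𝕜 := ℝ) q (1 : ℝ)
    (ContinuousLinearMap.adjoint (graphLaplacian E hr hl) (lp.single 2 p (1 : ℝ)))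
  rw [ContinuousLinearMap.adjoint_inner_right, lp.inner_single_right] at h1
  have h2 : ∀ x : ℝ, inner ℝ 1 x = x := fun x => by simp
  have h3 : ∀ x : ℝ, inner ℝ x 1 = x := fun x => by simp
  rw [h2, h3] at h1
  rw [← h1, lapFun_single_comm]
  rfl

end Symmetric

/-- A self-adjoint operator that is bounded below is invertible. -/
theorem isUnit_of_isSelfAdjoint {H : Type*} [NormedAddCommGroup H] [InnerProductSpace ℝ H]
    [CompleteSpace H] {T : H →L[ℝ] H} (hT : IsSelfAdjoint T) {c : ℝ} (hc : 0 < c)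
    (h : ∀ x, c * ‖x‖ ≤ ‖T x‖) : IsUnit T := by
  have hanti : AntilipschitzWith (Real.toNNReal c⁻¹) T := by
    refine T.antilipschitz_of_bound fun x => ?_
    rw [Real.coe_toNNReal _ (inv_nonneg.2 hc.le), inv_mul_eq_div, le_div_iff₀ hc, mul_comm]
    exact h x
  rw [ContinuousLinearMap.isUnit_iff_bijective,
    ContinuousLinearMap.bijective_iff_dense_range_and_antilipschitz]
  refine ⟨?_, _, hanti⟩
  rw [Submodule.topologicalClosure_eq_top_iff, Submodule.eq_bot_iff]
  intro x hx
  -- A vector orthogonal to the range is orthogonal to `T (T x)`, and this inner product is `‖T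
  -- x‖²`.
  have h0 : T x = 0 := by
    have : inner ℝ (T (T x)) x = 0 := hx _ ⟨T x, rfl⟩
    rw [← ContinuousLinearMap.adjoint_inner_right,
      ContinuousLinearMap.isSelfAdjoint_iff'.1 hT] at this
    exact inner_self_eq_zero.1 this
  exact hanti.injective (h0.trans (map_zero T).symm)

/-- A lower bound for an operator on `ℓ²` may be checked on finitely supported functions. -/
theorem le_norm_of_finite_support {V : Type*}
    (T : lp (fun _ : V => ℝ) 2 →L[ℝ] lp (fun _ : V => ℝ) 2) {c : ℝ}
    (h : ∀ g : lp (fun _ : V => ℝ) 2, {p | g p ≠ 0}.Finite → c * ‖g‖ ≤ ‖T g‖)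
    (g : lp (fun _ : V => ℝ) 2) : c * ‖g‖ ≤ ‖T g‖ := by
  classical
  have hs : HasSum (fun p => lp.single 2 p (g p)) g := lp.hasSum_single (by simp) g
  refine le_of_tendsto_of_tendsto ((hs.norm).const_mul c) ((T.continuous.tendsto g).comp hs).norm
    (Eventually.of_forall fun S => h _ ?_)
  refine S.finite_toSet.subset fun q hq => ?_
  by_contra hqS
  refine hq ?_
  rw [lp.coeFn_sum, Finset.sum_apply]
  refine Finset.sum_eq_zero fun p hp => ?_
  exact lp.single_apply_ne _ _ _ fun hqp => hqS (hqp ▸ hp)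

theorem norm_sq_eq_tsum {V : Type*} (g : lp (fun _ : V => ℝ) 2) : ‖g‖ ^ 2 = ∑' p, g p ^ 2 := by
  simpa using lp.norm_rpow_eq_tsum (p := 2) (by simp) g

theorem sum_sq_le_norm_sq {V : Type*} (g : lp (fun _ : V => ℝ) 2) (S : Finset V) :
    ∑ p ∈ S, g p ^ 2 ≤ ‖g‖ ^ 2 := by
  simpa using lp.sum_rpow_le_norm_rpow (p := 2) (by simp) g S

namespace Blowup

variable {B : Blowup}

/-- Away from the zeros of the pivots the Laplacian is bounded below on finitely supported
functions, which are supported in a finite graph. -/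
theorem IsGeneric.le_norm_sub (hB : B.IsGeneric) {c r : ℝ} (hr : 0 ≤ r)
    (hz : ∀ d ∈ pivotZeros, r < |d - c|) {g : lp (fun _ : B.Vertex => ℝ) 2}
    (hg : {p | g p ≠ 0}.Finite) :
    r * ‖g‖ ≤ ‖(algebraMap ℝ _ c - B.laplacian) g‖ := by
  classical
  -- At this level the whole support consists of non-boundary vertices, so `g` restricts to a
  -- Dirichlet function on one finite graph.
  obtain ⟨m, hm⟩ := ((Filter.eventually_all_finite hg).2
    fun p _ => hB.eventually_exists_inl p).exists
  set ι : Word (B.level m) → B.Vertex := fun w => B.toLimit m (.inl w) with hι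
  have hinj : Function.Injective ι := fun w w' h =>
    Sum.inl_injective (B.toLimit_eq_toLimit_inl_iff.1 h)
  have hsupp : Function.support (fun p => g p ^ 2) ⊆ Set.range ι := by
    intro p hp
    obtain ⟨w, hw⟩ := hm p (fun h => hp (by simp [h]))
    exact ⟨w, hw⟩
  set f : Word (B.level m) → ℝ := fun w => g (ι w) with hf
  have hfg : (g : B.Vertex → ℝ) ∘ B.toLimit m = extendZero (B.level m) f := by
    funext u
    rcases u with w | b
    · rfl
    · by_contra h
      obtain ⟨w, hw⟩ := hm _ (show g (B.toLimit m (.inr b)) ≠ 0 from h)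
      exact absurd (B.toLimit_eq_toLimit_inl_iff.1 hw.symm) (by simp)
  have hnorm : ‖g‖ ^ 2 = ∑ w, f w ^ 2 := by
    rw [norm_sq_eq_tsum, ← hinj.tsum_eq hsupp, tsum_fintype]
  have hLf : ∀ w, (algebraMap ℝ (lp (fun _ : B.Vertex => ℝ) 2 →L[ℝ] lp (fun _ : B.Vertex => ℝ) 2) c
      - B.laplacian) g (ι w) = c * f w - dirichletLap (B.level m) f w := by
    intro w
    rw [dirichletLap_apply, ← hfg, ← lapFun_map B.limEdge_right_unique B.limEdge_left_unique
      (B.edge_toLimit m)]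
    rfl
  by_contra hlt
  push Not at hlt
  have hg0 : f ≠ 0 := by
    intro h0
    have : ‖g‖ ^ 2 = 0 := by rw [hnorm, h0]; simp
    have : ‖g‖ = 0 := by simpa using this
    rw [this, mul_zero] at hlt
    exact absurd hlt (not_lt.2 (norm_nonneg _))
  -- The Dirichlet residual is the part of the residual of `g` on the copy; values elsewhere only
  -- add to the norm.
  have hle : ∑ w, (dirichletLap (B.level m) f w - c * f w) ^ 2 ≤ r ^ 2 * ∑ w, f w ^ 2 := by
    calc ∑ w, (dirichletLap (B.level m) f w - c * f w) ^ 2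
        = ∑ p ∈ Finset.univ.map ⟨ι, hinj⟩, (algebraMap ℝ
            (lp (fun _ : B.Vertex => ℝ) 2 →L[ℝ] lp (fun _ : B.Vertex => ℝ) 2) c
            - B.laplacian) g p ^ 2 := by
          rw [Finset.sum_map]
          refine Finset.sum_congr rfl fun w _ => ?_
          rw [Function.Embedding.coeFn_mk, hLf]
          ring
      _ ≤ _ := sum_sq_le_norm_sq _ _
      _ ≤ (r * ‖g‖) ^ 2 := pow_le_pow_left₀ (norm_nonneg _) hlt.le 2
      _ = r ^ 2 * ∑ w, f w ^ 2 := by rw [mul_pow, hnorm]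
  obtain ⟨d, hd, hdc⟩ := exists_pivotZero_near
    (show 1 ≤ B.level m by have := B.add_two_le_level m; omega) hr hg0 hle
  exact absurd hdc (not_le.2 (hz d hd))

end Blowup

/-- A point outside of the closure has a positive distance to the zeros of the pivots. -/
theorem exists_forall_lt_abs_sub {c : ℝ} (hc : c ∉ closure pivotZeros) :
    ∃ r > 0, ∀ d ∈ pivotZeros, r < |d - c| := by
  rw [Metric.mem_closure_iff] at hc
  push Not at hc
  obtain ⟨r, hr, h⟩ := hc
  refine ⟨r / 2, half_pos hr, fun d hd => ?_⟩
  have := h d hd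
  rw [dist_comm, Real.dist_eq] at this
  linarith

theorem Blowup.IsGeneric.spectrum_eq {B : Blowup} (hB : B.IsGeneric) :
    spectrum ℝ B.laplacian = closure pivotZeros := by
  refine Set.Subset.antisymm (fun c hc => ?_) B.closure_pivotZeros_subset_spectrum
  by_contra hcz
  obtain ⟨r, hr, hz⟩ := exists_forall_lt_abs_sub hcz
  refine hc (isUnit_of_isSelfAdjoint ?_ hr
    (le_norm_of_finite_support _ fun g hg => hB.le_norm_sub hr.le hz hg))
  exact (IsSelfAdjoint.algebraMap _ (.all c)).sub (isSelfAdjoint_graphLaplacian _ _)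

/-! ### The support of the spectral measure -/

open MeasureTheory

/-- The multiplicity of `t` is at least `2 ^ (n - m)` and `G_n` eventually has fewer than `(l + 1) 2
^ n` vertices. This uniform lower bound for the mass of the closed set `{t}` passes to the weak
limit. -/
theorem measure_singleton_pos {μ : ProbabilityMeasure ℝ} (hμ : IsKNSMeasure μ) {t : ℝ}
    (ht : t ∈ pivotZeros) : 0 < (μ : Measure ℝ) {t} := by
  classical
  obtain ⟨m, hm⟩ := exists_two_pow_le_finrank_localized ht
  obtain ⟨l, hl, hlim⟩ := exists_tendsto_card
  have hpos : 0 < ENNReal.ofReal (1 / (2 ^ m * (l + 1))) :=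
    ENNReal.ofReal_pos.2 (by positivity)
  refine hpos.trans_le (le_trans ?_ (ProbabilityMeasure.limsup_measure_closed_le_of_tendsto hμ
    (isClosed_singleton (x := t))))
  refine Filter.le_limsup_of_frequently_le' (Eventually.frequently ?_)
  filter_upwards [hlim.eventually_lt_const (lt_add_one l), eventually_ge_atTop m] with n hn hmn
  obtain ⟨j, rfl⟩ := Nat.exists_eq_add_of_le hmn
  change _ ≤ spectralMeasure (m + j) {t}
  rw [spectralMeasure_apply (m + j) (measurableSet_singleton t)]
  have h1 : 2 ^ j ≤ Fintype.card {i // (lapMatrix_isHermitian (m + j)).eigenvalues i ∈ ({t} : Set ℝ)} := by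
    refine (hm j).trans ((finrank_le_card_eigenvalues (lapMatrix_isHermitian (m + j))
      (localized (m + j) t) fun f hf => ?_).trans (Fintype.card_congr (Equiv.refl _)).le)
    rw [lapMatrix_mulVec_eq_lap]
    exact funext (mem_localized.1 hf).1
  rw [div_lt_iff₀ (by positivity)] at hn
  have hc : (0 : ℝ) < Fintype.card (Vtx (m + j)) := by exact_mod_cast Fintype.card_pos
  have h2 : ((Fintype.card (Vtx (m + j)) : ENNReal)⁻¹ * (2 ^ j : ℕ)) =
      ENNReal.ofReal (2 ^ j / Fintype.card (Vtx (m + j))) := by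
    rw [div_eq_inv_mul, ENNReal.ofReal_mul (by positivity), ENNReal.ofReal_inv_of_pos hc,
      ENNReal.ofReal_natCast, ← ENNReal.ofReal_natCast (2 ^ j), Nat.cast_pow, Nat.cast_ofNat]
  refine le_trans ?_ (mul_le_mul_right (Nat.cast_le.2 h1) _)
  rw [h2]
  refine ENNReal.ofReal_le_ofReal ?_
  rw [div_le_div_iff₀ (by positivity) hc]
  rw [pow_add] at hn
  nlinarith

/-- At most two eigenvalues lie in the ball while the number of vertices tends to infinity; the mass
of an open set is lower semicontinuous under weak limits. -/
theorem measure_ball_eq_zero {μ : ProbabilityMeasure ℝ} (hμ : IsKNSMeasure μ) {c r : ℝ}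
    (hr : 0 < r) (hz : ∀ d ∈ pivotZeros, r < |d - c|) :
    (μ : Measure ℝ) (Metric.ball c r) = 0 := by
  classical
  have hle : ∀ᶠ n in atTop, (spectralProbability n : Measure ℝ) (Metric.ball c r) ≤
      ENNReal.ofReal (2 / Fintype.card (Vtx n)) := by
    filter_upwards [eventually_ge_atTop 1] with n hn
    change spectralMeasure n _ ≤ _
    rw [spectralMeasure_apply n measurableSet_ball]
    have h1 : Fintype.card {i // (lapMatrix_isHermitian n).eigenvalues i ∈ Metric.ball c r} ≤ 2 :=
      (Fintype.card_subtype_mono _ _ fun i hi => (Metric.mem_ball.1 hi).le).trans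
        (card_eigenvalues_le_two hn hr.le hz)
    have hc : (0 : ℝ) < Fintype.card (Vtx n) := by exact_mod_cast Fintype.card_pos
    rw [div_eq_inv_mul, ENNReal.ofReal_mul (by positivity), ENNReal.ofReal_inv_of_pos hc,
      ENNReal.ofReal_natCast, ENNReal.ofReal_ofNat]
    exact mul_le_mul_right (by exact_mod_cast h1) _
  have hlim : Tendsto (fun n => ENNReal.ofReal (2 / Fintype.card (Vtx n))) atTop (𝓝 0) := by
    rw [← ENNReal.ofReal_zero]
    refine ENNReal.tendsto_ofReal (Tendsto.const_div_atTop ?_ 2)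
    obtain ⟨l, hl, hl'⟩ := exists_tendsto_card
    refine ((hl'.pos_mul_atTop hl
      (tendsto_pow_atTop_atTop_of_one_lt (one_lt_two (α := ℝ)))).congr fun n => ?_)
    rw [div_mul_cancel₀ _ (by positivity)]
  refine le_antisymm ((ProbabilityMeasure.le_liminf_measure_open_of_tendsto hμ
    Metric.isOpen_ball).trans ?_) zero_le
  rw [(tendsto_of_tendsto_of_tendsto_of_le_of_le' tendsto_const_nhds hlim
    (Eventually.of_forall fun _ => zero_le) hle).liminf_eq]

theorem IsKNSMeasure.support_eq {μ : ProbabilityMeasure ℝ} (hμ : IsKNSMeasure μ) :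
    (μ : Measure ℝ).support = closure pivotZeros := by
  refine Set.Subset.antisymm (fun c hc => ?_) (closure_minimal (fun t ht => ?_)
    Measure.isClosed_support)
  · by_contra hcz
    obtain ⟨r, hr, hz⟩ := exists_forall_lt_abs_sub hcz
    exact Measure.notMem_support_iff_exists.2
      ⟨_, Metric.ball_mem_nhds c hr, measure_ball_eq_zero hμ hr hz⟩ hc
  · by_contra h
    obtain ⟨U, hU, hU0⟩ := Measure.notMem_support_iff_exists.1 h
    exact (measure_singleton_pos hμ ht).ne'
      (measure_mono_null (Set.singleton_subset_iff.2 (mem_of_mem_nhds hU)) hU0)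

end Basilica

theorem mainTheorem8 :
    ∃ μ : MeasureTheory.ProbabilityMeasure ℝ, Basilica.IsKNSMeasure μ ∧
      ∀ B : Basilica.Blowup, B.IsGeneric →
        spectrum ℝ B.laplacian = (μ : MeasureTheory.Measure ℝ).support ∧
        Basilica.IsCantorSet (spectrum ℝ B.laplacian) := by
  obtain ⟨μ, hμ⟩ := Basilica.exists_isKNSMeasure
  refine ⟨μ, hμ, fun B hB => ⟨hB.spectrum_eq.trans hμ.support_eq.symm, ?_⟩⟩
  -- Boundedness of the set of zeros is read off from the spectrum of a bounded operator.
  have h : IsCompact (closure Basilica.pivotZeros) := hB.spectrum_eq ▸ spectrum.isCompact B.laplacian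
  rw [hB.spectrum_eq]
  exact Basilica.isCantorSet_closure_pivotZeros (h.isBounded.subset subset_closure)
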